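/- **Theorem (Calibration consistency).** *Setup.* Let $0<q<1$. For a weight profile $w=(w_1,\dots,w_n)$, $w_i>0$, put $\tilde w_i=w_i/\sum_j w_j$ and $n_{\mathrm{eff}}=(\sum_i w_i)^2/\sum_i w_i^2$. For scores $\rho=(\rho_1,\dots,\rho_n)\in\mathbb R^n$ let $\rho_{(1)}\le\dots\le\rho_{(n)}$ be the sorted scores, $\tilde w_{(1)},\dots,\tilde w_{(n)}$ the normalized weights in the same order, and $p_j=\sum_{i\le j}\tilde w_{(i)}$. Let $\hat F_w(t)=\sum_i\tilde w_i\mathbf 1[\rho_i\le t]$ and $\lambda_{\mathrm{WCP}}=\inf\{t:\hat F_w(t)\ge q\}$ (the weighted conformal threshold). For $c>0$ let $V\sim\mathrm{Dir}(c\,\tilde w_{(1)},\dots,c\,\tilde w_{(n)})$, $S_j=V_1+\dots+V_j$, $K=\min\{j:S_j\ge q\}$ and $\lambda_{\mathrm{post}}=\rho_{(K)}$. The law of $V$, for given $\rho$ and $w$, is called the posterior, with variance $\mathrm{Var}_c$; in the frequentist statements the weight profile is fixed and the scores are drawn independently from one probability law $P$ on $\mathbb R$ with distribution function $F$. 1.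 **Mean consistency.** If $\hat F_w(\lambda_{\mathrm{WCP}})\ne q$, there is a constant $C$ depending only on $\rho,w,q$ such that $|\mathbb E[\lambda_{\mathrm{post}}]-\lambda_{\mathrm{WCP}}|\le C/c$ for all $c>0$. 2. **Variance calibration.** (a) $\mathrm{Var}_c(S_j)=p_j(1-p_j)/(c+1)$ for all $c>0$ and all $j$. (b) $\mathrm{Var}_{\mathrm{freq}}(\hat F_w(t))=F(t)(1-F(t))/n_{\mathrm{eff}}$ for all $t$; and for any (test) law with distribution function $G$, $|\mathrm{Var}_{\mathrm{freq}}(\hat F_w(t))-G(t)(1-G(t))/n_{\mathrm{eff}}|\le|F(t)-G(t)|/n_{\mathrm{eff}}$. (c) If $p_j=F(t)\in(0,1)$, then for $c>0$: $\mathrm{Var}_c(S_j)=\mathrm{Var}_{\mathrm{freq}}(\hat F_w(t))$ if and only if $c=n_{\mathrm{eff}}-1$, and $\mathrm{Var}_c(S_j)<\mathrm{Var}_{\mathrm{freq}}(\hat F_w(t))$ if and only if $c>n_{\mathrm{eff}}-1$; for $c=n_{\mathrm{eff}}$ the two variances differ by at most $\mathrm{Var}_{\mathrm{freq}}(\hat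 F_w(t))/n_{\mathrm{eff}}$. (d) Consider any sequence of weight profiles $w^{(k)}$ (of any sizes) with $n_{\mathrm{eff}}^{(k)}\to\infty$, any scores $\rho^{(k)}$, any $c_k>0$, and a point $\lambda^*$ with $F(\lambda^*)=q$; let $k^*=\min\{j:p_j\ge q\}$. Then $\mathrm{Var}_{c_k}(S_{k^*})/\mathrm{Var}_{\mathrm{freq}}(\hat F_w(\lambda^*))\to1$ if and only if $c_k/n_{\mathrm{eff}}^{(k)}\to1$. 3. **Bernstein–von Mises alignment.** Let $w^{(k)}$ be a sequence of weight profiles with $n_{\mathrm{eff}}^{(k)}\to\infty$, let $F(\lambda^*)=q$, and let $F$ be differentiable at $\lambda^*$ with $F'(\lambda^*)=f>0$. Write $\sigma^2=q(1-q)/f^2$ and drop the index $k$. (a) Under the sampling law, $\sqrt{n_{\mathrm{eff}}}\,(\lambda_{\mathrm{WCP}}-\lambda^*)$ has asymptotic mean $0$ and asymptotic variance $\sigma^2$: its mean and second moment, truncated at level $M$, tend to $0$ and $\sigma^2$ as first $k\to\infty$ and then $M\to\infty$. If moreover $\sqrt{n_{\mathrm{eff}}}\max_i\tilde w_i\to0$,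 it converges in law to $N(0,\sigma^2)$. (b) With $c=n_{\mathrm{eff}}$, the posterior law of $\sqrt{n_{\mathrm{eff}}}\,(\lambda_{\mathrm{post}}-\lambda_{\mathrm{WCP}})$ converges weakly to $N(0,\sigma^2)$, in probability over the scores. (c) For other concentrations $c_k>0$: if $c_k/n_{\mathrm{eff}}\to\kappa\in(0,\infty)$, the limit of this posterior law is $N(0,\sigma^2/\kappa)$, so that the posterior is too concentrated for $\kappa>1$ and too diffuse for $\kappa<1$; if $c_k/n_{\mathrm{eff}}\to\infty$, then for every $x>0$ the posterior probability of $\sqrt{n_{\mathrm{eff}}}\,|\lambda_{\mathrm{post}}-\lambda_{\mathrm{WCP}}|\le x$ tends to $1$ in probability; if $c_k/n_{\mathrm{eff}}\to0$, it tends to $0$ in probability for every $x>0$. -/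

import Mathlib

open MeasureTheory ProbabilityTheory Filter Topology

noncomputable section

namespace WBCP

/-- Normalized weights `w̃ i = w i / ∑ j, w j`. -/
def normWeight {n : ℕ} (w : Fin n → ℝ) (i : Fin n) : ℝ := w i / ∑ j, w j

/-- Kish's effective sample size. -/
def nEff {n : ℕ} (w : Fin n → ℝ) : ℝ := (∑ i, w i) ^ 2 / ∑ i, w i ^ 2

/-- The order statistics of the scores `ρ` (indices start at `0`). -/
def sortedScore {n : ℕ} (ρ : Fin n → ℝ) (j : Fin n) : ℝ := ρ (Tuple.sort ρ j)

/-- The normalized weights, listed in the order of the sorted scores. -/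
def sortedWeight {n : ℕ} (ρ w : Fin n → ℝ) (j : Fin n) : ℝ := normWeight w (Tuple.sort ρ j)

/-- Cumulative sums `v 0 + ⋯ + v j`. -/
def cumSum {n : ℕ} (v : Fin n → ℝ) (j : Fin n) : ℝ := ∑ i ∈ Finset.Iic j, v i

/-- The first index at which the cumulative sums of `v` reach the level `q` (the infimum is taken in
the finite linear order `Fin n`, so it is a minimum whenever the level is reached). -/
def firstCrossing {n : ℕ} [NeZero n] (q : ℝ) (v : Fin n → ℝ) : Fin n :=
  sInf {j | q ≤ cumSum v j}

/-- The Dirichlet distribution with parameters `α i > 0`: the law of a vector of independent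
`Gamma(α i, 1)` variables divided by its sum. -/
def dirichlet {n : ℕ} (α : Fin n → ℝ) : Measure (Fin n → ℝ) :=
  (Measure.pi fun i => gammaMeasure (α i) 1).map fun g i => g i / ∑ j, g j

/-- The weighted Dirichlet model with concentration `c`: the law of
`V ~ Dir(c * w̃_(1), …, c * w̃_(n))`, given scores `ρ` and weights `w`. -/
def posterior {n : ℕ} (ρ w : Fin n → ℝ) (c : ℝ) : Measure (Fin n → ℝ) :=
  dirichlet fun j => c * sortedWeight ρ w j

/-- The threshold `ρ_(K)`, `K = min {j | V_1 + ⋯ + V_j ≥ q}`, as a function of `V = v`. Its law under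
`posterior ρ w c` is the posterior of the threshold. -/
def postThreshold {n : ℕ} [NeZero n] (ρ : Fin n → ℝ) (q : ℝ) (v : Fin n → ℝ) : ℝ :=
  sortedScore ρ (firstCrossing q v)

/-- The weighted empirical distribution function `∑ i, w̃ i * 1[ρ i ≤ t]`. -/
def weightedCDF {n : ℕ} (w ρ : Fin n → ℝ) (t : ℝ) : ℝ :=
  ∑ i, normWeight w i * (Set.Iic t).indicator 1 (ρ i)

/-- The threshold of weighted conformal prediction: the weighted `q`-quantile of the scores. -/
def wcpThreshold {n : ℕ} (w ρ : Fin n → ℝ) (q : ℝ) : ℝ := sInf {t | q ≤ weightedCDF w ρ t}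

/-- The sampling law of `n` independent scores with common law `P`. -/
def sampling (n : ℕ) (P : Measure ℝ) : Measure (Fin n → ℝ) := Measure.pi fun _ => P

/-- Frequentist variance of the weighted empirical distribution function at `t`, for a given weight
profile `w` and independent scores with law `P`. -/
def freqVar {n : ℕ} (w : Fin n → ℝ) (P : Measure ℝ) (t : ℝ) : ℝ :=
  variance (fun ρ => weightedCDF w ρ t) (sampling n P)

/-- Posterior variance of the cumulative sum `S_j`. -/
def postVar {n : ℕ} (ρ w : Fin n → ℝ) (c : ℝ) (j : Fin n) : ℝ :=
  variance (fun v => cumSum v j) (posterior ρ w c)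

/-- The error of the posterior threshold around the weighted-CP threshold, on the scale
`1 / √n_eff`. -/
def postError {n : ℕ} [NeZero n] (w ρ : Fin n → ℝ) (q : ℝ) (v : Fin n → ℝ) : ℝ :=
  √(nEff w) * (postThreshold ρ q v - wcpThreshold w ρ q)

/-- The sampling error of the weighted sample quantile around `θ`, on the scale `1 / √n_eff`. -/
def freqError {n : ℕ} (w : Fin n → ℝ) (q θ : ℝ) (ρ : Fin n → ℝ) : ℝ :=
  √(nEff w) * (wcpThreshold w ρ q - θ)

/-- `X k`, a function of the `k`-th calibration sample, tends to the constant `a` in probability. -/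
def TendstoInProb (m : ℕ → ℕ) (P : Measure ℝ) (X : ∀ k, (Fin (m k) → ℝ) → ℝ) (a : ℝ) : Prop :=
  ∀ ε > 0, Tendsto (fun k => sampling (m k) P {ρ | ε ≤ |X k ρ - a|}) atTop (𝓝 0)

/-- The (already rescaled and centred) variables `X k` have asymptotic mean `0` and asymptotic
variance `s`: the mean and the second moment of `X k`, truncated at the level `M`, tend to `0` and
`s` as first `k → ∞` and then `M → ∞`. The laws of `X k` are then asymptotically tight, and every
weak limit along a subsequence has mean `0` and variance `s`. -/
def HasAsymptoticVariance (m : ℕ → ℕ) (P : Measure ℝ) (X : ∀ k, (Fin (m k) → ℝ) → ℝ)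
    (s : ℝ) : Prop :=
  ∀ ε > 0, ∃ M₀ : ℝ, ∀ M ≥ M₀, ∀ᶠ k in atTop,
    |∫ ρ, max (-M) (min M (X k ρ)) ∂(sampling (m k) P)| ≤ ε ∧
    |∫ ρ, min (M ^ 2) (X k ρ ^ 2) ∂(sampling (m k) P) - s| ≤ ε

end WBCP

end

namespace WBCP

/-! Everything rests on one reduction. Under the posterior, almost surely, the threshold is at most
`t` exactly when the block of scores at most `t` carries mass at least `q` (`postThreshold_le_iff`).
With `p = weightedCDF w ρ t` in `(0, 1)`, that mass is distributed as `X / (X + Y)` for independent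
Gamma variables of parameters `c * p` and `c * (1 - p)` (`map_block_posterior`). So the posterior
law of the threshold depends on the data only through the weighted empirical distribution function.
Size-biasing of Gamma laws gives the mean and variance of the ratio, hence the variance formulas. If
the empirical distribution function jumps strictly across `q`, its levels at the weighted-CP
threshold and at all lower scores stay away from `q`, and Chebyshev's inequality makes a wrong
threshold an event of probability `O(1/c)`; this is mean consistency.

On the sampling side, the rescaled empirical process is a sum of independent centred terms whose
squared coefficients add up to one. Its increments over windows of length of order `1/√n_eff` have
vanishing variance, and monotonicity upgrades the pointwise approximation by a line of slope `f` to
a uniform one on bounded windows (`eventually_localDeviation_uniform`). Inverting it gives Bahadur's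
representation (`eventually_bahadur`): the quantile error is `-1/f` times the empirical process at
`θ`, up to a small error. The first two moments of that process are known exactly for every weight
profile; only the normal limit needs negligible individual weights (`tendsto_charFun_empirical`).

For the posterior, the same representation gives `√n_eff * (p - q) ≈ f * x` at distance `x / √n_eff`
from the weighted-CP threshold, so `√c * (p - q) ≈ √κ * f * x`. The central limit theorem for Gamma
ratios (`tendsto_gammaRatio_Ici`) turns this into the probability that a normal variable of mean `√κ
* f * x` and variance `q * (1 - q)` is nonnegative, which is the required normal distribution
function at `x`. When `c / n_eff → ∞`, Chebyshev suffices. When `c / n_eff → 0`, the concentrations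
may stay bounded, and an anticoncentration bound valid for all Gamma parameters
(`gammaRatio_Ico_le`) replaces the limit theorem. -/

/-! ### Gamma laws, their block sums and their ratios. -/

lemma lintegral_eq_setLIntegral_Ioi {f : ℝ → ENNReal} (hf : ∀ x < 0, f x = 0) :
    ∫⁻ x, f x = ∫⁻ x in Set.Ioi 0, f x := by
  have hd : Disjoint (Set.Iio (0 : ℝ)) (Set.Ici 0) :=
    Set.disjoint_left.2 fun x (hx : x < 0) (hx' : 0 ≤ x) => absurd hx' (not_le.2 hx)
  rw [← setLIntegral_univ, ← Set.Iio_union_Ici (a := (0 : ℝ)),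
    lintegral_union measurableSet_Ici hd,
    setLIntegral_congr_fun (g := 0) measurableSet_Iio hf,
    setLIntegral_congr Ioi_ae_eq_Ici.symm]
  simp

lemma lintegral_gammaMeasure (a : ℝ) (f : ℝ → ENNReal) (hf : Measurable f) :
    ∫⁻ x, f x ∂(gammaMeasure a 1) = ∫⁻ x in Set.Ioi 0,
      ENNReal.ofReal (x ^ (a - 1) * Real.exp (-x) / Real.Gamma a) * f x := by
  have hm : Measurable (gammaPDF a 1) := (measurable_gammaPDFReal a 1).ennreal_ofReal
  rw [gammaMeasure, lintegral_withDensity_eq_lintegral_mul _ hm hf,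
    lintegral_eq_setLIntegral_Ioi fun x hx => by simp [gammaPDF_of_neg hx]]
  refine setLIntegral_congr_fun measurableSet_Ioi fun x (hx : 0 < x) => ?_
  simp only [Pi.mul_apply, gammaPDF_of_nonneg hx.le]
  congr 2
  simp
  ring

lemma ae_gammaMeasure_pos (a : ℝ) : ∀ᵐ x ∂(gammaMeasure a 1), 0 < x := by
  have h : MeasurableSet {x : ℝ | ¬ 0 < x} := (measurableSet_lt measurable_const measurable_id).compl
  rw [ae_iff, ← lintegral_indicator_one h,
    lintegral_gammaMeasure _ _ (measurable_one.indicator h),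
    setLIntegral_congr_fun (g := 0) measurableSet_Ioi (fun x (hx : 0 < x) => by simp [hx])]
  simp

/-- The size-biased Gamma law is again a Gamma law. -/
lemma lintegral_mul_gammaMeasure {a : ℝ} (ha : 0 < a) (f : ℝ → ENNReal) (hf : Measurable f) :
    ∫⁻ x, ENNReal.ofReal x * f x ∂(gammaMeasure a 1)
      = ENNReal.ofReal a * ∫⁻ x, f x ∂(gammaMeasure (a + 1) 1) := by
  rw [lintegral_gammaMeasure _ _ (by fun_prop), lintegral_gammaMeasure _ _ hf,
    ← lintegral_const_mul _ (by fun_prop)]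
  refine setLIntegral_congr_fun measurableSet_Ioi fun x (hx : 0 < x) => ?_
  rw [← mul_assoc, ← mul_assoc, ← ENNReal.ofReal_mul' hx.le, ← ENNReal.ofReal_mul ha.le,
    Real.Gamma_add_one ha.ne', add_sub_cancel_right]
  congr 2
  have hG := (Real.Gamma_pos_of_pos ha).ne'
  have : x ^ a = x ^ (a - 1) * x := by
    rw [← Real.rpow_add_one hx.ne', sub_add_cancel]
  rw [this]
  field_simp

/-- Size-biasing applied to `1 / x`: the left side becomes the total mass of the Gamma law with
parameter `a`. -/
lemma lintegral_inv_gammaMeasure {a : ℝ} (ha : 0 < a) :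
    ∫⁻ x, ENNReal.ofReal x⁻¹ ∂(gammaMeasure (a + 1) 1) = ENNReal.ofReal a⁻¹ := by
  have := isProbabilityMeasure_gammaMeasure ha one_pos
  have h := lintegral_mul_gammaMeasure ha (fun x => ENNReal.ofReal x⁻¹) (by fun_prop)
  have h1 : ∫⁻ x, ENNReal.ofReal x * ENNReal.ofReal x⁻¹ ∂(gammaMeasure a 1) = 1 := by
    rw [lintegral_congr_ae (g := fun _ => 1)]
    · simp
    · filter_upwards [ae_gammaMeasure_pos a] with x hx
      rw [← ENNReal.ofReal_mul hx.le, mul_inv_cancel₀ hx.ne', ENNReal.ofReal_one]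
  rw [h1] at h
  rw [ENNReal.ofReal_inv_of_pos ha]
  exact ENNReal.eq_inv_of_mul_eq_one_left (by rw [mul_comm, ← h])

/-- Tilting by `exp (t * x)` turns the Gamma density of rate `1` into a multiple of the density of
rate `1 - t`, whose total mass is known. -/
lemma mgf_gammaMeasure {a : ℝ} (ha : 0 < a) {t : ℝ} (ht : t < 1) :
    mgf id (gammaMeasure a 1) t = (1 / (1 - t)) ^ a ∧
      Integrable (fun x => Real.exp (t * x)) (gammaMeasure a 1) := by
  have hr : 0 < 1 - t := by linarith
  have hl : ∫⁻ x, ENNReal.ofReal (Real.exp (t * x)) ∂(gammaMeasure a 1)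
      = ENNReal.ofReal ((1 / (1 - t)) ^ a) := by
    have h1 := lintegral_gammaPDF_eq_one ha hr
    rw [lintegral_gammaMeasure _ _ (by fun_prop)]
    rw [lintegral_eq_setLIntegral_Ioi fun x hx => gammaPDF_of_neg hx] at h1
    have hm : Measurable (gammaPDF a (1 - t)) := (measurable_gammaPDFReal a (1 - t)).ennreal_ofReal
    rw [← mul_one (ENNReal.ofReal ((1 / (1 - t)) ^ a)), ← h1, ← lintegral_const_mul _ hm]
    refine setLIntegral_congr_fun measurableSet_Ioi fun x (hx : 0 < x) => ?_
    have hG := Real.Gamma_pos_of_pos ha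
    rw [gammaPDF_of_nonneg hx.le, ← ENNReal.ofReal_mul (by positivity),
      ← ENNReal.ofReal_mul (by positivity)]
    congr 1
    rw [one_div, Real.inv_rpow hr.le]
    have : Real.exp (-((1 - t) * x)) = Real.exp (-x) * Real.exp (t * x) := by
      rw [← Real.exp_add]; ring_nf
    rw [this]
    have := Real.rpow_pos_of_pos hr a
    field_simp
  have hi : Integrable (fun x => Real.exp (t * x)) (gammaMeasure a 1) := by
    refine ⟨by fun_prop, ?_⟩
    rw [hasFiniteIntegral_iff_ofReal (ae_of_all _ fun x => (Real.exp_pos _).le), hl]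
    exact ENNReal.ofReal_lt_top
  refine ⟨?_, hi⟩
  rw [mgf, integral_eq_lintegral_of_nonneg_ae (ae_of_all _ fun x => (Real.exp_pos _).le) (by fun_prop)]
  simp only [id]
  rw [hl, ENNReal.toReal_ofReal (by positivity)]

/-- Analytic continuation: both sides extend to analytic functions on the half-plane `re z < 1`,
where `1 - z` avoids the cut of the logarithm, and they agree at real points near `0`. The value at
`t * I` is the characteristic function. -/
lemma charFun_gammaMeasure {a : ℝ} (ha : 0 < a) (t : ℝ) :
    charFun (gammaMeasure a 1) t = Complex.exp (-(a * Complex.log (1 - t * Complex.I))) := by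
  have hset : Set.Iio 1 ⊆ integrableExpSet id (gammaMeasure a 1) := fun t ht =>
    (mgf_gammaMeasure ha ht).2
  have hX : AnalyticOnNhd ℂ (complexMGF id (gammaMeasure a 1)) {z | z.re < 1} :=
    analyticOnNhd_complexMGF.mono fun z (hz : z.re < 1) =>
      interior_maximal hset isOpen_Iio hz
  have hY : AnalyticOnNhd ℂ (fun z => Complex.exp (-(a * Complex.log (1 - z)))) {z | z.re < 1} := by
    intro z hz
    have : 1 - z ∈ Complex.slitPlane := by
      left; simp only [Set.mem_ofPred_eq] at hz; simp [hz]
    have h1 : AnalyticAt ℂ (fun z : ℂ => 1 - z) z := by fun_prop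
    exact ((analyticAt_const.mul (h1.clog this)).neg).cexp
  have key := AnalyticOnNhd.eqOn_of_preconnected_of_frequently_eq hX hY
    ((convex_halfSpace_re_lt 1).isPreconnected) (z₀ := ((0 : ℝ) : ℂ)) (by simp) ?_
  · rw [← complexMGF_id_mul_I, key (by simp)]
  · have h_real : ∃ᶠ (x : ℝ) in 𝓝[≠] 0, complexMGF id (gammaMeasure a 1) x =
        Complex.exp (-(a * Complex.log (1 - x))) := by
      refine Eventually.frequently (eventually_nhdsWithin_of_eventually_nhds ?_)
      filter_upwards [Iio_mem_nhds (show (0 : ℝ) < 1 by norm_num)] with x hx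
      have hx1 : 0 < 1 - x := by simp only [Set.mem_Iio] at hx; linarith
      rw [complexMGF_ofReal, (mgf_gammaMeasure ha hx).1, one_div, Real.inv_rpow hx1.le,
        Real.rpow_def_of_pos hx1, ← Real.exp_neg, Complex.ofReal_exp]
      congr 1
      push_cast
      rw [Complex.ofReal_log hx1.le]
      push_cast
      ring
    rw [frequently_iff_seq_forall] at h_real ⊢
    obtain ⟨xs, hx_tendsto, hx_eq⟩ := h_real
    refine ⟨fun n => xs n, ?_, fun n => hx_eq n⟩
    rw [tendsto_nhdsWithin_iff] at hx_tendsto ⊢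
    exact ⟨(Complex.continuous_ofReal.tendsto _).comp hx_tendsto.1, by simpa using hx_tendsto.2⟩

/-- A sum of independent Gamma variables has a Gamma law. -/
lemma map_sum_pi_gammaMeasure {ι : Type*} [Fintype ι] {α : ι → ℝ} (hα : ∀ i, 0 < α i)
    {B : Finset ι} (hB : B.Nonempty) :
    (Measure.pi fun i => gammaMeasure (α i) 1).map (fun g => ∑ i ∈ B, g i)
      = gammaMeasure (∑ i ∈ B, α i) 1 := by
  have hp := fun i => isProbabilityMeasure_gammaMeasure (hα i) one_pos
  have hp' := isProbabilityMeasure_gammaMeasure (Finset.sum_pos (fun i _ => hα i) hB) one_pos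
  have : IsProbabilityMeasure ((Measure.pi fun i => gammaMeasure (α i) 1).map
      (fun g => ∑ i ∈ B, g i)) := Measure.isProbabilityMeasure_map (by fun_prop)
  refine Measure.ext_of_charFun ?_
  have hind : iIndepFun (fun i (g : ι → ℝ) => g i) (Measure.pi fun i => gammaMeasure (α i) 1) :=
    iIndepFun_pi (X := fun _ => id) fun _ => aemeasurable_id
  rw [iIndepFun.charFun_map_fun_finsetSum_eq_prod (X := fun i (g : ι → ℝ) => g i)
    (fun i _ => (measurable_pi_apply i).aemeasurable) (hind.restrict B)]
  ext t
  rw [Finset.prod_apply, charFun_gammaMeasure (Finset.sum_pos (fun i _ => hα i) hB)]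
  have : ∀ i, charFun ((Measure.pi fun i => gammaMeasure (α i) 1).map fun g => g i) t
      = Complex.exp (-(α i * Complex.log (1 - t * Complex.I))) := fun i => by
    rw [(measurePreserving_eval _ i).map_eq, charFun_gammaMeasure (hα i)]
  simp only [this, ← Complex.exp_sum]
  push_cast
  rw [Finset.sum_neg_distrib, Finset.sum_mul]

lemma map_add_prod_gammaMeasure {a b : ℝ} (ha : 0 < a) (hb : 0 < b) :
    ((gammaMeasure a 1).prod (gammaMeasure b 1)).map (fun x => x.1 + x.2)
      = gammaMeasure (a + b) 1 := by
  have := isProbabilityMeasure_gammaMeasure ha one_pos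
  have := isProbabilityMeasure_gammaMeasure hb one_pos
  have := isProbabilityMeasure_gammaMeasure (add_pos ha hb) one_pos
  have : IsProbabilityMeasure (((gammaMeasure a 1).prod (gammaMeasure b 1)).map
    (fun x => x.1 + x.2)) := Measure.isProbabilityMeasure_map (by fun_prop)
  refine Measure.ext_of_charFun ?_
  rw [charFun_map_add_prod_eq_mul]
  ext t
  rw [Pi.mul_apply, charFun_gammaMeasure ha, charFun_gammaMeasure hb,
    charFun_gammaMeasure (add_pos ha hb), ← Complex.exp_add]
  push_cast
  ring_nf

/-- Sums of independent Gamma variables over complementary blocks are independent Gamma variables. -/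
lemma map_block_sums_pi_gammaMeasure {ι : Type*} [Fintype ι] [DecidableEq ι] {α : ι → ℝ}
    (hα : ∀ i, 0 < α i) {B : Finset ι} (hB : B.Nonempty) (hB' : Bᶜ.Nonempty) :
    (Measure.pi fun i => gammaMeasure (α i) 1).map (fun g => (∑ i ∈ B, g i, ∑ i ∈ Bᶜ, g i))
      = (gammaMeasure (∑ i ∈ B, α i) 1).prod (gammaMeasure (∑ i ∈ Bᶜ, α i) 1) := by
  have hp := fun i => isProbabilityMeasure_gammaMeasure (hα i) one_pos
  have hind : iIndepFun (fun i (g : ι → ℝ) => g i) (Measure.pi fun i => gammaMeasure (α i) 1) :=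
    iIndepFun_pi (X := fun _ => id) fun _ => aemeasurable_id
  have h := hind.indepFun_finset B Bᶜ disjoint_compl_right (by fun_prop)
  have h2 := h.comp (φ := fun x => ∑ i, x i) (ψ := fun x => ∑ i, x i) (by fun_prop) (by fun_prop)
  have h3 : IndepFun (fun g : ι → ℝ => ∑ i ∈ B, g i) (fun g => ∑ i ∈ Bᶜ, g i)
      (Measure.pi fun i => gammaMeasure (α i) 1) := by
    convert h2 using 1
    · ext g; exact (Finset.sum_coe_sort B g).symm
    · ext g; exact (Finset.sum_coe_sort Bᶜ g).symm
  rw [(indepFun_iff_map_prod_eq_prod_map_map (by fun_prop) (by fun_prop)).1 h3,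
    map_sum_pi_gammaMeasure hα hB, map_sum_pi_gammaMeasure hα hB']

/-- The law of `x / (x + y)` for independent `x ~ Gamma(a, 1)` and `y ~ Gamma(b, 1)`. -/
noncomputable def gammaRatio (a b : ℝ) : Measure ℝ :=
  ((gammaMeasure a 1).prod (gammaMeasure b 1)).map fun x => x.1 / (x.1 + x.2)

lemma isProbabilityMeasure_gammaRatio {a b : ℝ} (ha : 0 < a) (hb : 0 < b) :
    IsProbabilityMeasure (gammaRatio a b) := by
  have := isProbabilityMeasure_gammaMeasure ha one_pos
  have := isProbabilityMeasure_gammaMeasure hb one_pos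
  exact Measure.isProbabilityMeasure_map (by fun_prop)

lemma ae_prod_gammaMeasure_pos (a : ℝ) {b : ℝ} (hb : 0 < b) :
    ∀ᵐ x ∂((gammaMeasure a 1).prod (gammaMeasure b 1)), 0 < x.1 ∧ 0 < x.2 := by
  have := isProbabilityMeasure_gammaMeasure hb one_pos
  have h1 := (Measure.quasiMeasurePreserving_fst (μ := gammaMeasure a 1)
    (ν := gammaMeasure b 1)).ae (ae_gammaMeasure_pos a)
  have h2 := (Measure.quasiMeasurePreserving_snd (μ := gammaMeasure a 1)
    (ν := gammaMeasure b 1)).ae (ae_gammaMeasure_pos b)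
  filter_upwards [h1, h2] with x h1 h2 using ⟨h1, h2⟩

lemma ae_gammaRatio_mem (a : ℝ) {b : ℝ} (hb : 0 < b) :
    ∀ᵐ x ∂(gammaRatio a b), 0 ≤ x ∧ x ≤ 1 := by
  rw [gammaRatio, ae_map_iff (by fun_prop)
    (show MeasurableSet {x : ℝ | 0 ≤ x ∧ x ≤ 1} from measurableSet_Icc)]
  filter_upwards [ae_prod_gammaMeasure_pos a hb] with x hx
  have := add_pos hx.1 hx.2
  exact ⟨div_nonneg hx.1.le this.le, (div_le_one this).2 (by linarith [hx.2])⟩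

/-- Size-biasing in the first coordinate alone. Together with the additivity of Gamma laws it
reduces moments of `x / (x + y)` to inverse moments of a single Gamma variable, so no Beta density
is needed. -/
lemma lintegral_mul_prod_gammaMeasure {a b : ℝ} (ha : 0 < a) (hb : 0 < b)
    (f : ℝ × ℝ → ENNReal) (hf : Measurable f) :
    ∫⁻ x, ENNReal.ofReal x.1 * f x ∂((gammaMeasure a 1).prod (gammaMeasure b 1))
      = ENNReal.ofReal a * ∫⁻ x, f x ∂((gammaMeasure (a + 1) 1).prod (gammaMeasure b 1)) := by
  have := isProbabilityMeasure_gammaMeasure ha one_pos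
  have := isProbabilityMeasure_gammaMeasure hb one_pos
  have := isProbabilityMeasure_gammaMeasure (add_pos ha one_pos) one_pos
  rw [lintegral_prod_symm _ (by fun_prop), lintegral_prod_symm _ (by fun_prop),
    ← lintegral_const_mul _ (by fun_prop)]
  refine lintegral_congr fun y => ?_
  exact lintegral_mul_gammaMeasure ha (fun x => f (x, y)) (by fun_prop)

lemma lintegral_prod_gammaMeasure_add {a b : ℝ} (ha : 0 < a) (hb : 0 < b)
    (f : ℝ → ENNReal) (hf : Measurable f) :
    ∫⁻ x, f (x.1 + x.2) ∂((gammaMeasure a 1).prod (gammaMeasure b 1))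
      = ∫⁻ x, f x ∂(gammaMeasure (a + b) 1) := by
  rw [← map_add_prod_gammaMeasure ha hb, lintegral_map hf (by fun_prop)]

lemma integral_gammaRatio {a b : ℝ} (ha : 0 < a) (hb : 0 < b) :
    ∫ x, x ∂(gammaRatio a b) = a / (a + b) := by
  rw [integral_eq_lintegral_of_nonneg_ae
    (by filter_upwards [ae_gammaRatio_mem a hb] with x hx using hx.1) (by fun_prop),
    gammaRatio, lintegral_map (by fun_prop) (by fun_prop)]
  have h1 : ∫⁻ x, ENNReal.ofReal (x.1 / (x.1 + x.2))
      ∂((gammaMeasure a 1).prod (gammaMeasure b 1))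
      = ∫⁻ x, ENNReal.ofReal x.1 * ENNReal.ofReal (x.1 + x.2)⁻¹
        ∂((gammaMeasure a 1).prod (gammaMeasure b 1)) := by
    refine lintegral_congr_ae ?_
    filter_upwards [ae_prod_gammaMeasure_pos a hb] with x hx
    rw [← ENNReal.ofReal_mul hx.1.le, div_eq_mul_inv]
  rw [h1, lintegral_mul_prod_gammaMeasure ha hb _ (by fun_prop),
    lintegral_prod_gammaMeasure_add (by positivity) hb (fun x => ENNReal.ofReal x⁻¹) (by fun_prop),
    show a + 1 + b = a + b + 1 by ring, lintegral_inv_gammaMeasure (by positivity),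
    ← ENNReal.ofReal_mul ha.le, ENNReal.toReal_ofReal (by positivity), div_eq_mul_inv]

lemma lintegral_inv_sq_gammaMeasure {a : ℝ} (ha : 0 < a) :
    ∫⁻ x, ENNReal.ofReal (x⁻¹ ^ 2) ∂(gammaMeasure (a + 2) 1)
      = ENNReal.ofReal (a * (a + 1))⁻¹ := by
  have ha1 : 0 < a + 1 := by positivity
  have h := lintegral_mul_gammaMeasure ha1 (fun x => ENNReal.ofReal (x⁻¹ ^ 2)) (by fun_prop)
  have h1 : ∫⁻ x, ENNReal.ofReal x * ENNReal.ofReal (x⁻¹ ^ 2) ∂(gammaMeasure (a + 1) 1)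
      = ENNReal.ofReal a⁻¹ := by
    rw [← lintegral_inv_gammaMeasure ha]
    refine lintegral_congr_ae ?_
    filter_upwards [ae_gammaMeasure_pos (a + 1)] with x hx
    rw [← ENNReal.ofReal_mul hx.le]
    congr 1
    field_simp
  rw [h1, show a + 1 + 1 = a + 2 by ring] at h
  have h0 : ENNReal.ofReal (a + 1) ≠ 0 := by simpa using ha1
  rw [mul_inv, ENNReal.ofReal_mul (by positivity), h, mul_comm, ← mul_assoc,
    ENNReal.ofReal_inv_of_pos ha1, ENNReal.inv_mul_cancel h0 ENNReal.ofReal_ne_top, one_mul]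

lemma integral_sq_gammaRatio {a b : ℝ} (ha : 0 < a) (hb : 0 < b) :
    ∫ x, x ^ 2 ∂(gammaRatio a b) = a * (a + 1) / ((a + b) * (a + b + 1)) := by
  rw [integral_eq_lintegral_of_nonneg_ae (ae_of_all _ fun x => sq_nonneg x) (by fun_prop),
    gammaRatio, lintegral_map (by fun_prop) (by fun_prop)]
  have h1 : ∫⁻ x, ENNReal.ofReal ((x.1 / (x.1 + x.2)) ^ 2)
      ∂((gammaMeasure a 1).prod (gammaMeasure b 1))
      = ∫⁻ x, ENNReal.ofReal x.1 * (ENNReal.ofReal x.1 * ENNReal.ofReal ((x.1 + x.2)⁻¹ ^ 2))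
        ∂((gammaMeasure a 1).prod (gammaMeasure b 1)) := by
    refine lintegral_congr_ae ?_
    filter_upwards [ae_prod_gammaMeasure_pos a hb] with x hx
    rw [← ENNReal.ofReal_mul hx.1.le, ← ENNReal.ofReal_mul hx.1.le]
    congr 1
    ring
  rw [h1, lintegral_mul_prod_gammaMeasure ha hb _ (by fun_prop),
    lintegral_mul_prod_gammaMeasure (by positivity) hb _ (by fun_prop),
    lintegral_prod_gammaMeasure_add (by positivity) hb (fun x => ENNReal.ofReal (x⁻¹ ^ 2))
      (by fun_prop),
    show a + 1 + 1 + b = a + b + 2 by ring, lintegral_inv_sq_gammaMeasure (by positivity),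
    ← ENNReal.ofReal_mul (by positivity), ← ENNReal.ofReal_mul ha.le,
    ENNReal.toReal_ofReal (by positivity), div_eq_mul_inv]
  ring

lemma memLp_id_gammaRatio {a b : ℝ} (ha : 0 < a) (hb : 0 < b) :
    MemLp (fun x => x) 2 (gammaRatio a b) := by
  have := isProbabilityMeasure_gammaRatio ha hb
  refine MemLp.of_bound (by fun_prop) 1 ?_
  filter_upwards [ae_gammaRatio_mem a hb] with x hx
  rw [Real.norm_eq_abs, abs_le]
  constructor <;> linarith [hx.1, hx.2]

lemma variance_gammaRatio {a b : ℝ} (ha : 0 < a) (hb : 0 < b) :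
    variance (fun x => x) (gammaRatio a b)
      = a / (a + b) * (1 - a / (a + b)) / (a + b + 1) := by
  have := isProbabilityMeasure_gammaRatio ha hb
  rw [variance_eq_sub (memLp_id_gammaRatio ha hb), integral_gammaRatio ha hb]
  simp only [Pi.pow_apply]
  rw [integral_sq_gammaRatio ha hb]
  field_simp
  ring

lemma variance_const_eq_zero {Ω : Type*} [MeasurableSpace Ω] {μ : Measure Ω} [IsProbabilityMeasure μ]
    (x : ℝ) : variance (fun _ => x) μ = 0 := by
  rw [variance_eq_integral aemeasurable_const]
  simp

/-! ### Blocks of a Dirichlet vector. -/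

section Dirichlet

variable {n : ℕ} {α : Fin n → ℝ}

lemma measurable_normalize : Measurable fun (g : Fin n → ℝ) i => g i / ∑ j, g j := by fun_prop

lemma ae_dirichlet [NeZero n] (hα : ∀ i, 0 < α i) :
    ∀ᵐ v ∂(dirichlet α), (∀ i, 0 ≤ v i) ∧ ∑ i, v i = 1 := by
  have hp := fun i => isProbabilityMeasure_gammaMeasure (hα i) one_pos
  rw [dirichlet, ae_map_iff measurable_normalize.aemeasurable]
  · have h : ∀ᵐ g ∂(Measure.pi fun i => gammaMeasure (α i) 1), ∀ i, 0 < g i := by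
      rw [ae_all_iff]
      exact fun i => (Measure.quasiMeasurePreserving_eval _ i).ae (ae_gammaMeasure_pos (α i))
    filter_upwards [h] with g hg
    have hs : 0 < ∑ j, g j := Finset.sum_pos (fun i _ => hg i) Finset.univ_nonempty
    refine ⟨fun i => div_nonneg (hg i).le hs.le, ?_⟩
    rw [← Finset.sum_div, div_self hs.ne']
  · exact MeasurableSet.inter (measurableSet_Ici (a := (0 : Fin n → ℝ)))
      (measurableSet_eq_fun (f := fun v : Fin n → ℝ => ∑ i, v i) (g := fun _ => 1)
        (by fun_prop) measurable_const)

lemma isProbabilityMeasure_dirichlet (hα : ∀ i, 0 < α i) : IsProbabilityMeasure (dirichlet α) := by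
  have hp := fun i => isProbabilityMeasure_gammaMeasure (hα i) one_pos
  exact Measure.isProbabilityMeasure_map measurable_normalize.aemeasurable

/-- The mass that a Dirichlet vector gives to a block of coordinates is a ratio of Gamma
variables. -/
lemma map_block_dirichlet (hα : ∀ i, 0 < α i) {B : Finset (Fin n)} (hB : B.Nonempty)
    (hB' : Bᶜ.Nonempty) :
    (dirichlet α).map (fun v => ∑ i ∈ B, v i) = gammaRatio (∑ i ∈ B, α i) (∑ i ∈ Bᶜ, α i) := by
  have hm : Measurable fun v : Fin n → ℝ => ∑ i ∈ B, v i := by fun_prop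
  have hr : Measurable fun x : ℝ × ℝ => x.1 / (x.1 + x.2) := by fun_prop
  rw [dirichlet, gammaRatio, ← map_block_sums_pi_gammaMeasure hα hB hB',
    Measure.map_map hm measurable_normalize, Measure.map_map hr (by fun_prop)]
  congr 1
  ext g
  simp only [Function.comp_apply]
  rw [← Finset.sum_div, Finset.sum_add_sum_compl]

/-- The empty and the full block have deterministic mass and are treated apart, because the ratio of
Gamma variables needs both parameters positive. -/
lemma block_dirichlet_moments [NeZero n] (hα : ∀ i, 0 < α i) (B : Finset (Fin n)) :
    ∫ v, ∑ i ∈ B, v i ∂(dirichlet α) = (∑ i ∈ B, α i) / ∑ i, α i ∧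
    variance (fun v => ∑ i ∈ B, v i) (dirichlet α)
      = (∑ i ∈ B, α i) / (∑ i, α i) * (1 - (∑ i ∈ B, α i) / ∑ i, α i) / (∑ i, α i + 1) := by
  have := isProbabilityMeasure_dirichlet hα
  have hpos : 0 < ∑ i, α i := Finset.sum_pos (fun i _ => hα i) Finset.univ_nonempty
  rcases B.eq_empty_or_nonempty with rfl | hB
  · simp [variance_const_eq_zero]
  rcases (Bᶜ).eq_empty_or_nonempty with hB' | hB'
  · rw [Finset.compl_eq_empty_iff] at hB'
    subst hB'
    have h : (fun v : Fin n → ℝ => ∑ i, v i) =ᵐ[dirichlet α] fun _ => 1 := by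
      filter_upwards [ae_dirichlet hα] with v hv using hv.2
    rw [integral_congr_ae h, variance_congr h, div_self hpos.ne']
    simp [variance_const_eq_zero]
  · have ha : 0 < ∑ i ∈ B, α i := Finset.sum_pos (fun i _ => hα i) hB
    have hb : 0 < ∑ i ∈ Bᶜ, α i := Finset.sum_pos (fun i _ => hα i) hB'
    have h := map_block_dirichlet hα hB hB'
    rw [← Finset.sum_add_sum_compl B]
    constructor
    · rw [← integral_gammaRatio ha hb, ← h, integral_map (by fun_prop) (by fun_prop)]
    · rw [← variance_gammaRatio ha hb, ← h, variance_map (by fun_prop) (by fun_prop)]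
      rfl

lemma memLp_block_dirichlet [NeZero n] (hα : ∀ i, 0 < α i) (B : Finset (Fin n)) :
    MemLp (fun v => ∑ i ∈ B, v i) 2 (dirichlet α) := by
  have := isProbabilityMeasure_dirichlet hα
  refine MemLp.of_bound (by fun_prop) 1 ?_
  filter_upwards [ae_dirichlet hα] with v hv
  rw [Real.norm_eq_abs, abs_of_nonneg (Finset.sum_nonneg fun i _ => hv.1 i), ← hv.2]
  exact Finset.sum_le_univ_sum_of_nonneg hv.1

end Dirichlet

/-! ### Gaussian limits of half-line probabilities. -/

section Gaussian

/-- Lévy's continuity theorem; a nondegenerate Gaussian does not charge the boundary point `0`.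
Posterior and sampling probabilities are both brought to this form, with the argument `x` moved into
the mean. -/
lemma tendsto_real_Ici_of_tendsto_charFun {μ : ℕ → Measure ℝ} [∀ k, IsProbabilityMeasure (μ k)]
    {m : ℝ} {v : NNReal} (hv : v ≠ 0)
    (h : ∀ t, Tendsto (fun k => charFun (μ k) t) atTop (𝓝 (charFun (gaussianReal m v) t))) :
    Tendsto (fun k => (μ k).real (Set.Ici 0)) atTop (𝓝 ((gaussianReal m v).real (Set.Ici 0))) := by
  have hl := ProbabilityMeasure.tendsto_of_tendsto_charFun (μ := fun k => ⟨μ k, inferInstance⟩)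
    (μ₀ := ⟨gaussianReal m v, inferInstance⟩) h
  have := nullSingletonClass_gaussianReal (μ := m) hv
  have h0 := ProbabilityMeasure.tendsto_measure_of_null_frontier_of_tendsto' hl
    (E := Set.Ici (0 : ℝ)) (by simp)
  exact (ENNReal.tendsto_toReal (measure_ne_top _ _)).comp h0

/-- If `Y` is centred with variance `v / s ^ 2`, then `s * x - s * Y` has mean `s * x` and variance
`v`, and it is nonnegative exactly when `Y ≤ x`. -/
lemma gaussianReal_real_Ici (x : ℝ) {s : ℝ} (hs : 0 < s) {v : ℝ} (hv : 0 ≤ v) :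
    (gaussianReal (s * x) v.toNNReal).real (Set.Ici 0)
      = (gaussianReal 0 (v / s ^ 2).toNNReal).real (Set.Iic x) := by
  have h : gaussianReal (s * x) v.toNNReal
      = (gaussianReal 0 (v / s ^ 2).toNNReal).map (fun y => s * x + -s * y) := by
    have hc : (fun y => s * x + -s * y) = (fun y => s * x + y) ∘ fun y => -s * y := rfl
    rw [hc, ← Measure.map_map (by fun_prop) (by fun_prop), gaussianReal_map_const_mul,
      gaussianReal_map_const_add]
    congr 1
    · simp
    · ext
      simp only [NNReal.coe_mul, NNReal.coe_mk]
      rw [Real.coe_toNNReal _ hv, Real.coe_toNNReal _ (by positivity)]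
      field_simp
  rw [h, map_measureReal_apply (by fun_prop) measurableSet_Ici]
  congr 1
  ext y
  simp only [Set.mem_preimage, Set.mem_Ici, Set.mem_Iic]
  constructor
  · intro h; nlinarith
  · intro h; nlinarith

end Gaussian

/-! ### Central limit theorem for ratios of Gamma variables. -/

section GammaClt

lemma norm_log_one_sub_add_le {z : ℂ} (hz : ‖z‖ ≤ 1 / 2) :
    ‖Complex.log (1 - z) + z + z ^ 2 / 2‖ ≤ ‖z‖ ^ 3 := by
  have h := Complex.norm_log_sub_logTaylor_le 2 (z := -z) (by rw [norm_neg]; linarith)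
  have e : Complex.log (1 + -z) - Complex.logTaylor (2 + 1) (-z)
      = Complex.log (1 - z) + z + z ^ 2 / 2 := by
    simp [Complex.logTaylor, Finset.sum_range_succ]
    ring_nf
  rw [e, norm_neg] at h
  refine h.trans ?_
  have h3 : (1 - ‖z‖)⁻¹ ≤ 2 := by
    rw [inv_le_comm₀ (by linarith) (by norm_num)]; linarith
  have h4 : ‖z‖ ^ 3 * (1 - ‖z‖)⁻¹ ≤ ‖z‖ ^ 3 * 2 := by gcongr
  have h5 : 0 ≤ ‖z‖ ^ 3 := by positivity
  push_cast
  linarith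

/-- The Taylor remainder is cubic in `1 / √c`, so after multiplication by `c` it is still of order
`1 / √c`. -/
lemma tendsto_mul_log_one_sub {c : ℕ → ℝ} (hc : Tendsto c atTop atTop) (r : ℝ) :
    Tendsto (fun k => (c k : ℂ) * (Complex.log (1 - (r / √(c k) : ℝ) * Complex.I)
      + (r / √(c k) : ℝ) * Complex.I + ((r / √(c k) : ℝ) * Complex.I) ^ 2 / 2)) atTop (𝓝 0) := by
  have hs : Tendsto (fun k => √(c k)) atTop atTop := Real.tendsto_sqrt_atTop.comp hc
  have hr : Tendsto (fun k => |r| / √(c k)) atTop (𝓝 0) := hs.const_div_atTop _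
  have hb : Tendsto (fun k => |r| ^ 3 / √(c k)) atTop (𝓝 0) := hs.const_div_atTop _
  refine squeeze_zero_norm' ?_ hb
  filter_upwards [hr.eventually_le_const (show (0 : ℝ) < 1 / 2 by norm_num),
    hc.eventually_gt_atTop 0] with k hk hk0
  have hn : ‖((r / √(c k) : ℝ) : ℂ) * Complex.I‖ = |r| / √(c k) := by
    rw [norm_mul, Complex.norm_I, mul_one, Complex.norm_real, Real.norm_eq_abs, abs_div,
      abs_of_nonneg (Real.sqrt_nonneg _)]
  have h := norm_log_one_sub_add_le (z := (r / √(c k) : ℝ) * Complex.I) (by rw [hn]; exact hk)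
  rw [norm_mul, Complex.norm_real, Real.norm_eq_abs, abs_of_pos hk0]
  rw [hn] at h
  refine (mul_le_mul_of_nonneg_left h hk0.le).trans (le_of_eq ?_)
  have hsq := Real.sq_sqrt hk0.le
  have hsp := Real.sqrt_pos.2 hk0
  rw [div_pow]
  field_simp
  rw [hsq, mul_comm]

/-- Clearing the positive denominator makes the event linear in two independent variables, whose
characteristic function is explicit. The scale `s` is free and is taken to be `√c` below. -/
lemma real_Ici_gammaRatio (a : ℝ) {b s : ℝ} (hb : 0 < b) (q : ℝ) (hs : 0 < s) :
    (gammaRatio a b).real (Set.Ici q)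
      = (((gammaMeasure a 1).prod (gammaMeasure b 1)).map
          fun x => (1 - q) / s * x.1 + -q / s * x.2).real (Set.Ici 0) := by
  rw [gammaRatio, map_measureReal_apply (by fun_prop) measurableSet_Ici,
    map_measureReal_apply (by fun_prop) measurableSet_Ici, measureReal_def, measureReal_def]
  congr 1
  refine measure_congr ?_
  filter_upwards [ae_prod_gammaMeasure_pos a hb] with x hx
  refine propext ?_
  change q ≤ x.1 / (x.1 + x.2) ↔ 0 ≤ (1 - q) / s * x.1 + -q / s * x.2
  have e : (1 - q) / s * x.1 + -q / s * x.2 = (x.1 - q * (x.1 + x.2)) / s := by ring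
  rw [e, le_div_iff₀ (add_pos hx.1 hx.2), le_div_iff₀ hs, zero_mul, sub_nonneg]

lemma charFun_map_prod_gammaMeasure {a b : ℝ} (ha : 0 < a) (hb : 0 < b) (u v t : ℝ) :
    charFun (((gammaMeasure a 1).prod (gammaMeasure b 1)).map fun x => u * x.1 + v * x.2) t
      = Complex.exp (-(a * Complex.log (1 - (u * t : ℝ) * Complex.I))
        - b * Complex.log (1 - (v * t : ℝ) * Complex.I)) := by
  have := isProbabilityMeasure_gammaMeasure ha one_pos
  have := isProbabilityMeasure_gammaMeasure hb one_pos
  have h : ((gammaMeasure a 1).prod (gammaMeasure b 1)).map (fun x => u * x.1 + v * x.2)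
      = (((gammaMeasure a 1).map (u * ·)).prod ((gammaMeasure b 1).map (v * ·))).map
          (fun x => x.1 + x.2) := by
    rw [Measure.map_prod_map _ _ (by fun_prop) (by fun_prop),
      Measure.map_map (by fun_prop) (by fun_prop)]
    rfl
  have : IsProbabilityMeasure ((gammaMeasure a 1).map (u * ·)) :=
    Measure.isProbabilityMeasure_map (by fun_prop)
  have : IsProbabilityMeasure ((gammaMeasure b 1).map (v * ·)) :=
    Measure.isProbabilityMeasure_map (by fun_prop)
  rw [h, charFun_map_add_prod_eq_mul, Pi.mul_apply, charFun_map_mul, charFun_map_mul,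
    charFun_gammaMeasure ha, charFun_gammaMeasure hb, ← Complex.exp_add, ← sub_eq_add_neg]

/-- The variable `((1 - q) * X - q * Y) / √c` has mean `√c * (p - q) → τ` and variance `(1 - q) ^ 2
* p + q ^ 2 * (1 - p) → q * (1 - q)`, because `p → q`. Expanding the logarithms in its
characteristic function to second order shows that it is asymptotically normal. -/
lemma tendsto_gammaRatio_Ici {q : ℝ} (hq0 : 0 < q) (hq1 : q < 1) {τ : ℝ} {c p : ℕ → ℝ}
    (hc0 : ∀ k, 0 < c k) (hc : Tendsto c atTop atTop) (hp0 : ∀ k, 0 < p k) (hp1 : ∀ k, p k < 1)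
    (hp : Tendsto (fun k => √(c k) * (p k - q)) atTop (𝓝 τ)) :
    Tendsto (fun k => (gammaRatio (c k * p k) (c k * (1 - p k))).real (Set.Ici q)) atTop
      (𝓝 ((gaussianReal τ (q * (1 - q)).toNNReal).real (Set.Ici 0))) := by
  have ha : ∀ k, 0 < c k * p k := fun k => mul_pos (hc0 k) (hp0 k)
  have hb : ∀ k, 0 < c k * (1 - p k) := fun k => mul_pos (hc0 k) (by linarith [hp1 k])
  have hs : ∀ k, 0 < √(c k) := fun k => Real.sqrt_pos.2 (hc0 k)
  have hv : 0 < q * (1 - q) := mul_pos hq0 (by linarith)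
  have hA := fun k => isProbabilityMeasure_gammaMeasure (ha k) one_pos
  have hB := fun k => isProbabilityMeasure_gammaMeasure (hb k) one_pos
  have hpq : Tendsto p atTop (𝓝 q) := by
    have h1 := hp.div_atTop (Real.tendsto_sqrt_atTop.comp hc)
    have h2 : Tendsto (fun k => √(c k) * (p k - q) / √(c k) + q) atTop (𝓝 (0 + q)) :=
      h1.add_const q
    rw [zero_add] at h2
    refine h2.congr fun k => ?_
    have := hs k
    field_simp
    ring
  simp only [fun k => real_Ici_gammaRatio (c k * p k) (hb k) q (hs k)]
  have : ∀ k, IsProbabilityMeasure (((gammaMeasure (c k * p k) 1).prod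
      (gammaMeasure (c k * (1 - p k)) 1)).map
        fun x => (1 - q) / √(c k) * x.1 + -q / √(c k) * x.2) := fun k =>
    Measure.isProbabilityMeasure_map (by fun_prop)
  refine tendsto_real_Ici_of_tendsto_charFun (by simpa using hv) fun t => ?_
  simp only [charFun_map_prod_gammaMeasure (ha _) (hb _), charFun_gaussianReal]
  refine (Complex.continuous_exp.tendsto _).comp ?_
  have hpC : Tendsto (fun k => (p k : ℂ)) atTop (𝓝 (q : ℂ)) :=
    (Complex.continuous_ofReal.tendsto _).comp hpq
  have hd : Tendsto (fun k => ((√(c k) * (p k - q) : ℝ) : ℂ)) atTop (𝓝 (τ : ℂ)) :=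
    (Complex.continuous_ofReal.tendsto _).comp hp
  have h1 := (tendsto_mul_log_one_sub hc ((1 - q) * t)).mul hpC
  have h2 := (tendsto_mul_log_one_sub hc (-q * t)).mul (hpC.const_sub 1)
  have h3 := ((hd.mul_const (t * Complex.I)).sub (((hpC.mul_const ((1 - q) ^ 2 * t ^ 2 / 2 : ℂ)).add
    ((hpC.const_sub 1).mul_const (q ^ 2 * t ^ 2 / 2 : ℂ))))).sub (h1.add h2)
  -- The exact exponent is the linear term, minus the quadratic term, minus the two remainders
  -- controlled by `h1` and `h2`.
  convert h3 using 2 with k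
  · have hsC : ((√(c k) : ℝ) : ℂ) ^ 2 = c k := by
      rw [← Complex.ofReal_pow, Real.sq_sqrt (hc0 k).le]
    have hsne : ((√(c k) : ℝ) : ℂ) ≠ 0 := Complex.ofReal_ne_zero.2 (hs k).ne'
    have e1 : (1 - q) / √(c k) * t = (1 - q) * t / √(c k) := by ring
    have e2 : -q / √(c k) * t = -q * t / √(c k) := by ring
    rw [e1, e2]
    generalize Complex.log (1 - ((1 - q) * t / √(c k) : ℝ) * Complex.I) = l1
    generalize Complex.log (1 - (-q * t / √(c k) : ℝ) * Complex.I) = l2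
    push_cast
    rw [← hsC]
    generalize ((√(c k) : ℝ) : ℂ) = s at hsne
    field_simp
    ring_nf
    simp only [Complex.I_sq]
    ring
  · rw [Real.coe_toNNReal _ hv.le]
    push_cast
    ring

/-- The limit theorem in a form uniform in `c` and `p`, deduced by contradiction along sequences.
Uniformity matters because `p` will be a random level of the empirical distribution function. -/
lemma exists_gammaRatio_Ici_near {q : ℝ} (hq0 : 0 < q) (hq1 : q < 1) (τ : ℝ) {ε : ℝ}
    (hε : 0 < ε) : ∃ δ > 0, ∃ C > 0, ∀ c p : ℝ, C ≤ c → 0 < p → p < 1 → |√c * (p - q) - τ| ≤ δ →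
      |(gammaRatio (c * p) (c * (1 - p))).real (Set.Ici q)
        - (gaussianReal τ (q * (1 - q)).toNNReal).real (Set.Ici 0)| < ε := by
  by_contra! hcon
  have hcon' : ∀ k : ℕ, ∃ x : ℝ × ℝ, (k + 1 : ℝ) ≤ x.1 ∧ 0 < x.2 ∧ x.2 < 1 ∧
      |√x.1 * (x.2 - q) - τ| ≤ 1 / (k + 1 : ℝ) ∧
      ε ≤ |(gammaRatio (x.1 * x.2) (x.1 * (1 - x.2))).real (Set.Ici q)
        - (gaussianReal τ (q * (1 - q)).toNNReal).real (Set.Ici 0)| := fun k => by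
    obtain ⟨c, p, h⟩ := hcon (1 / (k + 1 : ℝ)) (by positivity) (k + 1) (by positivity)
    exact ⟨(c, p), h⟩
  choose x h1 h2 h3 h4 h5 using hcon'
  have hc : Tendsto (fun k => (x k).1) atTop atTop :=
    tendsto_atTop_mono h1 (tendsto_atTop_add_const_right _ _ tendsto_natCast_atTop_atTop)
  have hp : Tendsto (fun k => √(x k).1 * ((x k).2 - q)) atTop (𝓝 τ) := by
    rw [tendsto_iff_norm_sub_tendsto_zero]
    exact squeeze_zero (fun _ => norm_nonneg _) h4 tendsto_one_div_add_atTop_nhds_zero_nat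
  have h := tendsto_gammaRatio_Ici hq0 hq1 (fun k => lt_of_lt_of_le (by positivity) (h1 k)) hc h2 h3 hp
  have h' := (tendsto_iff_norm_sub_tendsto_zero.1 h).eventually_lt_const hε
  obtain ⟨k, hk⟩ := h'.exists
  exact absurd hk (not_lt.2 (h5 k))

end GammaClt

/-! ### Anticoncentration of Gamma ratios. -/

section Anticoncentration

lemma rpow_mul_exp_neg_le {a x : ℝ} (ha : 0 < a) (hx : 0 < x) :
    x ^ a * Real.exp (-x) ≤ a ^ a * Real.exp (-a) := by
  rw [Real.rpow_def_of_pos hx, Real.rpow_def_of_pos ha, ← Real.exp_add, ← Real.exp_add,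
    Real.exp_le_exp]
  have h := Real.log_le_sub_one_of_pos (div_pos hx ha)
  rw [Real.log_div hx.ne' ha.ne'] at h
  have h2 : a * (Real.log x - Real.log a) ≤ a * (x / a - 1) := mul_le_mul_of_nonneg_left h ha.le
  have h3 : a * (x / a - 1) = x - a := by field_simp
  nlinarith

/-- Within `√a` to the right of its maximum at `a`, the function loses at most the factor `exp
(-1/2)`: with `x = a * (1 + u)` one has `log (1 + u) ≥ u - u ^ 2 / 2` and `a * u ^ 2 ≤ 1`. -/
lemma rpow_mul_exp_neg_ge {a x : ℝ} (ha : 0 < a) (hx : a ≤ x) (hx' : x ≤ a + √a) :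
    a ^ a * Real.exp (-a) * Real.exp (-(1 / 2)) ≤ x ^ a * Real.exp (-x) := by
  have hx0 : 0 < x := ha.trans_le hx
  rw [Real.rpow_def_of_pos hx0, Real.rpow_def_of_pos ha, ← Real.exp_add, ← Real.exp_add,
    ← Real.exp_add, Real.exp_le_exp]
  obtain ⟨u, hu, rfl⟩ : ∃ u, 0 ≤ u ∧ x = a * (1 + u) :=
    ⟨x / a - 1, by rw [sub_nonneg, le_div_iff₀ ha]; linarith, by field_simp; ring⟩
  have h1 := Real.le_log_one_add_of_nonneg hu
  have h2 : u - u ^ 2 / 2 ≤ 2 * u / (u + 2) := by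
    rw [le_div_iff₀ (by linarith)]
    nlinarith [pow_nonneg hu 3]
  have h3 : a * u ^ 2 ≤ 1 := by
    have h4 : a * u ≤ √a := by linarith
    have h5 : (a * u) ^ 2 ≤ a := by
      calc (a * u) ^ 2 ≤ √a ^ 2 := by gcongr
        _ = a := Real.sq_sqrt ha.le
    have h6 : a * (a * u ^ 2) ≤ a * 1 := by linarith
    exact le_of_mul_le_mul_left h6 ha
  rw [Real.log_mul ha.ne' (by linarith)]
  nlinarith

/-- A Stirling-type bound for every `a > 0`. Integrating over the window `(a, a + √a]` bounds `Γ(a +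
1) = a * Γ(a)` below by `√a` times the maximum of the integrand, up to `exp (-1/2)`. -/
lemma rpow_mul_exp_neg_le_Gamma {a x : ℝ} (ha : 0 < a) (hx : 0 < x) :
    x ^ a * Real.exp (-x) ≤ √a * Real.exp (1 / 2) * Real.Gamma a := by
  have hsa := Real.sqrt_pos.2 ha
  have hint : IntegrableOn (fun x => Real.exp (-x) * x ^ (a + 1 - 1)) (Set.Ioi 0) :=
    Real.GammaIntegral_convergent (by positivity)
  have h1 : √a * (a ^ a * Real.exp (-a) * Real.exp (-(1 / 2))) ≤ Real.Gamma (a + 1) := by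
    rw [Real.Gamma_eq_integral (by positivity)]
    calc √a * (a ^ a * Real.exp (-a) * Real.exp (-(1 / 2)))
        = ∫ x in Set.Ioc a (a + √a), (a ^ a * Real.exp (-a) * Real.exp (-(1 / 2))) := by
          rw [setIntegral_const, measureReal_def, Real.volume_Ioc,
            ENNReal.toReal_ofReal (by linarith)]
          simp
      _ ≤ ∫ x in Set.Ioc a (a + √a), Real.exp (-x) * x ^ (a + 1 - 1) := by
          refine setIntegral_mono_on continuous_const.integrableOn_Ioc
            (hint.mono_set fun y hy => ha.trans hy.1) measurableSet_Ioc fun y hy => ?_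
          rw [add_sub_cancel_right, mul_comm (Real.exp (-y))]
          exact rpow_mul_exp_neg_ge ha hy.1.le hy.2
      _ ≤ ∫ x in Set.Ioi 0, Real.exp (-x) * x ^ (a + 1 - 1) := by
          refine setIntegral_mono_set hint ?_ (ae_of_all _ fun y hy => ha.trans hy.1)
          filter_upwards [ae_restrict_mem measurableSet_Ioi] with y (hy : 0 < y)
          simp only [Pi.zero_apply]
          positivity
  rw [Real.Gamma_add_one ha.ne'] at h1
  refine (rpow_mul_exp_neg_le ha hx).trans ?_
  have h2 : a = √a * √a := (Real.mul_self_sqrt ha.le).symm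
  have h3 : √a * (a ^ a * Real.exp (-a) * Real.exp (-(1 / 2))) ≤ √a * (√a * Real.Gamma a) := by
    rw [← mul_assoc (√a) (√a), ← h2]; exact h1
  have h4 := le_of_mul_le_mul_left h3 hsa
  calc a ^ a * Real.exp (-a) = a ^ a * Real.exp (-a) * Real.exp (-(1 / 2)) * Real.exp (1 / 2) := by
        rw [mul_assoc _ (Real.exp (-(1 / 2))), ← Real.exp_add]; simp
    _ ≤ √a * Real.Gamma a * Real.exp (1 / 2) := by gcongr
    _ = _ := by ring

lemma gammaMeasure_Ico_le {a s t : ℝ} (ha : 0 < a) (hs : 0 < s) :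
    gammaMeasure a 1 (Set.Ico s t) ≤ ENNReal.ofReal (√a * Real.exp (1 / 2) * (t / s - 1)) := by
  have hG := Real.Gamma_pos_of_pos ha
  rw [gammaMeasure, withDensity_apply _ measurableSet_Ico]
  calc ∫⁻ x in Set.Ico s t, gammaPDF a 1 x
      ≤ ∫⁻ x in Set.Ico s t, ENNReal.ofReal (√a * Real.exp (1 / 2) / s) := by
        refine setLIntegral_mono (by fun_prop) fun x hx => ?_
        have hx0 : 0 < x := hs.trans_le hx.1
        rw [gammaPDF_of_nonneg hx0.le]
        refine ENNReal.ofReal_le_ofReal ?_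
        have h := rpow_mul_exp_neg_le_Gamma ha hx0
        have e : (1 : ℝ) ^ a / Real.Gamma a * x ^ (a - 1) * Real.exp (-(1 * x))
            = x ^ a * Real.exp (-x) / Real.Gamma a / x := by
          rw [Real.rpow_sub_one hx0.ne', Real.one_rpow, one_mul]
          field_simp
        rw [e]
        have h2 : x ^ a * Real.exp (-x) / Real.Gamma a ≤ √a * Real.exp (1 / 2) := by
          rwa [div_le_iff₀ hG]
        gcongr
        exact hx.1
    _ = ENNReal.ofReal (√a * Real.exp (1 / 2) * (t / s - 1)) := by
        rw [setLIntegral_const, Real.volume_Ico, ← ENNReal.ofReal_mul (by positivity)]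
        congr 1
        field_simp

/-- For fixed `y` the event places `x` in an interval whose endpoints are both proportional to `y`.
The bound for Gamma intervals depends only on the ratio of the endpoints, so `y` drops out. -/
lemma gammaRatio_Ico_le {a b q η : ℝ} (ha : 0 < a) (hb : 0 < b) (hη : 0 ≤ η) (hηq : η < q)
    (hq1 : q < 1) :
    (gammaRatio a b).real (Set.Ico (q - η) q)
      ≤ √a * Real.exp (1 / 2) * (η / ((1 - q) * (q - η))) := by
  have h1q : 0 < 1 - q := by linarith
  have hqη : 0 < q - η := by linarith
  have hpa := isProbabilityMeasure_gammaMeasure ha one_pos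
  have hpb := isProbabilityMeasure_gammaMeasure hb one_pos
  have hbound : 0 ≤ √a * Real.exp (1 / 2) * (η / ((1 - q) * (q - η))) := by positivity
  refine ENNReal.toReal_le_of_le_ofReal hbound ?_
  rw [gammaRatio, Measure.map_apply (by fun_prop) measurableSet_Ico,
    Measure.prod_apply_symm ((by fun_prop : Measurable fun x : ℝ × ℝ => x.1 / (x.1 + x.2))
      measurableSet_Ico)]
  calc _ ≤ ∫⁻ y, ENNReal.ofReal (√a * Real.exp (1 / 2) * (η / ((1 - q) * (q - η))))
        ∂(gammaMeasure b 1) := by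
        refine lintegral_mono_ae ?_
        filter_upwards [ae_gammaMeasure_pos b] with y hy
        have hs : 0 < (q - η) / (1 - q + η) * y := by
          have : 0 < 1 - q + η := by linarith
          positivity
        calc gammaMeasure a 1 _ ≤ gammaMeasure a 1
              (Set.Ico ((q - η) / (1 - q + η) * y) (q / (1 - q) * y)) := by
              refine measure_mono_ae ?_
              filter_upwards [ae_gammaMeasure_pos a] with x hx hmem
              obtain ⟨h1, h2⟩ := hmem
              simp only at h1 h2
              have hxy := add_pos hx hy
              rw [le_div_iff₀ hxy] at h1
              rw [div_lt_iff₀ hxy] at h2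
              constructor
              · rw [div_mul_eq_mul_div, div_le_iff₀ (by linarith)]; linarith
              · rw [div_mul_eq_mul_div, lt_div_iff₀ h1q]; linarith
          _ ≤ _ := gammaMeasure_Ico_le ha hs
          _ = _ := by
              congr 2
              have : 0 < 1 - q + η := by linarith
              field_simp
              ring
    _ = _ := by simp

end Anticoncentration

/-! ### Normalized weights and the weighted quantile. -/

section Weights

variable {n : ℕ} {w : Fin n → ℝ}

lemma sum_weight_pos [NeZero n] (hw : ∀ i, 0 < w i) : 0 < ∑ i, w i :=
  Finset.sum_pos (fun i _ => hw i) Finset.univ_nonempty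

lemma normWeight_pos [NeZero n] (hw : ∀ i, 0 < w i) (i : Fin n) : 0 < normWeight w i :=
  div_pos (hw i) (sum_weight_pos hw)

lemma sum_normWeight [NeZero n] (hw : ∀ i, 0 < w i) : ∑ i, normWeight w i = 1 := by
  simp only [normWeight]
  rw [← Finset.sum_div, div_self (sum_weight_pos hw).ne']

lemma nEff_pos [NeZero n] (hw : ∀ i, 0 < w i) : 0 < nEff w :=
  div_pos (pow_pos (sum_weight_pos hw) 2)
    (Finset.sum_pos (fun i _ => pow_pos (hw i) 2) Finset.univ_nonempty)

lemma sum_normWeight_sq : ∑ i, normWeight w i ^ 2 = 1 / nEff w := by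
  simp only [normWeight, nEff, div_pow]
  rw [← Finset.sum_div, one_div_div]

lemma normWeight_le (w : Fin n → ℝ) (i : Fin n) :
    normWeight w i ≤ 1 / √(nEff w) := by
  have h1 : normWeight w i ^ 2 ≤ 1 / nEff w := by
    rw [← sum_normWeight_sq]
    exact Finset.single_le_sum (f := fun i => normWeight w i ^ 2) (fun i _ => sq_nonneg _)
      (Finset.mem_univ i)
  rw [one_div, ← Real.sqrt_inv, ← one_div]
  exact Real.le_sqrt_of_sq_le h1

lemma weightedCDF_eq (w ρ : Fin n → ℝ) (t : ℝ) :
    weightedCDF w ρ t = ∑ i, if ρ i ≤ t then normWeight w i else 0 := by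
  simp only [weightedCDF]
  refine Finset.sum_congr rfl fun i _ => ?_
  by_cases h : ρ i ≤ t <;> simp [Set.indicator, h]

lemma weightedCDF_mono [NeZero n] (hw : ∀ i, 0 < w i) (ρ : Fin n → ℝ) :
    Monotone (weightedCDF w ρ) := by
  intro s t hst
  rw [weightedCDF_eq, weightedCDF_eq]
  refine Finset.sum_le_sum fun i _ => ?_
  have := (normWeight_pos hw i).le
  split_ifs with h1 h2 <;> linarith

/-- The weighted empirical distribution function reaches a level `q ∈ (0, 1]` at one of the
scores. -/
lemma exists_score_iff_le_weightedCDF [NeZero n] (hw : ∀ i, 0 < w i) (ρ : Fin n → ℝ) {q : ℝ}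
    (hq0 : 0 < q) (hq1 : q ≤ 1) : ∃ i, ∀ t, q ≤ weightedCDF w ρ t ↔ ρ i ≤ t := by
  obtain ⟨m, hm⟩ := Finite.exists_max ρ
  have hne : (Finset.univ.filter fun i => q ≤ weightedCDF w ρ (ρ i)).Nonempty := by
    refine ⟨m, by simp [weightedCDF_eq, hm, sum_normWeight hw, hq1]⟩
  obtain ⟨i, hi, hmin⟩ := Finset.exists_min_image _ ρ hne
  simp only [Finset.mem_filter, Finset.mem_univ, true_and] at hi hmin
  refine ⟨i, fun t => ⟨fun h => ?_, fun h => hi.trans (weightedCDF_mono hw ρ h)⟩⟩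
  -- The empirical distribution function is constant between the largest score `ρ j ≤ t` and `t`, so
  -- the level is already reached at `ρ j`. Since `q > 0`, such a score exists.
  have hne' : (Finset.univ.filter fun j => ρ j ≤ t).Nonempty := by
    by_contra hcon
    rw [Finset.not_nonempty_iff_eq_empty, Finset.filter_eq_empty_iff] at hcon
    rw [weightedCDF_eq, Finset.sum_eq_zero fun j hj => if_neg (hcon hj)] at h
    linarith
  obtain ⟨j, hj, hmax⟩ := Finset.exists_max_image _ ρ hne'
  simp only [Finset.mem_filter, Finset.mem_univ, true_and] at hj hmax
  refine (hmin j ?_).trans hj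
  have : weightedCDF w ρ (ρ j) = weightedCDF w ρ t := by
    rw [weightedCDF_eq, weightedCDF_eq]
    refine Finset.sum_congr rfl fun l _ => ?_
    have : ρ l ≤ ρ j ↔ ρ l ≤ t := ⟨fun h => h.trans hj, hmax l⟩
    simp [this]
  rw [this]
  exact h

lemma wcpThreshold_eq {ρ : Fin n → ℝ} {q : ℝ} {i : Fin n}
    (hi : ∀ t, q ≤ weightedCDF w ρ t ↔ ρ i ≤ t) : wcpThreshold w ρ q = ρ i := by
  simp only [wcpThreshold, hi]
  exact csInf_Ici

/-- The infimum is attained at a score, so events about the threshold become events about the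
empirical distribution function at a fixed point. -/
lemma wcpThreshold_le_iff [NeZero n] (hw : ∀ i, 0 < w i) (ρ : Fin n → ℝ) {q : ℝ}
    (hq0 : 0 < q) (hq1 : q ≤ 1) (t : ℝ) : wcpThreshold w ρ q ≤ t ↔ q ≤ weightedCDF w ρ t := by
  obtain ⟨i, hi⟩ := exists_score_iff_le_weightedCDF hw ρ hq0 hq1
  rw [wcpThreshold_eq hi, hi]

end Weights

/-! ### The posterior threshold as an event about block masses. -/

section Threshold

variable {n : ℕ}

lemma sortedScore_mono (ρ : Fin n → ℝ) : Monotone (sortedScore ρ) := Tuple.monotone_sort ρ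

/-- The positions of the sorted scores that are at most `t`. -/
noncomputable def scoresLE (ρ : Fin n → ℝ) (t : ℝ) : Finset (Fin n) :=
  Finset.univ.filter fun i => sortedScore ρ i ≤ t

lemma sum_scoresLE_sortedWeight (ρ w : Fin n → ℝ) (t : ℝ) :
    ∑ i ∈ scoresLE ρ t, sortedWeight ρ w i = weightedCDF w ρ t := by
  rw [weightedCDF_eq, ← Equiv.sum_comp (Tuple.sort ρ), scoresLE, Finset.sum_filter]
  rfl

lemma scoresLE_nonempty {w ρ : Fin n → ℝ} {t : ℝ} (h : 0 < weightedCDF w ρ t) :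
    (scoresLE ρ t).Nonempty := by
  rw [← sum_scoresLE_sortedWeight] at h
  exact Finset.nonempty_of_sum_ne_zero h.ne'

variable [NeZero n]

/-- The positions in `scoresLE ρ t` form an initial segment that contains all ties at `t`, so
comparing the threshold with `t` amounts to comparing the mass of that segment with `q`, also when
scores coincide. -/
lemma postThreshold_le_iff (ρ : Fin n → ℝ) {q : ℝ} (hq0 : 0 < q) (hq1 : q ≤ 1) {v : Fin n → ℝ}
    (hv : ∀ i, 0 ≤ v i) (hv1 : ∑ i, v i = 1) (t : ℝ) :
    postThreshold ρ q v ≤ t ↔ q ≤ ∑ i ∈ scoresLE ρ t, v i := by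
  constructor
  · intro h
    -- The total mass `1` reaches `q` at the last index, so the infimum defining the crossing is
    -- attained.
    have hne : {j | q ≤ cumSum v j}.Nonempty := by
      refine ⟨⊤, ?_⟩
      simp only [Set.mem_ofPred_eq, cumSum, Finset.Iic_top, hv1, hq1]
    have hK : q ≤ cumSum v (firstCrossing q v) := csInf_mem hne
    refine hK.trans (Finset.sum_le_sum_of_subset_of_nonneg (fun i hi => ?_) fun i _ _ => hv i)
    simp only [scoresLE, Finset.mem_filter, Finset.mem_univ, true_and]
    exact (sortedScore_mono ρ (Finset.mem_Iic.1 hi)).trans h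
  · intro h
    have hne : (scoresLE ρ t).Nonempty := by
      by_contra hcon
      rw [Finset.not_nonempty_iff_eq_empty] at hcon
      rw [hcon, Finset.sum_empty] at h
      linarith
    set J := (scoresLE ρ t).max' hne with hJ
    have hJm : J ∈ scoresLE ρ t := Finset.max'_mem _ _
    have hJt : sortedScore ρ J ≤ t := by simpa [scoresLE] using hJm
    refine (sortedScore_mono ρ (csInf_le' (a := J) ?_)).trans hJt
    refine h.trans (Finset.sum_le_sum_of_subset_of_nonneg (fun i hi => ?_) fun i _ _ => hv i)
    exact Finset.mem_Iic.2 (Finset.le_max' _ _ hi)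

lemma sum_sortedWeight {w : Fin n → ℝ} (hw : ∀ i, 0 < w i) (ρ : Fin n → ℝ) :
    ∑ i, sortedWeight ρ w i = 1 := by
  rw [← sum_normWeight hw]
  exact Equiv.sum_comp (Tuple.sort ρ) (normWeight w)

/-- The crossing index factors through the pattern of levels reached, which lives in a finite
discrete space. -/
lemma measurable_firstCrossing (q : ℝ) : Measurable (firstCrossing (n := n) q) := by
  have h : firstCrossing (n := n) q
      = (fun s : Fin n → Prop => sInf {j | s j}) ∘ fun v j => q ≤ cumSum v j := rfl
  rw [h]
  refine (Measurable.of_discrete).comp (measurable_pi_lambda _ fun j => ?_)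
  have : MeasurableSet {v : Fin n → ℝ | q ≤ cumSum v j} :=
    measurableSet_le measurable_const (by unfold cumSum; fun_prop)
  exact measurableSet_setOfPred.1 this

lemma measurable_postThreshold (ρ : Fin n → ℝ) (q : ℝ) : Measurable (postThreshold ρ q) :=
  (Measurable.of_discrete (f := sortedScore ρ)).comp (measurable_firstCrossing q)

end Threshold

/-! ### The posterior for fixed scores. -/

section Posterior

variable {n : ℕ} [NeZero n] {w : Fin n → ℝ} {c : ℝ}

lemma posterior_param_pos (hw : ∀ i, 0 < w i) (hc : 0 < c) (ρ : Fin n → ℝ) (i : Fin n) :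
    0 < c * sortedWeight ρ w i :=
  mul_pos hc (normWeight_pos hw _)

lemma isProbabilityMeasure_posterior (hw : ∀ i, 0 < w i) (hc : 0 < c) (ρ : Fin n → ℝ) :
    IsProbabilityMeasure (posterior ρ w c) :=
  isProbabilityMeasure_dirichlet (posterior_param_pos hw hc ρ)

lemma ae_posterior_postThreshold_le (hw : ∀ i, 0 < w i) (hc : 0 < c) (ρ : Fin n → ℝ) {q : ℝ}
    (hq0 : 0 < q) (hq1 : q ≤ 1) :
    ∀ᵐ v ∂(posterior ρ w c), (∀ i, 0 ≤ v i) ∧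
      ∀ t, postThreshold ρ q v ≤ t ↔ q ≤ ∑ i ∈ scoresLE ρ t, v i := by
  filter_upwards [ae_dirichlet (posterior_param_pos hw hc ρ)] with v hv
  exact ⟨hv.1, postThreshold_le_iff ρ hq0 hq1 hv.1 hv.2⟩

lemma block_posterior_moments (hw : ∀ i, 0 < w i) (hc : 0 < c) (ρ : Fin n → ℝ)
    (B : Finset (Fin n)) :
    ∫ v, ∑ i ∈ B, v i ∂(posterior ρ w c) = ∑ i ∈ B, sortedWeight ρ w i ∧
    variance (fun v => ∑ i ∈ B, v i) (posterior ρ w c)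
      = (∑ i ∈ B, sortedWeight ρ w i) * (1 - ∑ i ∈ B, sortedWeight ρ w i) / (c + 1) := by
  have h := block_dirichlet_moments (posterior_param_pos hw hc ρ) B
  rw [← Finset.mul_sum, ← Finset.mul_sum, sum_sortedWeight hw ρ, mul_one,
    mul_div_cancel_left₀ _ hc.ne'] at h
  exact h

lemma memLp_block_posterior (hw : ∀ i, 0 < w i) (hc : 0 < c) (ρ : Fin n → ℝ)
    (B : Finset (Fin n)) : MemLp (fun v => ∑ i ∈ B, v i) 2 (posterior ρ w c) :=
  memLp_block_dirichlet (posterior_param_pos hw hc ρ) B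

lemma posterior_abs_sub_ge_le (hw : ∀ i, 0 < w i) (hc : 0 < c) (ρ : Fin n → ℝ) (t : ℝ) {d : ℝ}
    (hd : 0 < d) :
    (posterior ρ w c).real {v | d ≤ |∑ i ∈ scoresLE ρ t, v i - weightedCDF w ρ t|}
      ≤ 1 / (c * d ^ 2) := by
  have := isProbabilityMeasure_posterior hw hc ρ
  obtain ⟨hm, hv⟩ := block_posterior_moments hw hc ρ (scoresLE ρ t)
  have h := meas_ge_le_variance_div_sq (memLp_block_posterior hw hc ρ (scoresLE ρ t)) hd
  rw [hm, hv, sum_scoresLE_sortedWeight] at h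
  have h2 : weightedCDF w ρ t * (1 - weightedCDF w ρ t) / (c + 1) / d ^ 2 ≤ 1 / (c * d ^ 2) := by
    rw [div_div]
    refine div_le_div₀ zero_le_one ?_ (by positivity) (by gcongr; linarith)
    nlinarith [sq_nonneg (weightedCDF w ρ t - 1 / 2)]
  exact ENNReal.toReal_le_of_le_ofReal (by positivity) (h.trans (ENNReal.ofReal_le_ofReal h2))

/-- The block mass has mean `weightedCDF w ρ t < q`; to reach `q` it must deviate from its mean by
the gap, and Chebyshev's inequality applies. -/
lemma posterior_postThreshold_le_le (hw : ∀ i, 0 < w i) (hc : 0 < c) (ρ : Fin n → ℝ) {q : ℝ}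
    (hq0 : 0 < q) (hq1 : q ≤ 1) {t : ℝ} (ht : weightedCDF w ρ t < q) :
    (posterior ρ w c).real {v | postThreshold ρ q v ≤ t}
      ≤ 1 / (c * (q - weightedCDF w ρ t) ^ 2) := by
  have := isProbabilityMeasure_posterior hw hc ρ
  refine le_trans (ENNReal.toReal_mono (measure_ne_top _ _) (measure_mono_ae ?_))
    (posterior_abs_sub_ge_le hw hc ρ t (sub_pos.2 ht))
  filter_upwards [ae_posterior_postThreshold_le hw hc ρ hq0 hq1] with v hv h
  have h1 := (hv.2 t).1 h
  exact (sub_le_sub_right h1 _).trans (le_abs_self _)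

lemma posterior_lt_postThreshold_le (hw : ∀ i, 0 < w i) (hc : 0 < c) (ρ : Fin n → ℝ) {q : ℝ}
    (hq0 : 0 < q) (hq1 : q ≤ 1) {t : ℝ} (ht : q < weightedCDF w ρ t) :
    (posterior ρ w c).real {v | t < postThreshold ρ q v}
      ≤ 1 / (c * (weightedCDF w ρ t - q) ^ 2) := by
  have := isProbabilityMeasure_posterior hw hc ρ
  refine le_trans (ENNReal.toReal_mono (measure_ne_top _ _) (measure_mono_ae ?_))
    (posterior_abs_sub_ge_le hw hc ρ t (sub_pos.2 ht))
  filter_upwards [ae_posterior_postThreshold_le hw hc ρ hq0 hq1] with v hv h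
  have h1 := not_le.1 (mt (hv.2 t).2 (not_le.2 h))
  change _ ≤ |_|
  rw [abs_sub_comm]
  exact (sub_le_sub_left h1.le _).trans (le_abs_self _)

lemma compl_scoresLE_nonempty (hw : ∀ i, 0 < w i) {ρ : Fin n → ℝ} {t : ℝ}
    (h : weightedCDF w ρ t < 1) : ((scoresLE ρ t)ᶜ).Nonempty := by
  rw [← sum_scoresLE_sortedWeight, ← sum_sortedWeight hw ρ,
    ← Finset.sum_add_sum_compl (scoresLE ρ t)] at h
  exact Finset.nonempty_of_sum_ne_zero (f := sortedWeight ρ w) (by intro h0; linarith)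

lemma map_block_posterior (hw : ∀ i, 0 < w i) (hc : 0 < c) (ρ : Fin n → ℝ) {t : ℝ}
    (h0 : 0 < weightedCDF w ρ t) (h1 : weightedCDF w ρ t < 1) :
    (posterior ρ w c).map (fun v => ∑ i ∈ scoresLE ρ t, v i)
      = gammaRatio (c * weightedCDF w ρ t) (c * (1 - weightedCDF w ρ t)) := by
  rw [posterior, map_block_dirichlet (posterior_param_pos hw hc ρ) (scoresLE_nonempty h0)
    (compl_scoresLE_nonempty hw h1), ← Finset.mul_sum, ← Finset.mul_sum,
    sum_scoresLE_sortedWeight]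
  congr 2
  rw [← sum_scoresLE_sortedWeight, ← sum_sortedWeight hw ρ,
    ← Finset.sum_add_sum_compl (scoresLE ρ t)]
  ring

lemma posterior_postThreshold_le_eq (hw : ∀ i, 0 < w i) (hc : 0 < c) (ρ : Fin n → ℝ) {q : ℝ}
    (hq0 : 0 < q) (hq1 : q ≤ 1) {t : ℝ} (h0 : 0 < weightedCDF w ρ t)
    (h1 : weightedCDF w ρ t < 1) :
    (posterior ρ w c).real {v | postThreshold ρ q v ≤ t}
      = (gammaRatio (c * weightedCDF w ρ t) (c * (1 - weightedCDF w ρ t))).real (Set.Ici q) := by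
  rw [← map_block_posterior hw hc ρ h0 h1, map_measureReal_apply (by fun_prop) measurableSet_Ici,
    measureReal_def, measureReal_def]
  congr 1
  refine measure_congr ?_
  filter_upwards [ae_posterior_postThreshold_le hw hc ρ hq0 hq1] with v hv
  exact propext (hv.2 t)

/-- On this event the mass up to `s` is below `q` and the mass up to `t` is not. Either the mass in
between is at least `η`, which Markov's inequality bounds, or the mass up to `s` lies in `[q - η,
q)`, which anticoncentration bounds. The level `η` is left free for a later trade-off. -/
lemma posterior_postThreshold_Ioc_le (hw : ∀ i, 0 < w i) (hc : 0 < c) (ρ : Fin n → ℝ) {q : ℝ}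
    (hq0 : 0 < q) (hq1 : q < 1) {s t : ℝ} (hst : s ≤ t) (h0 : 0 < weightedCDF w ρ s)
    (h1 : weightedCDF w ρ s < 1) {η : ℝ} (hη : 0 < η) (hηq : η < q) :
    (posterior ρ w c).real {v | s < postThreshold ρ q v ∧ postThreshold ρ q v ≤ t}
      ≤ (weightedCDF w ρ t - weightedCDF w ρ s) / η
        + √c * Real.exp (1 / 2) * (η / ((1 - q) * (q - η))) := by
  have := isProbabilityMeasure_posterior hw hc ρ
  have hsub : scoresLE ρ s ⊆ scoresLE ρ t := fun i hi => by
    simp only [scoresLE, Finset.mem_filter, Finset.mem_univ, true_and] at hi ⊢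
    exact hi.trans hst
  set D := scoresLE ρ t \ scoresLE ρ s with hD
  have hsplit : ∀ v : Fin n → ℝ, ∑ i ∈ D, v i + ∑ i ∈ scoresLE ρ s, v i
      = ∑ i ∈ scoresLE ρ t, v i := fun v => Finset.sum_sdiff hsub
  have hmean : ∫ v, ∑ i ∈ D, v i ∂(posterior ρ w c)
      = weightedCDF w ρ t - weightedCDF w ρ s := by
    rw [(block_posterior_moments hw hc ρ D).1, ← sum_scoresLE_sortedWeight,
      ← sum_scoresLE_sortedWeight, ← hsplit]
    ring
  have hD1 : (posterior ρ w c).real {v | η ≤ ∑ i ∈ D, v i}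
      ≤ (weightedCDF w ρ t - weightedCDF w ρ s) / η := by
    have h := mul_meas_ge_le_integral_of_nonneg (μ := posterior ρ w c)
      (f := fun v => ∑ i ∈ D, v i) (by
        filter_upwards [ae_posterior_postThreshold_le hw hc ρ hq0 hq1.le] with v hv
        exact Finset.sum_nonneg fun i _ => hv.1 i)
      ((memLp_block_posterior hw hc ρ D).integrable (by norm_num)) η
    rw [hmean] at h
    rw [le_div_iff₀ hη, mul_comm]
    exact h
  have hD2 : (posterior ρ w c).real {v | ∑ i ∈ scoresLE ρ s, v i ∈ Set.Ico (q - η) q}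
      ≤ √c * Real.exp (1 / 2) * (η / ((1 - q) * (q - η))) := by
    have h := gammaRatio_Ico_le (mul_pos hc h0) (mul_pos hc (sub_pos.2 h1)) hη.le hηq hq1
    rw [← map_block_posterior hw hc ρ h0 h1,
      map_measureReal_apply (by fun_prop) measurableSet_Ico] at h
    refine h.trans ?_
    have hp1 : 0 < 1 - q := by linarith
    have hp2 : 0 < q - η := by linarith
    gcongr
    exact mul_le_of_le_one_right hc.le h1.le
  refine le_trans (ENNReal.toReal_mono (measure_ne_top _ _) (measure_mono_ae ?_))
    ((measureReal_union_le _ _).trans (add_le_add hD1 hD2))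
  filter_upwards [ae_posterior_postThreshold_le hw hc ρ hq0 hq1.le] with v hv h
  have h2 := not_le.1 (mt (hv.2 s).2 (not_le.2 h.1))
  have h3 := (hv.2 t).1 h.2
  rw [← hsplit] at h3
  by_cases h4 : η ≤ ∑ i ∈ D, v i
  · exact Or.inl h4
  · exact Or.inr ⟨by linarith [not_le.1 h4], h2⟩

/-- The error of the threshold is at most `D`, and it is nonzero with probability at most `E / c`.
The strict jump over `q` at `θ` keeps the gaps in `E` positive. -/
lemma posterior_mean_sub_le (hw : ∀ i, 0 < w i) (ρ : Fin n → ℝ) {q : ℝ}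
    (hq0 : 0 < q) (hq1 : q < 1) (hne : weightedCDF w ρ (wcpThreshold w ρ q) ≠ q) :
    ∃ C : ℝ, ∀ c : ℝ, 0 < c →
      |(∫ v, postThreshold ρ q v ∂(posterior ρ w c)) - wcpThreshold w ρ q| ≤ C / c := by
  set θ := wcpThreshold w ρ q with hθ
  have hlt : q < weightedCDF w ρ θ :=
    lt_of_le_of_ne ((wcpThreshold_le_iff hw ρ hq0 hq1.le θ).1 le_rfl) hne.symm
  set I := Finset.univ.filter fun i => ρ i < θ with hI
  have hIlt : ∀ i ∈ I, weightedCDF w ρ (ρ i) < q := fun i hi => by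
    have h : ρ i < θ := by simpa [hI] using hi
    exact not_le.1 fun h' => absurd ((wcpThreshold_le_iff hw ρ hq0 hq1.le (ρ i)).2 h') (not_le.2 h)
  set E := 1 / (weightedCDF w ρ θ - q) ^ 2 + ∑ i ∈ I, 1 / (q - weightedCDF w ρ (ρ i)) ^ 2 with hE
  set D := ∑ i, |ρ i - θ| with hD
  refine ⟨D * E, fun c hc => ?_⟩
  have := isProbabilityMeasure_posterior hw hc ρ
  have hm := measurable_postThreshold ρ q
  have hbd : ∀ v, |postThreshold ρ q v - θ| ≤ D := fun v =>
    Finset.single_le_sum (f := fun i => |ρ i - θ|) (fun i _ => abs_nonneg _)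
      (Finset.mem_univ (Tuple.sort ρ (firstCrossing q v)))
  have hint : Integrable (fun v => postThreshold ρ q v - θ) (posterior ρ w c) :=
    Integrable.of_bound (by fun_prop) D (ae_of_all _ hbd)
  have hint' : Integrable (fun v => postThreshold ρ q v) (posterior ρ w c) :=
    (hint.add (integrable_const θ)).congr (ae_of_all _ fun v => sub_add_cancel _ _)
  have hms : MeasurableSet {v | postThreshold ρ q v ≠ θ} :=
    (measurableSet_eq_fun hm measurable_const).compl
  have hprob : (posterior ρ w c).real {v | postThreshold ρ q v ≠ θ} ≤ E / c := by
    -- The threshold takes its values among the scores, so falling below `θ` means being at most one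
    -- of the finitely many scores indexed by `I`.
    have hsub : {v | postThreshold ρ q v ≠ θ} ⊆
        {v | θ < postThreshold ρ q v} ∪ ⋃ i ∈ I, {v | postThreshold ρ q v ≤ ρ i} := by
      intro v (hv : _ ≠ _)
      rcases lt_or_gt_of_ne hv with h | h
      · refine Or.inr (Set.mem_biUnion (x := Tuple.sort ρ (firstCrossing q v)) ?_ ?_)
        · simp only [hI, Finset.coe_filter, Finset.mem_univ, true_and]; exact h
        · exact le_refl (postThreshold ρ q v)
      · exact Or.inl h
    refine (measureReal_mono hsub).trans ((measureReal_union_le _ _).trans ?_)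
    rw [hE, add_div, Finset.sum_div]
    refine add_le_add ?_ ((measureReal_biUnion_finset_le _ _).trans
      (Finset.sum_le_sum fun i hi => ?_))
    · refine (posterior_lt_postThreshold_le hw hc ρ hq0 hq1.le hlt).trans (le_of_eq ?_)
      rw [div_div, mul_comm]
    · refine (posterior_postThreshold_le_le hw hc ρ hq0 hq1.le (hIlt i hi)).trans (le_of_eq ?_)
      rw [div_div, mul_comm]
  have heq : (∫ v, postThreshold ρ q v ∂(posterior ρ w c)) - θ
      = ∫ v, (postThreshold ρ q v - θ) ∂(posterior ρ w c) := by
    rw [integral_sub hint' (integrable_const θ)]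
    simp
  rw [heq]
  calc |∫ v, (postThreshold ρ q v - θ) ∂(posterior ρ w c)|
      ≤ ∫ v, |postThreshold ρ q v - θ| ∂(posterior ρ w c) := abs_integral_le_integral_abs
    _ ≤ ∫ v, {v | postThreshold ρ q v ≠ θ}.indicator (fun _ => D) v ∂(posterior ρ w c) := by
        refine integral_mono hint.abs ((integrable_const D).indicator hms) fun v => ?_
        by_cases hv : postThreshold ρ q v = θ
        · simp [Set.indicator, hv]
        · simpa [Set.indicator, hv] using hbd v
    _ = D * (posterior ρ w c).real {v | postThreshold ρ q v ≠ θ} := by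
        rw [integral_indicator hms, setIntegral_const, smul_eq_mul, mul_comm]
    _ ≤ D * (E / c) := by
        have : 0 ≤ D := Finset.sum_nonneg fun i _ => abs_nonneg _
        gcongr
    _ = D * E / c := by ring

lemma postVar_eq (hw : ∀ i, 0 < w i) (hc : 0 < c) (ρ : Fin n → ℝ) (j : Fin n) :
    postVar ρ w c j = cumSum (sortedWeight ρ w) j * (1 - cumSum (sortedWeight ρ w) j) / (c + 1) :=
  (block_posterior_moments hw hc ρ (Finset.Iic j)).2

end Posterior

/-- The empirical process at `t`, as a sum of independent centred variables. -/
lemma scaled_weightedCDF_sub_cdf (P : Measure ℝ) {n : ℕ} [NeZero n] {w : Fin n → ℝ} (hw : ∀ i, 0 < w i) (t : ℝ) (ρ : Fin n → ℝ) :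
    √(nEff w) * (weightedCDF w ρ t - cdf P t)
      = ∑ i, √(nEff w) * normWeight w i * ((Set.Iic t).indicator 1 (ρ i) - cdf P t) := by
  simp only [weightedCDF, mul_sub, Finset.sum_sub_distrib, ← Finset.sum_mul, ← Finset.mul_sum,
    sum_normWeight hw, one_mul, mul_assoc]

/-! ### Moments and tails of the empirical distribution function under sampling. -/

section Sampling

variable {n : ℕ} (P : Measure ℝ) [IsProbabilityMeasure P]

instance isProbabilityMeasure_sampling : IsProbabilityMeasure (sampling n P) := by
  unfold sampling; infer_instance

lemma measurable_weightedCDF (w : Fin n → ℝ) (t : ℝ) : Measurable fun ρ => weightedCDF w ρ t := by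
  unfold weightedCDF
  have h : Measurable ((Set.Iic t).indicator (1 : ℝ → ℝ)) := measurable_one.indicator measurableSet_Iic
  fun_prop

/-- An indicator is a Bernoulli variable. The target space is general so that the formula serves
both real moments and complex characteristic functions. -/
lemma integral_comp_indicator_one {E : Type*} [NormedAddCommGroup E] [NormedSpace ℝ E]
    [CompleteSpace E] {A : Set ℝ} (hA : MeasurableSet A) (h : ℝ → E) :
    ∫ x, h (A.indicator 1 x) ∂P = P.real A • h 1 + (1 - P.real A) • h 0 := by
  classical
  have e : (fun x => h (A.indicator 1 x))
      = fun x => A.indicator (fun _ => h 1) x + Aᶜ.indicator (fun _ => h 0) x := by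
    ext x
    by_cases hx : x ∈ A <;> simp [hx]
  rw [e, integral_add ((integrable_const _).indicator hA) ((integrable_const _).indicator hA.compl),
    integral_indicator hA, integral_indicator hA.compl, setIntegral_const, setIntegral_const,
    probReal_compl_eq_one_sub hA]

lemma memLp_indicator_one {A : Set ℝ} (hA : MeasurableSet A) (p : ENNReal) :
    MemLp (A.indicator (1 : ℝ → ℝ)) p P :=
  memLp_indicator_const p hA 1 (Or.inr (measure_ne_top _ _))

lemma variance_indicator_one {A : Set ℝ} (hA : MeasurableSet A) :
    variance (A.indicator (1 : ℝ → ℝ)) P = P.real A * (1 - P.real A) := by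
  rw [variance_eq_sub (memLp_indicator_one P hA 2)]
  have h1 := integral_comp_indicator_one P hA (fun x : ℝ => x)
  have h2 := integral_comp_indicator_one P hA (fun x : ℝ => x ^ 2)
  simp only [Pi.pow_apply]
  rw [h1, h2]
  simp
  ring

lemma measurePreserving_eval_sampling (i : Fin n) :
    MeasurePreserving (fun ρ : Fin n → ℝ => ρ i) (sampling n P) P :=
  measurePreserving_eval (fun _ => P) i

lemma memLp_weighted_indicator {A : Set ℝ} (hA : MeasurableSet A) (a : Fin n → ℝ) :
    MemLp (fun ρ : Fin n → ℝ => ∑ i, a i * A.indicator 1 (ρ i)) 2 (sampling n P) :=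
  memLp_finsetSum _ fun i _ => ((memLp_indicator_one P hA 2).comp_measurePreserving
    (measurePreserving_eval_sampling P i)).const_mul (a i)

lemma integral_weighted_indicator {A : Set ℝ} (hA : MeasurableSet A) (a : Fin n → ℝ) :
    ∫ ρ, ∑ i, a i * A.indicator 1 (ρ i) ∂(sampling n P) = (∑ i, a i) * P.real A := by
  have hi : ∀ i, Integrable (fun ρ : Fin n → ℝ => a i * A.indicator 1 (ρ i)) (sampling n P) :=
    fun i => (((memLp_indicator_one P hA 1).comp_measurePreserving
      (measurePreserving_eval_sampling P i)).const_mul (a i)).integrable le_rfl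
  rw [integral_finsetSum _ fun i _ => hi i, Finset.sum_mul]
  refine Finset.sum_congr rfl fun i _ => ?_
  rw [integral_const_mul]
  congr 1
  have h := (measurePreserving_eval_sampling (n := n) P i).map_eq
  have hm : AEStronglyMeasurable (A.indicator (1 : ℝ → ℝ))
      ((sampling n P).map fun ρ => ρ i) :=
    (measurable_one.indicator hA).aestronglyMeasurable
  rw [← integral_map (measurable_pi_apply i).aemeasurable hm, h]
  simpa using integral_comp_indicator_one P hA (fun x : ℝ => x)

lemma variance_weighted_indicator {A : Set ℝ} (hA : MeasurableSet A) (a : Fin n → ℝ) :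
    variance (fun ρ : Fin n → ℝ => ∑ i, a i * A.indicator 1 (ρ i)) (sampling n P)
      = (∑ i, a i ^ 2) * (P.real A * (1 - P.real A)) := by
  have h := variance_sum_pi (μ := fun _ : Fin n => P) (X := fun i x => a i * A.indicator 1 x)
    fun i => (memLp_indicator_one P hA 2).const_mul (a i)
  have e : (fun ρ : Fin n → ℝ => ∑ i, a i * A.indicator (1 : ℝ → ℝ) (ρ i))
      = ∑ i, fun ρ : Fin n → ℝ => a i * A.indicator (1 : ℝ → ℝ) (ρ i) := by
    ext ρ; simp
  rw [e, sampling, h, Finset.sum_mul]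
  refine Finset.sum_congr rfl fun i _ => ?_
  rw [variance_const_mul, ← variance_indicator_one P hA]

lemma freqVar_eq (w : Fin n → ℝ) (t : ℝ) :
    freqVar w P t = cdf P t * (1 - cdf P t) / nEff w := by
  have h := variance_weighted_indicator P (measurableSet_Iic (a := t)) (normWeight w)
  rw [sum_normWeight_sq, ← cdf_eq_real] at h
  rw [freqVar]
  refine Eq.trans h ?_
  ring

variable [NeZero n]

/-- Chebyshev's inequality for the indicator of `(s, t]`: the factor `n_eff` cancels the sum of
squared weights, and the Bernoulli variance is at most its mean. -/
lemma sampling_increment_ge_le {w : Fin n → ℝ} (hw : ∀ i, 0 < w i) {s t : ℝ} (hst : s ≤ t)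
    {ε : ℝ} (hε : 0 < ε) :
    (sampling n P).real {ρ | ε ≤ |√(nEff w) * (weightedCDF w ρ t - weightedCDF w ρ s
        - (cdf P t - cdf P s))|} ≤ (cdf P t - cdf P s) / ε ^ 2 := by
  have hn := nEff_pos hw
  have hsn := Real.sqrt_pos.2 hn
  have hA := measurableSet_Ioc (a := s) (b := t)
  have hP : P.real (Set.Ioc s t) = cdf P t - cdf P s := by
    rw [← Set.Iic_sdiff_Iic, measureReal_sdiff (Set.Iic_subset_Iic.2 hst) measurableSet_Iic,
      cdf_eq_real, cdf_eq_real]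
  have h := meas_ge_le_variance_div_sq (memLp_weighted_indicator P hA (normWeight w))
    (div_pos hε hsn)
  rw [integral_weighted_indicator P hA, variance_weighted_indicator P hA, sum_normWeight hw,
    one_mul, sum_normWeight_sq, hP] at h
  have hF : 0 ≤ cdf P t - cdf P s := sub_nonneg.2 (monotone_cdf P hst)
  refine ENNReal.toReal_le_of_le_ofReal (by positivity) (le_trans (le_of_eq ?_)
    (h.trans (ENNReal.ofReal_le_ofReal ?_)))
  · congr 1
    ext ρ
    have e : ∑ i, normWeight w i * (Set.Ioc s t).indicator 1 (ρ i)
        = weightedCDF w ρ t - weightedCDF w ρ s := by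
      simp only [weightedCDF]
      rw [← Finset.sum_sub_distrib]
      refine Finset.sum_congr rfl fun i _ => ?_
      rw [← mul_sub]
      congr 1
      by_cases h1 : ρ i ≤ s
      · simp [Set.indicator, h1, h1.trans hst, not_lt.2 h1]
      · by_cases h2 : ρ i ≤ t <;> simp [Set.indicator, h1, h2, not_le.1 h1]
    simp only [Set.mem_ofPred_eq]
    rw [e, abs_mul, abs_of_pos hsn, div_le_iff₀ hsn, mul_comm |_|]
  · rw [div_pow, Real.sq_sqrt hn.le]
    have : (cdf P t - cdf P s) * (1 - (cdf P t - cdf P s)) ≤ cdf P t - cdf P s := by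
      nlinarith [sq_nonneg (cdf P t - cdf P s)]
    calc 1 / nEff w * ((cdf P t - cdf P s) * (1 - (cdf P t - cdf P s))) / (ε ^ 2 / nEff w)
        = (cdf P t - cdf P s) * (1 - (cdf P t - cdf P s)) / ε ^ 2 := by field_simp
      _ ≤ _ := by gcongr

lemma sum_scaled_normWeight_sq {w : Fin n → ℝ} (hw : ∀ i, 0 < w i) :
    ∑ i, (√(nEff w) * normWeight w i) ^ 2 = 1 := by
  simp only [mul_pow, ← Finset.mul_sum, sum_normWeight_sq, Real.sq_sqrt (nEff_pos hw).le]
  rw [mul_one_div, div_self (nEff_pos hw).ne']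

/-- Hoeffding's lemma gives each centred indicator the variance proxy `1/4`, and the squared
coefficients sum to one. The proxy therefore does not depend on the weights, which makes the
fourth-moment bound uniform. -/
lemma hasSubgaussianMGF_empirical {w : Fin n → ℝ} (hw : ∀ i, 0 < w i) (t : ℝ) :
    HasSubgaussianMGF (fun ρ => √(nEff w) * (weightedCDF w ρ t - cdf P t)) (1 / 4)
      (sampling n P) := by
  simp only [scaled_weightedCDF_sub_cdf P hw t]
  have hm : Measurable ((Set.Iic t).indicator (1 : ℝ → ℝ)) :=
    measurable_one.indicator measurableSet_Iic
  have hind : iIndepFun (fun i (ρ : Fin n → ℝ) => √(nEff w) * normWeight w i *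
      ((Set.Iic t).indicator 1 (ρ i) - cdf P t)) (sampling n P) :=
    iIndepFun_pi (X := fun i x => √(nEff w) * normWeight w i *
      ((Set.Iic t).indicator 1 x - cdf P t)) fun i => by fun_prop
  have h1 : HasSubgaussianMGF (fun x => (Set.Iic t).indicator (1 : ℝ → ℝ) x - cdf P t)
      ((‖(1 : ℝ) - 0‖₊ / 2) ^ 2) P := by
    have h := hasSubgaussianMGF_of_mem_Icc (μ := P) (a := 0) (b := 1) hm.aemeasurable
      (ae_of_all _ fun x => ⟨Set.indicator_nonneg (fun _ _ => zero_le_one) x,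
        Set.indicator_le_self' (f := 1) (by simp) x⟩)
    have e := integral_comp_indicator_one P (measurableSet_Iic (a := t)) (fun x : ℝ => x)
    rw [e] at h
    simpa [← cdf_eq_real] using h
  have h2 : ∀ i, HasSubgaussianMGF (fun ρ : Fin n → ℝ => √(nEff w) * normWeight w i *
      ((Set.Iic t).indicator 1 (ρ i) - cdf P t))
      (NNReal.mk ((√(nEff w) * normWeight w i) ^ 2) (sq_nonneg _) * (‖(1 : ℝ) - 0‖₊ / 2) ^ 2)
      (sampling n P) := fun i => by
    refine HasSubgaussianMGF.const_mul ?_ _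
    refine HasSubgaussianMGF.of_map (Y := fun ρ : Fin n → ℝ => ρ i)
      (X := fun x => (Set.Iic t).indicator (1 : ℝ → ℝ) x - cdf P t) (measurable_pi_apply i).aemeasurable ?_
    rw [(measurePreserving_eval_sampling P i).map_eq]
    exact h1
  have h3 := HasSubgaussianMGF.sum_of_iIndepFun hind (s := Finset.univ) fun i _ => h2 i
  convert h3 using 1
  rw [← Finset.sum_mul]
  ext
  push_cast
  simp only [sum_scaled_normWeight_sq hw]
  norm_num

lemma integral_pow_four_le {Ω : Type*} [MeasurableSpace Ω] {μ : Measure Ω} [IsProbabilityMeasure μ]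
    {X : Ω → ℝ} (hX : AEMeasurable X μ) (h : HasSubgaussianMGF X (1 / 4) μ) :
    Integrable (fun ω => X ω ^ 4) μ ∧ ∫ ω, X ω ^ 4 ∂μ ≤ 144 := by
  -- One term of the exponential series gives `x ^ 4 / 24 ≤ exp |x|`. Each exponential moment at
  -- `±1` is at most `exp (1/8) ≤ 3`, whence `144 = 24 * (3 + 3)`.
  have hb : ∀ x : ℝ, x ^ 4 ≤ 24 * (Real.exp (1 * x) + Real.exp (-1 * x)) := by
    intro x
    have h1 := Real.pow_div_factorial_le_exp |x| (abs_nonneg x) 4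
    have h2 : Real.exp |x| ≤ Real.exp (1 * x) + Real.exp (-1 * x) := by
      rcases abs_cases x with ⟨hx, _⟩ | ⟨hx, _⟩ <;> rw [hx] <;>
        simp only [one_mul, neg_mul] <;> linarith [Real.exp_pos x, Real.exp_pos (-x)]
    have h3 : |x| ^ 4 = x ^ 4 := by
      rw [show 4 = 2 * 2 by rfl, pow_mul, sq_abs, ← pow_mul]
    rw [h3] at h1
    norm_num [Nat.factorial] at h1
    linarith
  have hi : Integrable (fun ω => 24 * (Real.exp (1 * X ω) + Real.exp (-1 * X ω))) μ :=
    ((h.integrable_exp_mul 1).add (h.integrable_exp_mul (-1))).const_mul 24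
  refine ⟨hi.mono' (by fun_prop) (ae_of_all _ fun ω => ?_), ?_⟩
  · rw [Real.norm_of_nonneg (by positivity)]
    exact hb _
  · have hi4 : Integrable (fun ω => X ω ^ 4) μ :=
      hi.mono' (by fun_prop) (ae_of_all _ fun ω => by
        rw [Real.norm_of_nonneg (by positivity)]; exact hb _)
    refine (integral_mono hi4 hi fun ω => hb _).trans ?_
    rw [integral_const_mul, integral_add (h.integrable_exp_mul 1) (h.integrable_exp_mul (-1))]
    have h1 := h.mgf_le 1
    have h2 := h.mgf_le (-1)
    simp only [mgf] at h1 h2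
    have h3 : Real.exp (((1 / 4 : NNReal) : ℝ) * 1 ^ 2 / 2) ≤ 3 := by
      refine le_trans (Real.exp_le_exp.2 ?_) (Real.exp_one_lt_d9.le.trans (by norm_num))
      push_cast
      norm_num
    have h4 : Real.exp (((1 / 4 : NNReal) : ℝ) * (-1) ^ 2 / 2) ≤ 3 := by
      rwa [neg_one_sq, ← one_pow (M := ℝ) 2]
    linarith

end Sampling

/-! ### Central limit theorem for the weighted empirical distribution function. -/

section Clt

/-- The factors are exchanged one at a time, all others having modulus at most one. -/
lemma norm_prod_sub_prod_le {ι : Type*} (s : Finset ι) {z u : ι → ℂ} (hz : ∀ i ∈ s, ‖z i‖ ≤ 1)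
    (hu : ∀ i ∈ s, ‖u i‖ ≤ 1) : ‖∏ i ∈ s, z i - ∏ i ∈ s, u i‖ ≤ ∑ i ∈ s, ‖z i - u i‖ := by
  classical
  induction s using Finset.induction_on with
  | empty => simp
  | insert a s ha ih =>
    rw [Finset.prod_insert ha, Finset.prod_insert ha, Finset.sum_insert ha]
    have h1 := ih (fun i hi => hz i (Finset.mem_insert_of_mem hi))
      (fun i hi => hu i (Finset.mem_insert_of_mem hi))
    have h2 : ‖∏ i ∈ s, u i‖ ≤ 1 := by
      rw [norm_prod]
      exact Finset.prod_le_one (fun _ _ => norm_nonneg _)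
        fun i hi => hu i (Finset.mem_insert_of_mem hi)
    have e : z a * ∏ i ∈ s, z i - u a * ∏ i ∈ s, u i
        = (z a - u a) * ∏ i ∈ s, u i + z a * (∏ i ∈ s, z i - ∏ i ∈ s, u i) := by ring
    rw [e]
    refine (norm_add_le _ _).trans (add_le_add ?_ ?_)
    · rw [norm_mul]; exact mul_le_of_le_one_right (norm_nonneg _) h2
    · rw [norm_mul]
      exact (mul_le_of_le_one_left (norm_nonneg _) (hz a (Finset.mem_insert_self a s))).trans h1

/-- The characteristic function of a centred Bernoulli variable, scaled by `a`, is close to the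
Gaussian one. -/
lemma norm_bernoulli_charFun_sub_le {p a : ℝ} (hp0 : 0 ≤ p) (hp1 : p ≤ 1) (ha0 : 0 ≤ a)
    (ha1 : a ≤ 1) (t : ℝ) :
    ‖((p : ℂ) * Complex.exp (t * a * (1 - p) * Complex.I)
        + (1 - p) * Complex.exp (t * a * (0 - p) * Complex.I))
      - Complex.exp (-(t ^ 2 * a ^ 2 * (p * (1 - p)) / 2))‖
      ≤ (|t| ^ 3 * Real.exp |t| + t ^ 4 * Real.exp (t ^ 2)) * a ^ 3 := by
  have hT : ∀ y : ℝ, |y| ≤ 1 → ‖Complex.exp (t * a * y * Complex.I)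
      - (1 + t * a * y * Complex.I + (t * a * y * Complex.I) ^ 2 / 2)‖
      ≤ |t| ^ 3 * Real.exp |t| * a ^ 3 := fun y hy => by
    have h := Complex.norm_exp_sub_sum_le_norm_mul_exp (t * a * y * Complex.I) 3
    have hn : ‖(t * a * y * Complex.I : ℂ)‖ = |t| * a * |y| := by
      simp [abs_of_nonneg ha0]
    have hn1 : |t| * a * |y| ≤ |t| * a := mul_le_of_le_one_right (by positivity) hy
    have hn2 : |t| * a ≤ |t| := mul_le_of_le_one_right (by positivity) ha1
    simp only [Finset.sum_range_succ, Finset.sum_range_zero, hn] at h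
    norm_num at h
    refine h.trans ?_
    calc (|t| * a * |y|) ^ 3 * Real.exp (|t| * a * |y|) ≤ (|t| * a) ^ 3 * Real.exp |t| := by
          gcongr
          exact hn1.trans hn2
      _ = _ := by ring
  have hv0 : 0 ≤ p * (1 - p) := mul_nonneg hp0 (by linarith)
  have hv1 : p * (1 - p) ≤ 1 := by nlinarith
  have hE : ‖Complex.exp (-(t ^ 2 * a ^ 2 * (p * (1 - p)) / 2))
      - (1 + -(t ^ 2 * a ^ 2 * (p * (1 - p)) / 2))‖ ≤ t ^ 4 * Real.exp (t ^ 2) * a ^ 3 := by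
    have h := Complex.norm_exp_sub_sum_le_norm_mul_exp (-(t ^ 2 * a ^ 2 * (p * (1 - p)) / 2)) 2
    have hn : ‖(-(t ^ 2 * a ^ 2 * (p * (1 - p)) / 2) : ℂ)‖ = t ^ 2 * a ^ 2 * (p * (1 - p)) / 2 := by
      have e : (-(t ^ 2 * a ^ 2 * (p * (1 - p)) / 2) : ℂ)
          = ((-(t ^ 2 * a ^ 2 * (p * (1 - p)) / 2) : ℝ) : ℂ) := by push_cast; ring
      rw [e, Complex.norm_real, Real.norm_eq_abs, abs_neg, abs_of_nonneg (by positivity)]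
    have hn1 : t ^ 2 * a ^ 2 * (p * (1 - p)) / 2 ≤ t ^ 2 * a ^ 2 := by
      have : t ^ 2 * a ^ 2 * (p * (1 - p)) ≤ t ^ 2 * a ^ 2 :=
        mul_le_of_le_one_right (by positivity) hv1
      have : 0 ≤ t ^ 2 * a ^ 2 := by positivity
      linarith
    have hn2 : t ^ 2 * a ^ 2 ≤ t ^ 2 :=
      mul_le_of_le_one_right (by positivity) (pow_le_one₀ ha0 ha1)
    simp only [Finset.sum_range_succ, Finset.sum_range_zero, hn] at h
    norm_num at h
    refine h.trans ?_
    calc (t ^ 2 * a ^ 2 * (p * (1 - p)) / 2) ^ 2 * Real.exp (t ^ 2 * a ^ 2 * (p * (1 - p)) / 2)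
        ≤ (t ^ 2 * a ^ 2) ^ 2 * Real.exp (t ^ 2) := by
          gcongr
          exact hn1.trans hn2
      _ = t ^ 4 * Real.exp (t ^ 2) * a ^ 3 * a := by ring
      _ ≤ _ := mul_le_of_le_one_right (by positivity) ha1
  have h1 := hT (1 - p) (by rw [abs_le]; constructor <;> linarith)
  have h2 := hT (0 - p) (by rw [abs_le]; constructor <;> linarith)
  push_cast at h1 h2
  set e1 := Complex.exp (t * a * (1 - p) * Complex.I)
  set e2 := Complex.exp (t * a * (0 - p) * Complex.I)
  set e3 := Complex.exp (-(t ^ 2 * a ^ 2 * (p * (1 - p)) / 2))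
  -- The linear Taylor terms cancel because the variable is centred, and the quadratic ones match
  -- the Gaussian variance, so only remainders of order `a ^ 3` survive.
  have e : (p : ℂ) * e1 + (1 - p) * e2 - e3
      = p * (e1 - (1 + t * a * (1 - p) * Complex.I + (t * a * (1 - p) * Complex.I) ^ 2 / 2))
        + (1 - p) * (e2 - (1 + t * a * (0 - p) * Complex.I + (t * a * (0 - p) * Complex.I) ^ 2 / 2))
        - (e3 - (1 + -(t ^ 2 * a ^ 2 * (p * (1 - p)) / 2))) := by
    ring_nf
    simp only [Complex.I_sq]
    ring
  rw [e]
  refine (norm_sub_le _ _).trans ?_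
  rw [add_mul]
  refine add_le_add ((norm_add_le _ _).trans ?_) hE
  rw [norm_mul, norm_mul]
  have hn1 : ‖(p : ℂ)‖ = p := by rw [Complex.norm_real, Real.norm_of_nonneg hp0]
  have hn2 : ‖(1 - p : ℂ)‖ = 1 - p := by
    rw [← Complex.ofReal_one, ← Complex.ofReal_sub, Complex.norm_real,
      Real.norm_of_nonneg (by linarith)]
  rw [hn1, hn2]
  have h3 := mul_le_mul_of_nonneg_left h1 hp0
  have h4 := mul_le_mul_of_nonneg_left h2 (show 0 ≤ 1 - p by linarith)
  linarith

variable (P : Measure ℝ) [IsProbabilityMeasure P]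

lemma charFun_map_empirical {n : ℕ} [NeZero n] {w : Fin n → ℝ} (hw : ∀ i, 0 < w i) (s d t : ℝ) :
    charFun ((sampling n P).map fun ρ => √(nEff w) * (weightedCDF w ρ s - cdf P s) + d) t
      = (∏ i, ((cdf P s : ℂ) * Complex.exp (t * (√(nEff w) * normWeight w i : ℝ) * (1 - cdf P s)
            * Complex.I)
          + (1 - cdf P s) * Complex.exp (t * (√(nEff w) * normWeight w i : ℝ) * (0 - cdf P s)
            * Complex.I))) * Complex.exp (t * d * Complex.I) := by
  have hm : Measurable fun ρ => √(nEff w) * (weightedCDF w ρ s - cdf P s) + d := by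
    have := measurable_weightedCDF w s
    fun_prop
  rw [charFun_apply_real, integral_map hm.aemeasurable (by fun_prop)]
  have e : ∀ ρ : Fin n → ℝ,
      Complex.exp (t * ((√(nEff w) * (weightedCDF w ρ s - cdf P s) + d : ℝ) : ℂ) * Complex.I)
      = (∏ i, Complex.exp (t * (√(nEff w) * normWeight w i : ℝ) *
          (((Set.Iic s).indicator (1 : ℝ → ℝ) (ρ i) : ℝ) - cdf P s) * Complex.I))
        * Complex.exp (t * d * Complex.I) := fun ρ => by
    rw [← Complex.exp_sum, ← Complex.exp_add, scaled_weightedCDF_sub_cdf P hw]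
    congr 1
    push_cast
    rw [mul_add, add_mul, Finset.mul_sum, Finset.sum_mul]
    congr 1
    refine Finset.sum_congr rfl fun i _ => ?_
    ring
  simp only [e]
  rw [integral_mul_const, sampling, integral_fintype_prod_eq_prod (f := fun i x =>
    Complex.exp (t * (√(nEff w) * normWeight w i : ℝ) *
          (((Set.Iic s).indicator (1 : ℝ → ℝ) x : ℝ) - cdf P s) * Complex.I))]
  congr 1
  refine Finset.prod_congr rfl fun i _ => ?_
  rw [integral_comp_indicator_one P measurableSet_Iic (fun y : ℝ =>
    Complex.exp (t * (√(nEff w) * normWeight w i : ℝ) * ((y : ℝ) - cdf P s) * Complex.I)),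
    ← cdf_eq_real]
  simp

/-- Central limit theorem for the weighted empirical distribution function at a moving point. -/
lemma tendsto_charFun_empirical {m : ℕ → ℕ} [∀ k, NeZero (m k)] {w : ∀ k, Fin (m k) → ℝ}
    (hw : ∀ k i, 0 < w k i)
    (hmax : ∀ ε > 0, ∀ᶠ k in atTop, ∀ i, √(nEff (w k)) * normWeight (w k) i ≤ ε)
    {s d : ℕ → ℝ} {q d' : ℝ} (hs : Tendsto (fun k => cdf P (s k)) atTop (𝓝 q))
    (hd : Tendsto d atTop (𝓝 d')) (hq0 : 0 < q) (hq1 : q < 1) (t : ℝ) :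
    Tendsto (fun k => charFun ((sampling (m k) P).map fun ρ =>
        √(nEff (w k)) * (weightedCDF (w k) ρ (s k) - cdf P (s k)) + d k) t) atTop
      (𝓝 (charFun (gaussianReal d' (q * (1 - q)).toNNReal) t)) := by
  simp only [charFun_map_empirical P (hw _), charFun_gaussianReal]
  set A : ℕ → ℂ := fun k => ∏ i, ((cdf P (s k) : ℂ) *
      Complex.exp (t * (√(nEff (w k)) * normWeight (w k) i : ℝ) * (1 - cdf P (s k)) * Complex.I)
    + (1 - cdf P (s k)) *
      Complex.exp (t * (√(nEff (w k)) * normWeight (w k) i : ℝ) * (0 - cdf P (s k)) * Complex.I))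
    with hA
  have hK : ∃ K, 0 ≤ K ∧ K = |t| ^ 3 * Real.exp |t| + t ^ 4 * Real.exp (t ^ 2) :=
    ⟨_, by positivity, rfl⟩
  obtain ⟨K, hK0, hK⟩ := hK
  have hlim : Tendsto (fun k => Complex.exp (-(t ^ 2 * (cdf P (s k) * (1 - cdf P (s k))) / 2)))
      atTop (𝓝 (Complex.exp (-(t ^ 2 * (q * (1 - q)) / 2)))) := by
    have hsC : Tendsto (fun k => (cdf P (s k) : ℂ)) atTop (𝓝 (q : ℂ)) :=
      (Complex.continuous_ofReal.tendsto _).comp hs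
    exact (Complex.continuous_exp.tendsto _).comp
      ((((hsC.mul (hsC.const_sub 1)).const_mul _).div_const _).neg)
  have hdiff : Tendsto (fun k => A k
      - Complex.exp (-(t ^ 2 * (cdf P (s k) * (1 - cdf P (s k))) / 2))) atTop (𝓝 0) := by
    rw [Metric.tendsto_nhds]
    intro ε hε
    filter_upwards [hmax (ε / (2 * (K + 1))) (by positivity)] with k hk
    rw [dist_zero_right]
    have ha0 : ∀ i, 0 ≤ √(nEff (w k)) * normWeight (w k) i := fun i =>
      mul_nonneg (Real.sqrt_nonneg _) (normWeight_pos (hw k) i).le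
    have hsum := sum_scaled_normWeight_sq (hw k)
    have ha1 : ∀ i, √(nEff (w k)) * normWeight (w k) i ≤ 1 := fun i => by
      have h := Finset.single_le_sum (f := fun i => (√(nEff (w k)) * normWeight (w k) i) ^ 2)
        (fun i _ => sq_nonneg _) (Finset.mem_univ i)
      rw [hsum] at h
      exact (sq_le_one_iff₀ (ha0 i)).1 h
    have hp0 := cdf_nonneg P (s k)
    have hp1 := cdf_le_one P (s k)
    -- Since the squared coefficients sum to one, the Gaussian factor splits as a product over the
    -- same indices and can be compared factor by factor.
    have e : Complex.exp (-(t ^ 2 * (cdf P (s k) * (1 - cdf P (s k))) / 2))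
        = ∏ i, Complex.exp (-(t ^ 2 * ((√(nEff (w k)) * normWeight (w k) i : ℝ) : ℂ) ^ 2
          * (cdf P (s k) * (1 - cdf P (s k))) / 2)) := by
      rw [← Complex.exp_sum]
      congr 1
      have h2 : (∑ i, ((√(nEff (w k)) * normWeight (w k) i : ℝ) : ℂ) ^ 2) = 1 := by
        exact_mod_cast congrArg (fun x : ℝ => (x : ℂ)) hsum
      rw [Finset.sum_neg_distrib, ← Finset.sum_div, ← Finset.sum_mul, ← Finset.mul_sum, h2, mul_one]
    rw [e, hA]
    have hnorm : ∀ y : ℝ, ‖Complex.exp (y * Complex.I)‖ = 1 := Complex.norm_exp_ofReal_mul_I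
    refine (norm_prod_sub_prod_le _ (fun i _ => ?_) fun i _ => ?_).trans_lt ?_
    · refine (norm_add_le _ _).trans (le_of_eq ?_)
      have h1 := hnorm (t * (√(nEff (w k)) * normWeight (w k) i) * (1 - cdf P (s k)))
      have h2 := hnorm (t * (√(nEff (w k)) * normWeight (w k) i) * (0 - cdf P (s k)))
      push_cast at h1 h2 ⊢
      rw [norm_mul, norm_mul, h1, h2, ← Complex.ofReal_one, ← Complex.ofReal_sub,
        Complex.norm_real, Complex.norm_real, Real.norm_of_nonneg hp0,
        Real.norm_of_nonneg (by linarith)]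
      ring
    · rw [Complex.norm_exp, Real.exp_le_one_iff]
      have : (-(t ^ 2 * ((√(nEff (w k)) * normWeight (w k) i : ℝ) : ℂ) ^ 2
          * (cdf P (s k) * (1 - cdf P (s k))) / 2) : ℂ)
          = ((-(t ^ 2 * (√(nEff (w k)) * normWeight (w k) i) ^ 2
          * (cdf P (s k) * (1 - cdf P (s k))) / 2) : ℝ) : ℂ) := by push_cast; ring
      rw [this, Complex.ofReal_re]
      have := mul_nonneg hp0 (sub_nonneg.2 hp1)
      rw [neg_nonpos]
      positivity
    -- The sum of cubes is at most the largest coefficient times the sum of squares, hence at most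
    -- the largest coefficient.
    · calc _ ≤ ∑ i, K * (√(nEff (w k)) * normWeight (w k) i) ^ 3 := by
            refine Finset.sum_le_sum fun i _ => ?_
            rw [hK]
            exact norm_bernoulli_charFun_sub_le hp0 hp1 (ha0 i) (ha1 i) t
        _ ≤ ∑ i, K * (ε / (2 * (K + 1)) * (√(nEff (w k)) * normWeight (w k) i) ^ 2) := by
            refine Finset.sum_le_sum fun i _ => ?_
            rw [pow_succ' _ 2]
            have := hk i
            gcongr
        _ = K * (ε / (2 * (K + 1))) := by
            rw [← Finset.mul_sum, ← Finset.mul_sum, hsum, mul_one]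
        _ < ε := by
            rw [mul_div_assoc', div_lt_iff₀ (by positivity)]
            nlinarith
  have hA' : Tendsto A atTop (𝓝 (Complex.exp (-(t ^ 2 * (q * (1 - q)) / 2)))) := by
    have := hdiff.add hlim
    simpa using this
  have hdC : Tendsto (fun k => Complex.exp (t * d k * Complex.I)) atTop
      (𝓝 (Complex.exp (t * d' * Complex.I))) :=
    (Complex.continuous_exp.tendsto _).comp
      ((((Complex.continuous_ofReal.tendsto _).comp hd).const_mul _).mul_const _)
  have hfin := hA'.mul hdC
  rw [← Complex.exp_add] at hfin
  convert hfin using 3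
  rw [Real.coe_toNNReal _ (mul_nonneg hq0.le (by linarith))]
  push_cast
  ring

end Clt

/-! ### Local inversion of the empirical distribution function. -/

section Local

/-- The centred weighted empirical distribution function at `θ + y / √n_eff`, on the scale
`1 / √n_eff`. -/
noncomputable def localDeviation {n : ℕ} (w : Fin n → ℝ) (q θ : ℝ) (ρ : Fin n → ℝ) (y : ℝ) : ℝ :=
  √(nEff w) * (weightedCDF w ρ (θ + y / √(nEff w)) - q)

lemma localDeviation_mono {n : ℕ} [NeZero n] {w : Fin n → ℝ} (hw : ∀ i, 0 < w i) (q θ : ℝ)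
    (ρ : Fin n → ℝ) : Monotone (localDeviation w q θ ρ) := by
  intro y z hyz
  have := Real.sqrt_pos.2 (nEff_pos hw)
  have h := weightedCDF_mono hw ρ (show θ + y / √(nEff w) ≤ θ + z / √(nEff w) by gcongr)
  unfold localDeviation
  gcongr

lemma measurable_localDeviation {n : ℕ} (w : Fin n → ℝ) (q θ y : ℝ) :
    Measurable fun ρ => localDeviation w q θ ρ y := by
  have := measurable_weightedCDF w (θ + y / √(nEff w))
  unfold localDeviation
  fun_prop

/-- The quantile error is the point where the monotone local deviation becomes nonnegative, so the
sign of the deviation locates it. -/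
lemma freqError_le_iff {n : ℕ} [NeZero n] {w : Fin n → ℝ} (hw : ∀ i, 0 < w i) {q : ℝ}
    (hq0 : 0 < q) (hq1 : q ≤ 1) (θ : ℝ) (ρ : Fin n → ℝ) (y : ℝ) :
    freqError w q θ ρ ≤ y ↔ 0 ≤ localDeviation w q θ ρ y := by
  have hs := Real.sqrt_pos.2 (nEff_pos hw)
  rw [localDeviation, mul_nonneg_iff_of_pos_left hs, sub_nonneg, ← wcpThreshold_le_iff hw ρ hq0 hq1,
    freqError, ← sub_le_iff_le_add', le_div_iff₀' hs]

lemma measurable_freqError {n : ℕ} [NeZero n] {w : Fin n → ℝ} (hw : ∀ i, 0 < w i) {q : ℝ}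
    (hq0 : 0 < q) (hq1 : q ≤ 1) (θ : ℝ) : Measurable (freqError w q θ) := by
  refine measurable_of_Iic fun y => ?_
  have : freqError w q θ ⁻¹' Set.Iic y = {ρ | 0 ≤ localDeviation w q θ ρ y} := by
    ext ρ
    exact freqError_le_iff hw hq0 hq1 θ ρ y
  rw [this]
  exact measurableSet_le measurable_const (measurable_localDeviation w q θ y)

lemma localDeviation_freqError_add {n : ℕ} [NeZero n] {w : Fin n → ℝ} (hw : ∀ i, 0 < w i)
    (q θ : ℝ) (ρ : Fin n → ℝ) (x : ℝ) :
    localDeviation w q θ ρ (freqError w q θ ρ + x)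
      = √(nEff w) * (weightedCDF w ρ (wcpThreshold w ρ q + x / √(nEff w)) - q) := by
  have hs := Real.sqrt_pos.2 (nEff_pos hw)
  rw [localDeviation, freqError]
  congr 3
  field_simp
  ring

/-- If the local deviation is nearly linear with slope `f`, then so is its zero. -/
lemma linearization {n : ℕ} [NeZero n] {w : Fin n → ℝ} (hw : ∀ i, 0 < w i) {q : ℝ}
    (hq0 : 0 < q) (hq1 : q ≤ 1) {θ f δ R x : ℝ} (hf : 0 < f) (hδ : 0 < δ) {ρ : Fin n → ℝ}
    (hR : |localDeviation w q θ ρ 0| ≤ R)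
    (h : ∀ y, |y| ≤ (R + 3 * δ) / f + |x| →
      |localDeviation w q θ ρ y - localDeviation w q θ ρ 0 - f * y| ≤ δ) :
    |localDeviation w q θ ρ 0 + f * freqError w q θ ρ| ≤ 2 * δ ∧
    |localDeviation w q θ ρ (freqError w q θ ρ + x) - f * x| ≤ 3 * δ := by
  set Z := localDeviation w q θ ρ 0
  set X := freqError w q θ ρ
  have hR0 : 0 ≤ R := (abs_nonneg _).trans hR
  obtain ⟨hZ1, hZ2⟩ := abs_le.1 hR
  have hx := abs_nonneg x
  have hδf : 0 < δ / f := div_pos hδ hf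
  have hM : (R + 3 * δ) / f = (R + 2 * δ) / f + δ / f := by ring
  have hM0 : 0 ≤ (R + 2 * δ) / f := by positivity
  have hfM : f * ((R + 2 * δ) / f) = R + 2 * δ := by field_simp
  -- At `±(R + 2 * δ) / f` the linear part `±(R + 2 * δ)` outweighs both the value at `0`, at most
  -- `R`, and the error `δ`, so the sign of the deviation is forced.
  have hX1 : X ≤ (R + 2 * δ) / f := by
    rw [freqError_le_iff hw hq0 hq1]
    have h1 := abs_le.1 (h ((R + 2 * δ) / f) (by rw [abs_of_nonneg hM0]; linarith))
    rw [hfM] at h1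
    linarith [h1.1]
  have hX2 : -((R + 2 * δ) / f) < X := by
    rw [← not_le, freqError_le_iff hw hq0 hq1, not_le]
    have h1 := abs_le.1 (h (-((R + 2 * δ) / f)) (by rw [abs_neg, abs_of_nonneg hM0]; linarith))
    rw [mul_neg, hfM] at h1
    linarith [h1.2]
  have hXabs : |X| ≤ (R + 2 * δ) / f := abs_le.2 ⟨hX2.le, hX1⟩
  have hHX : 0 ≤ localDeviation w q θ ρ X := (freqError_le_iff hw hq0 hq1 θ ρ X).1 le_rfl
  have h1 := abs_le.1 (h X (by linarith))
  -- The deviation need not vanish at `X`, since it jumps. Slightly to the left it is negative while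
  -- the line has dropped by only `δ`; this supplies the missing upper bound.
  have hlt : localDeviation w q θ ρ (X - δ / f) < 0 := by
    rw [← not_le, ← freqError_le_iff hw hq0 hq1, not_le]
    exact sub_lt_self _ hδf
  have h2 := abs_le.1 (h (X - δ / f) (by
    refine (abs_sub _ _).trans ?_
    rw [abs_of_pos hδf]; linarith))
  have h3 := abs_le.1 (h (X + x) ((abs_add_le _ _).trans (by linarith)))
  have e : f * (X - δ / f) = f * X - δ := by field_simp
  rw [e] at h2
  rw [mul_add] at h3
  refine ⟨abs_le.2 ⟨?_, ?_⟩, abs_le.2 ⟨?_, ?_⟩⟩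
  · linarith [h1.2]
  · linarith [h2.1]
  · linarith [h3.1, h1.2]
  · linarith [h3.2, h2.1]

end Local

/-! ### Uniform linearization and Bahadur's representation. -/

section Asymptotics

lemma tendsto_sqrt_nEff {m : ℕ → ℕ} {w : ∀ k, Fin (m k) → ℝ}
    (hn : Tendsto (fun k => nEff (w k)) atTop atTop) :
    Tendsto (fun k => √(nEff (w k))) atTop atTop :=
  Real.tendsto_sqrt_atTop.comp hn

lemma tendsto_cdf_local {m : ℕ → ℕ} {w : ∀ k, Fin (m k) → ℝ} {P : Measure ℝ} {q θ f : ℝ}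
    (hn : Tendsto (fun k => nEff (w k)) atTop atTop)
    (hθ : cdf P θ = q) (hf : HasDerivAt (cdf P) f θ) (y : ℝ) :
    Tendsto (fun k => cdf P (θ + y / √(nEff (w k)))) atTop (𝓝 q) := by
  have h : Tendsto (fun k => θ + y / √(nEff (w k))) atTop (𝓝 (θ + 0)) :=
    ((tendsto_sqrt_nEff hn).const_div_atTop y).const_add θ
  rw [add_zero] at h
  rw [← hθ]
  exact hf.continuousAt.tendsto.comp h

variable {q : ℝ} {m : ℕ → ℕ} [∀ k, NeZero (m k)] {w : ∀ k, Fin (m k) → ℝ}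
  {P : Measure ℝ} {θ f : ℝ}

lemma tendsto_local_cdf (hw : ∀ k i, 0 < w k i) (hn : Tendsto (fun k => nEff (w k)) atTop atTop)
    (hθ : cdf P θ = q) (hf : HasDerivAt (cdf P) f θ) (y : ℝ) :
    Tendsto (fun k => √(nEff (w k)) * (cdf P (θ + y / √(nEff (w k))) - q)) atTop (𝓝 (f * y)) := by
  have h1 : HasDerivAt (fun t : ℝ => cdf P (θ + t * y)) (f * y) 0 := by
    have h0 : HasDerivAt (fun t : ℝ => θ + t * y) y 0 := by
      simpa using ((hasDerivAt_id (0 : ℝ)).mul_const y).const_add θ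
    exact HasDerivAt.comp (0 : ℝ) (by simpa using hf) h0
  rw [hasDerivAt_iff_tendsto_slope_zero] at h1
  have h2 : Tendsto (fun k => 1 / √(nEff (w k))) atTop (𝓝[≠] 0) := by
    rw [tendsto_nhdsWithin_iff]
    refine ⟨(tendsto_sqrt_nEff hn).const_div_atTop _, Eventually.of_forall fun k => ?_⟩
    exact one_div_ne_zero (Real.sqrt_pos.2 (nEff_pos (hw k))).ne'
  refine (h1.comp h2).congr fun k => ?_
  simp only [Function.comp_apply, zero_add, zero_mul, add_zero, smul_eq_mul, one_div, inv_inv, hθ]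
  rw [inv_mul_eq_div]

variable [IsProbabilityMeasure P]

/-- Half of `δ` absorbs the deterministic error of the derivative. The other half is exceeded by the
random increment with probability of order `F(θ + y / √n_eff) - q`, in absolute value, which tends
to `0`. -/
lemma tendsto_localDeviation_sub (hw : ∀ k i, 0 < w k i)
    (hn : Tendsto (fun k => nEff (w k)) atTop atTop) (hθ : cdf P θ = q)
    (hf : HasDerivAt (cdf P) f θ) (y : ℝ) {δ : ℝ} (hδ : 0 < δ) :
    Tendsto (fun k => (sampling (m k) P).real {ρ | δ < |localDeviation (w k) q θ ρ y
      - localDeviation (w k) q θ ρ 0 - f * y|}) atTop (𝓝 0) := by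
  have hlim : Tendsto (fun k => |cdf P (θ + y / √(nEff (w k))) - q| / (δ / 2) ^ 2) atTop (𝓝 0) := by
    have := (((tendsto_cdf_local hn hθ hf y).sub_const q).abs).div_const ((δ / 2) ^ 2)
    simpa using this
  refine squeeze_zero' (Eventually.of_forall fun k => measureReal_nonneg) ?_ hlim
  have h2 := (tendsto_iff_norm_sub_tendsto_zero.1
    (tendsto_local_cdf hw hn hθ hf y)).eventually_le_const (half_pos hδ)
  filter_upwards [h2] with k hk
  rw [Real.norm_eq_abs] at hk
  have hs := Real.sqrt_pos.2 (nEff_pos (hw k))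
  have key : ∀ ρ, δ < |localDeviation (w k) q θ ρ y - localDeviation (w k) q θ ρ 0 - f * y| →
      δ / 2 ≤ |√(nEff (w k)) * (weightedCDF (w k) ρ (θ + y / √(nEff (w k)))
        - weightedCDF (w k) ρ θ - (cdf P (θ + y / √(nEff (w k))) - cdf P θ))| := by
    intro ρ hρ
    have e : localDeviation (w k) q θ ρ y - localDeviation (w k) q θ ρ 0 - f * y
        = √(nEff (w k)) * (weightedCDF (w k) ρ (θ + y / √(nEff (w k)))
        - weightedCDF (w k) ρ θ - (cdf P (θ + y / √(nEff (w k))) - cdf P θ))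
        + (√(nEff (w k)) * (cdf P (θ + y / √(nEff (w k))) - q) - f * y) := by
      simp only [localDeviation, zero_div, add_zero, hθ]; ring
    rw [e] at hρ
    have := abs_add_le (√(nEff (w k)) * (weightedCDF (w k) ρ (θ + y / √(nEff (w k)))
        - weightedCDF (w k) ρ θ - (cdf P (θ + y / √(nEff (w k))) - cdf P θ)))
        (√(nEff (w k)) * (cdf P (θ + y / √(nEff (w k))) - q) - f * y)
    linarith
  refine (measureReal_mono key).trans ?_
  rcases le_total 0 y with hy | hy
  · have hle : θ ≤ θ + y / √(nEff (w k)) := le_add_of_nonneg_right (by positivity)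
    refine (sampling_increment_ge_le P (hw k) hle (half_pos hδ)).trans (le_of_eq ?_)
    rw [hθ, abs_of_nonneg]
    rw [← hθ]
    exact sub_nonneg.2 (monotone_cdf P hle)
  · have hle : θ + y / √(nEff (w k)) ≤ θ :=
      add_le_of_nonpos_right (div_nonpos_of_nonpos_of_nonneg hy hs.le)
    have h := sampling_increment_ge_le P (hw k) hle (half_pos hδ)
    rw [hθ] at h
    have hF : cdf P (θ + y / √(nEff (w k))) ≤ q := by rw [← hθ]; exact monotone_cdf P hle
    rw [abs_of_nonpos (by linarith), neg_sub]
    refine (measureReal_mono fun ρ hρ => ?_).trans h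
    have hρ' : δ / 2 ≤ |√(nEff (w k)) * (weightedCDF (w k) ρ (θ + y / √(nEff (w k)))
        - weightedCDF (w k) ρ θ - (cdf P (θ + y / √(nEff (w k))) - cdf P θ))| := hρ
    rw [← abs_neg, hθ] at hρ'
    refine hρ'.trans (le_of_eq ?_)
    congr 1
    ring

/-- The local deviation is uniformly close to a line on bounded sets, with high probability. -/
lemma eventually_localDeviation_uniform (hw : ∀ k i, 0 < w k i)
    (hn : Tendsto (fun k => nEff (w k)) atTop atTop) (hθ : cdf P θ = q) (hf0 : 0 < f)
    (hf : HasDerivAt (cdf P) f θ) (M : ℝ) {δ ε : ℝ} (hδ : 0 < δ) (hε : 0 < ε) :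
    ∀ᶠ k in atTop, ∃ B, (sampling (m k) P).real B ≤ ε ∧ ∀ ρ ∉ B, ∀ y, |y| ≤ M →
      |localDeviation (w k) q θ ρ y - localDeviation (w k) q θ ρ 0 - f * y| ≤ δ := by
  -- On this mesh the line rises by `δ / 2` per cell. Monotonicity traps the deviation between
  -- neighbouring grid points, where the error is at most `δ / 2`, and finitely many points cover
  -- `[-M, M]`.
  set h := δ / (2 * f) with hh
  have hh0 : 0 < h := by positivity
  obtain ⟨N, hN⟩ := exists_nat_gt (2 * M / h + 1)
  have hsum : Tendsto (fun k => ∑ i ∈ Finset.range (N + 1), (sampling (m k) P).real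
      {ρ | δ / 2 < |localDeviation (w k) q θ ρ (-M + i * h) - localDeviation (w k) q θ ρ 0
        - f * (-M + i * h)|}) atTop (𝓝 0) := by
    have := tendsto_finsetSum (Finset.range (N + 1)) fun i _ =>
      tendsto_localDeviation_sub hw hn hθ hf (-M + i * h) (half_pos hδ)
    simpa using this
  filter_upwards [hsum.eventually_le_const hε] with k hk
  refine ⟨⋃ i ∈ Finset.range (N + 1),
      {ρ | δ / 2 < |localDeviation (w k) q θ ρ (-M + i * h) - localDeviation (w k) q θ ρ 0
        - f * (-M + i * h)|}, (measureReal_biUnion_finset_le _ _).trans hk, fun ρ hρ y hy => ?_⟩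
  simp only [Set.mem_iUnion, Set.mem_ofPred_eq, not_exists, not_lt] at hρ
  obtain ⟨hy1, hy2⟩ := abs_le.1 hy
  have hu0 : 0 ≤ (y + M) / h := div_nonneg (by linarith) hh0.le
  set i := ⌊(y + M) / h⌋₊ with hi
  have hi1 : (i : ℝ) ≤ (y + M) / h := Nat.floor_le hu0
  have hi2 : (y + M) / h < i + 1 := Nat.lt_floor_add_one _
  have hiN : i + 1 ≤ N := by
    have h1 : (y + M) / h ≤ 2 * M / h := by gcongr; linarith
    have : ((i + 1 : ℕ) : ℝ) < N := by push_cast; linarith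
    exact_mod_cast this.le
  rw [le_div_iff₀ hh0] at hi1
  rw [div_lt_iff₀ hh0] at hi2
  have hlo := abs_le.1 (hρ i (Finset.mem_range.2 (by omega)))
  have hhi := abs_le.1 (hρ (i + 1) (Finset.mem_range.2 (by omega)))
  push_cast at hhi
  have hm1 := localDeviation_mono (hw k) q θ ρ (show -M + i * h ≤ y by linarith)
  have hm2 := localDeviation_mono (hw k) q θ ρ (show y ≤ -M + (i + 1) * h by linarith)
  have hfh : f * h = δ / 2 := by rw [hh]; field_simp
  have e1 : f * y ≤ f * (-M + i * h) + δ / 2 := by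
    rw [← hfh, ← mul_add]; exact mul_le_mul_of_nonneg_left (by linarith) hf0.le
  have e2 : f * (-M + (i + 1) * h) ≤ f * y + δ / 2 := by
    rw [← hfh, ← mul_add]; exact mul_le_mul_of_nonneg_left (by linarith) hf0.le
  rw [abs_le]
  constructor
  · linarith [hlo.1]
  · linarith [hhi.2]

lemma localDeviation_zero_moments (hw : ∀ k i, 0 < w k i) (hθ : cdf P θ = q) (k : ℕ) :
    ∫ ρ, localDeviation (w k) q θ ρ 0 ∂(sampling (m k) P) = 0 ∧
    ∫ ρ, localDeviation (w k) q θ ρ 0 ^ 2 ∂(sampling (m k) P) = q * (1 - q) ∧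
    Integrable (fun ρ => localDeviation (w k) q θ ρ 0 ^ 4) (sampling (m k) P) ∧
    ∫ ρ, localDeviation (w k) q θ ρ 0 ^ 4 ∂(sampling (m k) P) ≤ 144 := by
  have e : (fun ρ => localDeviation (w k) q θ ρ 0)
      = fun ρ => √(nEff (w k)) * (weightedCDF (w k) ρ θ - cdf P θ) := by
    ext ρ; simp [localDeviation, hθ]
  have hsub := hasSubgaussianMGF_empirical P (hw k) θ
  rw [← e] at hsub
  have hm := measurable_localDeviation (w k) q θ 0
  have h4 := integral_pow_four_le hm.aemeasurable hsub
  have hmean : ∫ ρ, weightedCDF (w k) ρ θ ∂(sampling (m k) P) = q := by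
    have h := integral_weighted_indicator P (measurableSet_Iic (a := θ)) (normWeight (w k))
    rw [sum_normWeight (hw k), one_mul, ← cdf_eq_real, hθ] at h
    exact h
  have hL : MemLp (fun ρ => weightedCDF (w k) ρ θ) 2 (sampling (m k) P) :=
    memLp_weighted_indicator P (measurableSet_Iic (a := θ)) (normWeight (w k))
  have h1 : ∫ ρ, localDeviation (w k) q θ ρ 0 ∂(sampling (m k) P) = 0 := by
    rw [e, integral_const_mul, integral_sub (hL.integrable (by norm_num)) (integrable_const _),
      hmean]
    simp [hθ]
  refine ⟨h1, ?_, h4.1, h4.2⟩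
  have hv : variance (fun ρ => localDeviation (w k) q θ ρ 0) (sampling (m k) P) = q * (1 - q) := by
    rw [e, variance_const_mul, variance_sub_const hL.aestronglyMeasurable,
      Real.sq_sqrt (nEff_pos (hw k)).le]
    change _ * freqVar (w k) P θ = _
    rw [freqVar_eq, hθ]
    have := (nEff_pos (hw k)).ne'
    field_simp
  rw [variance_of_integral_eq_zero hm.aemeasurable h1] at hv
  exact hv

lemma localDeviation_zero_tail (hw : ∀ k i, 0 < w k i) (hθ : cdf P θ = q) (k : ℕ) {R : ℝ}
    (hR : 0 < R) :
    (sampling (m k) P).real {ρ | R < |localDeviation (w k) q θ ρ 0|} ≤ 144 / R ^ 4 := by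
  obtain ⟨-, -, hi, h4⟩ := localDeviation_zero_moments (P := P) hw hθ k
  have h := mul_meas_ge_le_integral_of_nonneg (μ := sampling (m k) P)
    (f := fun ρ => localDeviation (w k) q θ ρ 0 ^ 4) (ae_of_all _ fun ρ => by positivity) hi (R ^ 4)
  rw [le_div_iff₀ (by positivity), mul_comm]
  refine le_trans (mul_le_mul_of_nonneg_left (measureReal_mono fun ρ (hρ : R < |_|) => ?_)
    (by positivity)) (h.trans h4)
  change R ^ 4 ≤ localDeviation (w k) q θ ρ 0 ^ 4
  have e : |localDeviation (w k) q θ ρ 0| ^ 4 = localDeviation (w k) q θ ρ 0 ^ 4 := by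
    rw [show 4 = 2 * 2 by rfl, pow_mul, sq_abs, ← pow_mul]
  rw [← e]
  gcongr

/-- Bahadur's representation of the weighted sample quantile, and the local behaviour of the
weighted empirical distribution function around it. -/
lemma eventually_bahadur (hq0 : 0 < q) (hq1 : q < 1) (hw : ∀ k i, 0 < w k i)
    (hn : Tendsto (fun k => nEff (w k)) atTop atTop) (hθ : cdf P θ = q) (hf0 : 0 < f)
    (hf : HasDerivAt (cdf P) f θ) (x : ℝ) {δ ε : ℝ} (hδ : 0 < δ) (hε : 0 < ε) :
    ∀ᶠ k in atTop, ∃ B, (sampling (m k) P).real B ≤ ε ∧ ∀ ρ ∉ B,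
      |localDeviation (w k) q θ ρ 0 + f * freqError (w k) q θ ρ| ≤ δ ∧
      |√(nEff (w k)) * (weightedCDF (w k) ρ (wcpThreshold (w k) ρ q + x / √(nEff (w k))) - q)
        - f * x| ≤ δ := by
  -- Chosen so that `R ≥ 1` and `ε / 2 * R ≥ 144`; with `R ≤ R ^ 4` the fourth-moment tail is at
  -- most `ε / 2`.
  set R := 1 + 288 / ε with hR
  have hR1 : 1 ≤ R := le_add_of_nonneg_right (by positivity)
  have hR4 : 144 / R ^ 4 ≤ ε / 2 := by
    rw [div_le_iff₀ (by positivity)]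
    have h1 : R ≤ R ^ 4 := le_self_pow₀ hR1 (by norm_num)
    have h2 : ε / 2 * R = ε / 2 + 144 := by rw [hR]; field_simp; ring
    have h3 : ε / 2 * R ≤ ε / 2 * R ^ 4 := by gcongr
    linarith
  have hδ3 : 0 < δ / 3 := by positivity
  filter_upwards [eventually_localDeviation_uniform hw hn hθ hf0 hf ((R + 3 * (δ / 3)) / f + |x|) hδ3
    (half_pos hε)] with k ⟨B, hB, hB'⟩
  refine ⟨B ∪ {ρ | R < |localDeviation (w k) q θ ρ 0|}, (measureReal_union_le _ _).trans ?_,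
    fun ρ hρ => ?_⟩
  · have := localDeviation_zero_tail (P := P) hw hθ k (R := R) (by linarith)
    linarith
  · simp only [Set.mem_union, Set.mem_ofPred_eq, not_or, not_lt] at hρ
    have h := linearization (hw k) hq0 hq1.le hf0 hδ3 hρ.2 (hB' ρ hρ.1)
    rw [localDeviation_freqError_add (hw k)] at h
    exact ⟨h.1.trans (by linarith), h.2.trans (by linarith)⟩

end Asymptotics

/-! ### Stability of truncated moments. -/

section Truncation

variable {Ω : Type*} [MeasurableSpace Ω] {μ : Measure Ω} [IsProbabilityMeasure μ]

/-- Where the variables are `δ`-close the Lipschitz bound applies, elsewhere the sup bound. No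
moment of `X` or `Y` is required. -/
lemma abs_integral_comp_sub_le {X Y : Ω → ℝ} (hX : Measurable X) (hY : Measurable Y)
    {φ : ℝ → ℝ} (hφ : Measurable φ) {K L δ : ℝ} (hK : ∀ x, |φ x| ≤ K)
    (hL : ∀ x y, |φ x - φ y| ≤ L * |x - y|) (hL0 : 0 ≤ L) (hδ : 0 ≤ δ) :
    |∫ ω, φ (X ω) ∂μ - ∫ ω, φ (Y ω) ∂μ|
      ≤ L * δ + 2 * K * μ.real {ω | δ < |X ω - Y ω|} := by
  have hiX : Integrable (fun ω => φ (X ω)) μ :=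
    Integrable.of_bound (hφ.comp hX).aestronglyMeasurable K (ae_of_all _ fun ω => hK _)
  have hiY : Integrable (fun ω => φ (Y ω)) μ :=
    Integrable.of_bound (hφ.comp hY).aestronglyMeasurable K (ae_of_all _ fun ω => hK _)
  have hms : MeasurableSet {ω | δ < |X ω - Y ω|} :=
    measurableSet_lt measurable_const (by fun_prop)
  have hK0 : 0 ≤ K := (abs_nonneg _).trans (hK 0)
  rw [← integral_sub hiX hiY]
  calc |∫ ω, (φ (X ω) - φ (Y ω)) ∂μ| ≤ ∫ ω, |φ (X ω) - φ (Y ω)| ∂μ := abs_integral_le_integral_abs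
    _ ≤ ∫ ω, (L * δ + {ω | δ < |X ω - Y ω|}.indicator (fun _ => 2 * K) ω) ∂μ := by
        refine integral_mono (hiX.sub hiY).abs
          ((integrable_const _).add ((integrable_const _).indicator hms)) fun ω => ?_
        by_cases h : δ < |X ω - Y ω|
        · simp only [Set.indicator, Set.mem_ofPred_eq, h, if_true]
          have h1 := abs_sub (φ (X ω)) (φ (Y ω))
          have h2 := hK (X ω)
          have h3 := hK (Y ω)
          have : 0 ≤ L * δ := by positivity
          linarith
        · simp only [Set.indicator, Set.mem_ofPred_eq, h, if_false, add_zero]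
          exact (hL _ _).trans (by gcongr; exact not_lt.1 h)
    _ = _ := by
        rw [integral_add (integrable_const _) ((integrable_const _).indicator hms),
          integral_indicator hms, setIntegral_const]
        simp
        ring

lemma abs_truncate_sub_le (M x y : ℝ) :
    |max (-M) (min M x) - max (-M) (min M y)| ≤ |x - y| := by
  have h1 := abs_max_sub_max_le_max (-M) (min M x) (-M) (min M y)
  have h2 := abs_min_sub_min_le_max M x M y
  simp only [sub_self, abs_zero, abs_nonneg, max_eq_right] at h1 h2
  exact h1.trans h2

lemma abs_min_sq_sub_le {M : ℝ} (hM : 0 ≤ M) (x y : ℝ) :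
    |min (M ^ 2) (x ^ 2) - min (M ^ 2) (y ^ 2)| ≤ 2 * M * |x - y| := by
  have e : ∀ x : ℝ, min (M ^ 2) (x ^ 2) = min M |x| ^ 2 := fun x => by
    rw [← sq_abs x]
    rcases le_total M |x| with h | h
    · rw [min_eq_left h, min_eq_left (by gcongr)]
    · rw [min_eq_right h, min_eq_right (by gcongr)]
  rw [e, e, sq_sub_sq, abs_mul]
  have h0 : ∀ x : ℝ, 0 ≤ min M |x| := fun x => le_min hM (abs_nonneg x)
  have h1 : |min M (|x|) + min M (|y|)| ≤ 2 * M := by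
    rw [abs_of_nonneg (add_nonneg (h0 x) (h0 y))]
    linarith [min_le_left M |x|, min_le_left M |y|]
  have h2 : |min M (|x|) - min M (|y|)| ≤ |x - y| := by
    refine (abs_min_sub_min_le_max M |x| M |y|).trans ?_
    simpa using abs_abs_sub_abs_le_abs_sub x y
  gcongr

/-- Truncation changes nothing when `|y| ≤ M`; beyond that, `|y| ≤ y ^ 2 ≤ y ^ 4 / M` because `1 ≤ M
< |y|`. -/
lemma abs_truncate_sub_self_le {M : ℝ} (hM : 1 ≤ M) (y : ℝ) :
    |max (-M) (min M y) - y| ≤ y ^ 4 / M ∧ |min (M ^ 2) (y ^ 2) - y ^ 2| ≤ y ^ 4 / M := by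
  have hM0 : 0 < M := by linarith
  have hnn : 0 ≤ y ^ 4 / M := by positivity
  have e4 : |y| ^ 4 = y ^ 4 := by
    rw [show 4 = 2 * 2 by rfl, pow_mul, sq_abs, ← pow_mul]
  rcases le_or_gt |y| M with h | h
  · obtain ⟨h1, h2⟩ := abs_le.1 h
    rw [min_eq_right h2, max_eq_right h1, sub_self, abs_zero, min_eq_right (sq_le_sq' h1 h2),
      sub_self, abs_zero]
    exact ⟨hnn, hnn⟩
  · have hy1 : 1 ≤ |y| := by linarith
    have b2 : |y| ^ 2 ≤ y ^ 4 / M := by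
      rw [le_div_iff₀ hM0, ← e4]
      calc |y| ^ 2 * M ≤ |y| ^ 2 * |y| ^ 2 := by
            gcongr
            exact h.le.trans (le_self_pow₀ hy1 (by norm_num))
        _ = |y| ^ 4 := by ring
    have b1 : |y| ≤ y ^ 4 / M := (le_self_pow₀ hy1 (by norm_num)).trans b2
    constructor
    · refine le_trans ?_ b1
      rcases abs_cases y with ⟨hy, h0⟩ | ⟨hy, h0⟩
      · rw [hy] at h ⊢
        rw [min_eq_left h.le, max_eq_right (by linarith), abs_le]
        constructor <;> linarith
      · rw [hy] at h ⊢
        rw [min_eq_right (by linarith), max_eq_left (by linarith), abs_le]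
        constructor <;> linarith
    · refine le_trans ?_ b2
      have h2 : M ^ 2 ≤ y ^ 2 := by rw [← sq_abs y]; gcongr
      rw [min_eq_left h2, sq_abs, abs_le]
      constructor <;> nlinarith [sq_nonneg M]

/-- Truncated moments of a variable with bounded fourth moment. -/
lemma abs_integral_truncate_le {Y : Ω → ℝ} (hY : Measurable Y) {A s M : ℝ} (hM : 1 ≤ M)
    (h4 : Integrable (fun ω => Y ω ^ 4) μ) (hA : ∫ ω, Y ω ^ 4 ∂μ ≤ A)
    (h1 : ∫ ω, Y ω ∂μ = 0) (h2 : ∫ ω, Y ω ^ 2 ∂μ = s) :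
    |∫ ω, max (-M) (min M (Y ω)) ∂μ| ≤ A / M ∧ |∫ ω, min (M ^ 2) (Y ω ^ 2) ∂μ - s| ≤ A / M := by
  have hM0 : 0 < M := by linarith
  have hb : ∀ y : ℝ, |y| ≤ 1 + y ^ 4 ∧ y ^ 2 ≤ 1 + y ^ 4 := fun y =>
    ⟨abs_le.2 ⟨by nlinarith [sq_nonneg (y ^ 2 - 1 / 2), sq_nonneg (y + 1 / 2)],
      by nlinarith [sq_nonneg (y ^ 2 - 1 / 2), sq_nonneg (y - 1 / 2)]⟩,
      by nlinarith [sq_nonneg (y ^ 2 - 1 / 2)]⟩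
  have hi : Integrable (fun ω => 1 + Y ω ^ 4) μ := (integrable_const 1).add h4
  have hi1 : Integrable Y μ := hi.mono' (by fun_prop) (ae_of_all _ fun ω => (hb _).1)
  have hi2 : Integrable (fun ω => Y ω ^ 2) μ := hi.mono' (by fun_prop) (ae_of_all _ fun ω => by
    rw [Real.norm_of_nonneg (sq_nonneg _)]; exact (hb _).2)
  have hj1 : Integrable (fun ω => max (-M) (min M (Y ω))) μ :=
    Integrable.of_bound (by fun_prop) M (ae_of_all _ fun ω => abs_le.2
      ⟨le_max_left _ _, max_le (by linarith) (min_le_left _ _)⟩)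
  have hj2 : Integrable (fun ω => min (M ^ 2) (Y ω ^ 2)) μ :=
    Integrable.of_bound (by fun_prop) (M ^ 2) (ae_of_all _ fun ω => by
      rw [Real.norm_of_nonneg (le_min (sq_nonneg _) (sq_nonneg _))]; exact min_le_left _ _)
  have hd : Integrable (fun ω => Y ω ^ 4 / M) μ := h4.div_const M
  have hfin : ∫ ω, Y ω ^ 4 / M ∂μ ≤ A / M := by
    rw [integral_div]; gcongr
  constructor
  · rw [← sub_zero (∫ ω, max (-M) (min M (Y ω)) ∂μ), ← h1, ← integral_sub hj1 hi1]
    exact abs_integral_le_integral_abs.trans ((integral_mono (hj1.sub hi1).abs hd fun ω =>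
      (abs_truncate_sub_self_le hM _).1).trans hfin)
  · rw [← h2, ← integral_sub hj2 hi2]
    exact abs_integral_le_integral_abs.trans ((integral_mono (hj2.sub hi2).abs hd fun ω =>
      (abs_truncate_sub_self_le hM _).2).trans hfin)

end Truncation

/-! ### Sampling distribution of the weighted quantile. -/

section SampleQuantile

variable {q : ℝ} {m : ℕ → ℕ} [∀ k, NeZero (m k)] {w : ∀ k, Fin (m k) → ℝ}
  {P : Measure ℝ} [IsProbabilityMeasure P] {θ f : ℝ}

/-- Bahadur's representation puts the error close in probability to `Y = -localDeviation / f` at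
`0`, whose mean and variance are exact and whose fourth moment is bounded uniformly. The truncation
is what lets closeness in probability pass to moments, as `P` need not have any. -/
lemma hasAsymptoticVariance_freqError (hq0 : 0 < q) (hq1 : q < 1) (hw : ∀ k i, 0 < w k i)
    (hn : Tendsto (fun k => nEff (w k)) atTop atTop) (hθ : cdf P θ = q) (hf0 : 0 < f)
    (hf : HasDerivAt (cdf P) f θ) :
    HasAsymptoticVariance m P (fun k => freqError (w k) q θ) (q * (1 - q) / f ^ 2) := by
  intro ε hε
  set A := 144 / f ^ 4 with hA
  have hA0 : 0 < A := by positivity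
  refine ⟨1 + 2 * A / ε, fun M hM => ?_⟩
  have hM1 : 1 ≤ M := le_trans (le_add_of_nonneg_right (by positivity)) hM
  have hM0 : 0 < M := by linarith
  have hAM : A / M ≤ ε / 2 := by
    rw [div_le_iff₀ hM0]
    have : ε / 2 * (1 + 2 * A / ε) ≤ ε / 2 * M := by gcongr
    have e : ε / 2 * (1 + 2 * A / ε) = ε / 2 + A := by field_simp
    linarith
  -- Closeness `ε / (8 * M)` meets the Lipschitz constant `2 * M`, and bad probability `ε / (8 * M ^
  -- 2)` meets the sup bound `M ^ 2`; each contributes at most `ε / 4`.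
  filter_upwards [eventually_bahadur hq0 hq1 hw hn hθ hf0 hf 0 (δ := ε / (8 * M) * f)
    (ε := ε / (8 * M ^ 2)) (by positivity) (by positivity)] with k ⟨B, hB, hB'⟩
  set μ := sampling (m k) P
  set X := freqError (w k) q θ
  set Y : (Fin (m k) → ℝ) → ℝ := fun ρ => (-1 / f) * localDeviation (w k) q θ ρ 0 with hYdef
  have hXm : Measurable X := measurable_freqError (hw k) hq0 hq1.le θ
  have hYm : Measurable Y := (measurable_localDeviation (w k) q θ 0).const_mul _
  obtain ⟨z1, z2, z3, z4⟩ := localDeviation_zero_moments (P := P) hw hθ k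
  have hprob : μ.real {ρ | ε / (8 * M) < |X ρ - Y ρ|} ≤ ε / (8 * M ^ 2) := by
    refine (measureReal_mono fun ρ (hρ : ε / (8 * M) < |X ρ - Y ρ|) => ?_).trans hB
    by_contra hcon
    have h := (hB' ρ hcon).1
    have e : X ρ - Y ρ = (localDeviation (w k) q θ ρ 0 + f * X ρ) / f := by
      rw [hYdef]; field_simp; ring
    rw [e, abs_div, abs_of_pos hf0, lt_div_iff₀ hf0] at hρ
    linarith
  have y4 : Integrable (fun ρ => Y ρ ^ 4) μ := by
    simp only [hYdef, mul_pow]; exact z3.const_mul _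
  have y4' : ∫ ρ, Y ρ ^ 4 ∂μ ≤ A := by
    simp only [hYdef, mul_pow]
    rw [integral_const_mul, hA]
    calc (-1 / f) ^ 4 * _ ≤ (-1 / f) ^ 4 * 144 := by gcongr
      _ = 144 / f ^ 4 := by ring
  have y1 : ∫ ρ, Y ρ ∂μ = 0 := by
    simp only [hYdef]; rw [integral_const_mul, z1, mul_zero]
  have y2 : ∫ ρ, Y ρ ^ 2 ∂μ = q * (1 - q) / f ^ 2 := by
    simp only [hYdef, mul_pow]; rw [integral_const_mul, z2]; ring
  obtain ⟨t1, t2⟩ := abs_integral_truncate_le hYm hM1 y4 y4' y1 y2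
  have d1 := abs_integral_comp_sub_le (μ := μ) hXm hYm (φ := fun x => max (-M) (min M x))
    (by fun_prop) (K := M) (L := 1) (δ := ε / (8 * M))
    (fun x => abs_le.2 ⟨le_max_left _ _, max_le (by linarith) (min_le_left _ _)⟩)
    (fun x y => by rw [one_mul]; exact abs_truncate_sub_le M x y) zero_le_one (by positivity)
  have d2 := abs_integral_comp_sub_le (μ := μ) hXm hYm (φ := fun x => min (M ^ 2) (x ^ 2))
    (by fun_prop) (K := M ^ 2) (L := 2 * M) (δ := ε / (8 * M))
    (fun x => by
      rw [abs_of_nonneg (le_min (sq_nonneg _) (sq_nonneg _))]; exact min_le_left _ _)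
    (fun x y => abs_min_sq_sub_le hM0.le x y) (by positivity) (by positivity)
  have b2 : 2 * M * (ε / (8 * M)) = ε / 4 := by field_simp; ring
  have b2' : 2 * M ^ 2 * μ.real {ρ | ε / (8 * M) < |X ρ - Y ρ|} ≤ ε / 4 := by
    calc _ ≤ 2 * M ^ 2 * (ε / (8 * M ^ 2)) := by gcongr
      _ = ε / 4 := by field_simp; ring
  have b1 : 1 * (ε / (8 * M)) ≤ ε / 4 := by
    rw [one_mul]
    gcongr
    linarith
  have b1' : 2 * M * μ.real {ρ | ε / (8 * M) < |X ρ - Y ρ|} ≤ ε / 4 := by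
    refine le_trans ?_ b2'
    have : M ≤ M ^ 2 := le_self_pow₀ hM1 (by norm_num)
    gcongr
  constructor
  · have := abs_sub_abs_le_abs_sub (∫ ρ, max (-M) (min M (X ρ)) ∂μ)
      (∫ ρ, max (-M) (min M (Y ρ)) ∂μ)
    linarith
  · have := abs_sub_le (∫ ρ, min (M ^ 2) (X ρ ^ 2) ∂μ) (∫ ρ, min (M ^ 2) (Y ρ ^ 2) ∂μ)
      (q * (1 - q) / f ^ 2)
    linarith

/-- The event says that the empirical process at the moving point `θ + x / √n_eff`, plus a drift
tending to `f * x`, is nonnegative. -/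
lemma tendsto_freqError_le (hq0 : 0 < q) (hq1 : q < 1) (hw : ∀ k i, 0 < w k i)
    (hn : Tendsto (fun k => nEff (w k)) atTop atTop) (hθ : cdf P θ = q) (hf0 : 0 < f)
    (hf : HasDerivAt (cdf P) f θ)
    (hmax : ∀ ε > 0, ∀ᶠ k in atTop, ∀ i, √(nEff (w k)) * normWeight (w k) i ≤ ε) (x : ℝ) :
    Tendsto (fun k => (sampling (m k) P).real {ρ | freqError (w k) q θ ρ ≤ x}) atTop
      (𝓝 ((gaussianReal 0 (q * (1 - q) / f ^ 2).toNNReal).real (Set.Iic x))) := by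
  have hv : 0 < q * (1 - q) := mul_pos hq0 (by linarith)
  rw [← gaussianReal_real_Ici x hf0 hv.le]
  have hm : ∀ k, Measurable fun ρ : Fin (m k) → ℝ => √(nEff (w k)) *
      (weightedCDF (w k) ρ (θ + x / √(nEff (w k))) - cdf P (θ + x / √(nEff (w k))))
        + √(nEff (w k)) * (cdf P (θ + x / √(nEff (w k))) - q) := fun k => by
    have := measurable_weightedCDF (w k) (θ + x / √(nEff (w k)))
    fun_prop
  have : ∀ k, IsProbabilityMeasure ((sampling (m k) P).map fun ρ => √(nEff (w k)) *
      (weightedCDF (w k) ρ (θ + x / √(nEff (w k))) - cdf P (θ + x / √(nEff (w k))))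
        + √(nEff (w k)) * (cdf P (θ + x / √(nEff (w k))) - q)) := fun k =>
    Measure.isProbabilityMeasure_map (hm k).aemeasurable
  refine (tendsto_real_Ici_of_tendsto_charFun (by simpa using hv)
    (tendsto_charFun_empirical P hw hmax (tendsto_cdf_local hn hθ hf x)
      (tendsto_local_cdf hw hn hθ hf x) hq0 hq1)).congr fun k => ?_
  rw [map_measureReal_apply (hm k) measurableSet_Ici]
  congr 1
  ext ρ
  simp only [Set.mem_preimage, Set.mem_Ici, Set.mem_ofPred_eq,
    freqError_le_iff (hw k) hq0 hq1.le, localDeviation]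
  rw [← mul_add, sub_add_sub_cancel]

end SampleQuantile

/-! ### Posterior variance at the crossing index. -/

section PosteriorVariance

/-- The cumulative sum overshoots `q` by at most the last weight added, which is at most `1 /
√n_eff` whatever the scores. -/
lemma tendsto_sum_sortedWeight_firstCrossing {q : ℝ} (hq0 : 0 < q) (hq1 : q < 1) {m : ℕ → ℕ}
    [∀ k, NeZero (m k)] {w : ∀ k, Fin (m k) → ℝ} (hw : ∀ k i, 0 < w k i)
    (hn : Tendsto (fun k => nEff (w k)) atTop atTop) (ρ : ∀ k, Fin (m k) → ℝ) :
    Tendsto (fun k => cumSum (sortedWeight (ρ k) (w k))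
      (firstCrossing q (sortedWeight (ρ k) (w k)))) atTop (𝓝 q) := by
  have hlim : Tendsto (fun k => q + 1 / √(nEff (w k))) atTop (𝓝 (q + 0)) :=
    ((tendsto_sqrt_nEff hn).const_div_atTop 1).const_add q
  rw [add_zero] at hlim
  refine tendsto_of_tendsto_of_tendsto_of_le_of_le tendsto_const_nhds hlim (fun k => ?_) fun k => ?_
  all_goals
    set v := sortedWeight (ρ k) (w k)
    set K := firstCrossing q v with hK
  · have hne : {j | q ≤ cumSum v j}.Nonempty := by
      refine ⟨⊤, ?_⟩
      simp only [Set.mem_ofPred_eq, cumSum, Finset.Iic_top]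
      rw [sum_sortedWeight (hw k)]
      exact hq1.le
    exact csInf_mem hne
  · have hsplit : cumSum v K = ∑ i ∈ Finset.Iio K, v i + v K := by
      rw [cumSum, ← Finset.Iio_insert, Finset.sum_insert (by simp), add_comm]
    have hlt : ∑ i ∈ Finset.Iio K, v i < q := by
      rcases Nat.eq_zero_or_pos (K : ℕ) with h0 | h0
      · have : Finset.Iio K = ∅ := by
          ext i
          simp [Fin.lt_def, h0]
        rw [this, Finset.sum_empty]
        exact hq0
      -- The sum strictly before `K` is the cumulative sum at the predecessor of `K`, which is below
      -- `q` by minimality.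
      · have hJ : (K : ℕ) - 1 < m k := by omega
        have : Finset.Iio K = Finset.Iic ⟨(K : ℕ) - 1, hJ⟩ := by
          ext i
          simp only [Finset.mem_Iio, Finset.mem_Iic, Fin.lt_def, Fin.le_def]
          omega
        rw [this]
        by_contra hcon
        have h1 : K ≤ ⟨(K : ℕ) - 1, hJ⟩ := csInf_le' (not_lt.1 hcon)
        rw [Fin.le_def] at h1
        simp only at h1
        omega
    have hle : v K ≤ 1 / √(nEff (w k)) := normWeight_le (w k) _
    linarith

lemma tendsto_postVar_div_freqVar_iff {q : ℝ} (hq0 : 0 < q) (hq1 : q < 1) {m : ℕ → ℕ}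
    [∀ k, NeZero (m k)] {w : ∀ k, Fin (m k) → ℝ} (hw : ∀ k i, 0 < w k i)
    (hn : Tendsto (fun k => nEff (w k)) atTop atTop) {P : Measure ℝ} [IsProbabilityMeasure P]
    {θ : ℝ} (hθ : cdf P θ = q) (ρ : ∀ k, Fin (m k) → ℝ) {c : ℕ → ℝ} (hc : ∀ k, 0 < c k) :
    Tendsto (fun k => postVar (ρ k) (w k) (c k) (firstCrossing q (sortedWeight (ρ k) (w k)))
        / freqVar (w k) P θ) atTop (𝓝 1) ↔
      Tendsto (fun k => c k / nEff (w k)) atTop (𝓝 1) := by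
  have hv : 0 < q * (1 - q) := mul_pos hq0 (by linarith)
  set p := fun k => cumSum (sortedWeight (ρ k) (w k))
      (firstCrossing q (sortedWeight (ρ k) (w k))) with hp
  have hpl : Tendsto p atTop (𝓝 q) := tendsto_sum_sortedWeight_firstCrossing hq0 hq1 hw hn ρ
  have hr : Tendsto (fun k => p k * (1 - p k) / (q * (1 - q))) atTop (𝓝 1) := by
    have := (hpl.mul (hpl.const_sub 1)).div_const (q * (1 - q))
    rwa [div_self hv.ne'] at this
  have hN : ∀ k, 0 < nEff (w k) := fun k => nEff_pos (hw k)
  have heq : ∀ k, postVar (ρ k) (w k) (c k) (firstCrossing q (sortedWeight (ρ k) (w k)))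
        / freqVar (w k) P θ = p k * (1 - p k) / (q * (1 - q)) * ((c k + 1) / nEff (w k))⁻¹ := by
    intro k
    rw [postVar_eq (hw k) (hc k), freqVar_eq, hθ]
    have h1 := hN k
    have h2 := hc k
    have h3 : 1 - q ≠ 0 := by linarith
    change p k * (1 - p k) / (c k + 1) / _ = _
    field_simp
  have hinv : Tendsto (fun k => 1 / nEff (w k)) atTop (𝓝 0) := hn.const_div_atTop 1
  simp only [heq]
  constructor
  · intro h
    have h1 := h.div hr one_ne_zero
    have h2 : Tendsto (fun k => ((c k + 1) / nEff (w k))⁻¹) atTop (𝓝 1) := by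
      rw [div_one] at h1
      refine h1.congr' ?_
      filter_upwards [hr.eventually_ne one_ne_zero] with k hk
      rw [Pi.div_apply, mul_div_cancel_left₀ _ hk]
    have h3 := (h2.inv₀ one_ne_zero).sub hinv
    simp only [inv_inv, inv_one, sub_zero] at h3
    refine h3.congr fun k => ?_
    ring
  · intro h
    have h1 := (h.add hinv).inv₀ (by norm_num)
    have h2 := hr.mul h1
    simp only [add_zero, inv_one, mul_one] at h2
    refine h2.congr fun k => ?_
    rw [add_div]

end PosteriorVariance

/-! ### Limits of the posterior law of the threshold. -/

section BernsteinVonMises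

/-- Working with exceptional sets of small outer measure avoids proving that posterior probabilities
are measurable in the scores. -/
lemma tendstoInProb_of_eventually {m : ℕ → ℕ} {P : Measure ℝ} [IsProbabilityMeasure P]
    {X : ∀ k, (Fin (m k) → ℝ) → ℝ} {a : ℝ}
    (h : ∀ ε > 0, ∀ η > 0, ∀ᶠ k in atTop, ∃ B, (sampling (m k) P).real B ≤ η ∧
      ∀ ρ ∉ B, |X k ρ - a| < ε) : TendstoInProb m P X a := by
  intro ε hε
  rw [ENNReal.tendsto_nhds_zero]
  intro η hη
  rcases eq_or_ne η ⊤ with rfl | hη'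
  · exact Eventually.of_forall fun _ => le_top
  filter_upwards [h ε hε η.toReal (ENNReal.toReal_pos hη.ne' hη')] with k ⟨B, hB, hB'⟩
  rw [← ENNReal.toReal_le_toReal (measure_ne_top _ _) hη']
  refine (measureReal_mono fun ρ hρ => ?_).trans hB
  by_contra hcon
  exact absurd (hB' ρ hcon) (not_lt.2 hρ)

lemma postError_le_iff {n : ℕ} [NeZero n] {w : Fin n → ℝ} (hw : ∀ i, 0 < w i) (ρ : Fin n → ℝ)
    (q : ℝ) (v : Fin n → ℝ) (x : ℝ) :
    postError w ρ q v ≤ x ↔ postThreshold ρ q v ≤ wcpThreshold w ρ q + x / √(nEff w) := by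
  have hs := Real.sqrt_pos.2 (nEff_pos hw)
  rw [postError, ← le_div_iff₀' hs, sub_le_iff_le_add']

variable {q : ℝ} {m : ℕ → ℕ} [∀ k, NeZero (m k)] {w : ∀ k, Fin (m k) → ℝ}
  {P : Measure ℝ} [IsProbabilityMeasure P] {θ f : ℝ}

lemma eventually_lt_of_scaled (hw : ∀ k i, 0 < w k i)
    (hn : Tendsto (fun k => nEff (w k)) atTop atTop) (hq0 : 0 < q) (hq1 : q < 1) (A : ℝ) :
    ∀ᶠ k in atTop, ∀ p, |√(nEff (w k)) * (p - q)| ≤ A → 0 < p ∧ p < 1 := by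
  have h := (tendsto_sqrt_nEff hn).const_div_atTop A
  filter_upwards [h.eventually_lt_const hq0, h.eventually_lt_const (sub_pos.2 hq1)]
    with k h1 h2 p hp
  have hs := Real.sqrt_pos.2 (nEff_pos (hw k))
  rw [abs_mul, abs_of_pos hs, ← le_div_iff₀' hs, abs_le] at hp
  constructor <;> linarith [hp.1, hp.2]

/-- The posterior distribution function at `x` is a Gamma-ratio tail at the random level `p`.
Outside a small set, `√c * (p - q) = √(c / n_eff) * √n_eff * (p - q)` is close to `√κ * f * x`, and
the uniform limit theorem applies. -/
lemma tendstoInProb_posterior_of_ratio (hq0 : 0 < q) (hq1 : q < 1) (hw : ∀ k i, 0 < w k i)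
    (hn : Tendsto (fun k => nEff (w k)) atTop atTop) (hθ : cdf P θ = q) (hf0 : 0 < f)
    (hf : HasDerivAt (cdf P) f θ) {c : ℕ → ℝ} (hc : ∀ k, 0 < c k) {κ : ℝ} (hκ : 0 < κ)
    (hcκ : Tendsto (fun k => c k / nEff (w k)) atTop (𝓝 κ)) (x : ℝ) :
    TendstoInProb m P (fun k ρ =>
        (posterior ρ (w k) (c k)).real {v | postError (w k) ρ q v ≤ x})
      ((gaussianReal 0 (q * (1 - q) / (κ * f ^ 2)).toNNReal).real (Set.Iic x)) := by
  have hv : 0 < q * (1 - q) := mul_pos hq0 (by linarith)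
  have hsκ := Real.sqrt_pos.2 hκ
  have eκ : κ * f ^ 2 = (√κ * f) ^ 2 := by rw [mul_pow, Real.sq_sqrt hκ.le]
  rw [eκ, ← gaussianReal_real_Ici x (mul_pos hsκ hf0) hv.le]
  refine tendstoInProb_of_eventually fun ε hε η hη => ?_
  obtain ⟨δ, hδ, C, hC, hnear⟩ := exists_gammaRatio_Ici_near hq0 hq1 (√κ * f * x) hε
  have hcinf : Tendsto c atTop atTop := by
    refine (hcκ.pos_mul_atTop hκ hn).congr fun k => ?_
    have := (nEff_pos (hw k)).ne'
    field_simp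
  have hsq : Tendsto (fun k => √(c k / nEff (w k))) atTop (𝓝 (√κ)) :=
    (Real.continuous_sqrt.tendsto _).comp hcκ
  have hsqd : Tendsto (fun k => |√(c k / nEff (w k)) - √κ| * |f * x|) atTop (𝓝 0) := by
    have := ((hsq.sub_const (√κ)).abs).mul_const |f * x|
    simpa using this
  set δ₁ := δ / (2 * (√κ + 1)) with hδ₁
  have hδ₁0 : 0 < δ₁ := by positivity
  filter_upwards [eventually_bahadur hq0 hq1 hw hn hθ hf0 hf x hδ₁0 hη,
    eventually_lt_of_scaled hw hn hq0 hq1 (|f * x| + δ₁),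
    hcinf.eventually_ge_atTop C, hsq.eventually_le_const (show √κ < √κ + 1 by linarith),
    hsqd.eventually_le_const (half_pos hδ)] with k ⟨B, hB, hB'⟩ h01 hCk hsk hdk
  refine ⟨B, hB, fun ρ hρ => ?_⟩
  have hlin := (hB' ρ hρ).2
  set t := wcpThreshold (w k) ρ q + x / √(nEff (w k)) with ht
  set p := weightedCDF (w k) ρ t with hp
  obtain ⟨hp0, hp1⟩ := h01 p (by
    have := abs_sub_abs_le_abs_sub (√(nEff (w k)) * (p - q)) (f * x)
    linarith)
  simp only [postError_le_iff (hw k)]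
  rw [posterior_postThreshold_le_eq (hw k) (hc k) ρ hq0 hq1.le hp0 hp1]
  refine hnear (c k) p hCk hp0 hp1 ?_
  have hN := nEff_pos (hw k)
  have e : √(c k) = √(c k / nEff (w k)) * √(nEff (w k)) := by
    rw [← Real.sqrt_mul (div_pos (hc k) hN).le, div_mul_cancel₀ _ hN.ne']
  have e2 : √(c k) * (p - q) - √κ * f * x = √(c k / nEff (w k)) *
      (√(nEff (w k)) * (p - q) - f * x) + (√(c k / nEff (w k)) - √κ) * (f * x) := by
    rw [e]; ring
  rw [e2]
  refine (abs_add_le _ _).trans ?_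
  rw [abs_mul, abs_mul (_ - _) (f * x), abs_of_nonneg (Real.sqrt_nonneg _)]
  have h1 : √(c k / nEff (w k)) * |√(nEff (w k)) * (p - q) - f * x| ≤ (√κ + 1) * δ₁ := by gcongr
  have h2 : (√κ + 1) * δ₁ = δ / 2 := by rw [hδ₁]; field_simp
  linarith

/-- At distance `x / √n_eff` on either side of the weighted-CP threshold the empirical level differs
from `q` by at least `f * x / (2 * √n_eff)`. Chebyshev's bound for each side is then of order `n_eff
/ c`. -/
lemma tendstoInProb_posterior_of_atTop (hq0 : 0 < q) (hq1 : q < 1) (hw : ∀ k i, 0 < w k i)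
    (hn : Tendsto (fun k => nEff (w k)) atTop atTop) (hθ : cdf P θ = q) (hf0 : 0 < f)
    (hf : HasDerivAt (cdf P) f θ) {c : ℕ → ℝ} (hc : ∀ k, 0 < c k)
    (hcn : Tendsto (fun k => c k / nEff (w k)) atTop atTop) {x : ℝ} (hx : 0 < x) :
    TendstoInProb m P (fun k ρ =>
      (posterior ρ (w k) (c k)).real {v | |postError (w k) ρ q v| ≤ x}) 1 := by
  refine tendstoInProb_of_eventually fun ε hε η hη => ?_
  have hfx : 0 < f * x := mul_pos hf0 hx
  have hd : 0 < f * x / 2 := half_pos hfx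
  have hlim : Tendsto (fun k => 2 / (f * x / 2) ^ 2 / (c k / nEff (w k))) atTop (𝓝 0) :=
    hcn.const_div_atTop _
  filter_upwards [eventually_bahadur hq0 hq1 hw hn hθ hf0 hf x hd (half_pos hη),
    eventually_bahadur hq0 hq1 hw hn hθ hf0 hf (-x) hd (half_pos hη),
    hlim.eventually_lt_const hε] with k ⟨B₁, hB₁, hB₁'⟩ ⟨B₂, hB₂, hB₂'⟩ hk
  refine ⟨B₁ ∪ B₂, (measureReal_union_le _ _).trans (by linarith), fun ρ hρ => ?_⟩
  rw [Set.mem_union, not_or] at hρ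
  have h1 := (abs_le.1 (hB₁' ρ hρ.1).2).1
  have h2 := (abs_le.1 (hB₂' ρ hρ.2).2).2
  have hN := nEff_pos (hw k)
  have hs := Real.sqrt_pos.2 hN
  set t₁ := wcpThreshold (w k) ρ q + x / √(nEff (w k)) with ht₁
  set t₂ := wcpThreshold (w k) ρ q + -x / √(nEff (w k)) with ht₂
  have g1 : f * x / 2 ≤ √(nEff (w k)) * (weightedCDF (w k) ρ t₁ - q) := by linarith
  have g2 : f * x / 2 ≤ √(nEff (w k)) * (q - weightedCDF (w k) ρ t₂) := by linarith
  have hbound : ∀ u, f * x / 2 ≤ √(nEff (w k)) * u →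
      0 < u ∧ 1 / (c k * u ^ 2) ≤ 1 / (f * x / 2) ^ 2 / (c k / nEff (w k)) := fun u hu => by
    have hu0 : 0 < u := by
      by_contra hcon
      have := mul_nonpos_of_nonneg_of_nonpos hs.le (not_lt.1 hcon)
      linarith
    refine ⟨hu0, ?_⟩
    have h3 : (f * x / 2) ^ 2 ≤ nEff (w k) * u ^ 2 := by
      calc (f * x / 2) ^ 2 ≤ (√(nEff (w k)) * u) ^ 2 := by gcongr
        _ = _ := by rw [mul_pow, Real.sq_sqrt hN.le]
    have hck := hc k
    rw [div_div, div_le_div_iff₀ (by positivity) (by positivity), one_mul, one_mul]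
    calc (f * x / 2) ^ 2 * (c k / nEff (w k)) ≤ nEff (w k) * u ^ 2 * (c k / nEff (w k)) := by gcongr
      _ = c k * u ^ 2 := by field_simp
  obtain ⟨u1, b1⟩ := hbound _ g1
  obtain ⟨u2, b2⟩ := hbound _ g2
  have hprob := isProbabilityMeasure_posterior (hw k) (hc k) ρ
  have p1 := posterior_lt_postThreshold_le (hw k) (hc k) ρ hq0 hq1.le (sub_pos.1 u1)
  have p2 := posterior_postThreshold_le_le (hw k) (hc k) ρ hq0 hq1.le (sub_pos.1 u2)
  have hcover : (Set.univ : Set (Fin (m k) → ℝ)) ⊆ {v | |postError (w k) ρ q v| ≤ x} ∪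
      ({v | t₁ < postThreshold ρ q v} ∪ {v | postThreshold ρ q v ≤ t₂}) := by
    intro v _
    by_contra hcon
    simp only [Set.mem_union, Set.mem_ofPred_eq, not_or, not_lt] at hcon
    obtain ⟨c1, c2, c3⟩ := hcon
    rw [ht₁, ← postError_le_iff (hw k)] at c2
    rw [ht₂, ← postError_le_iff (hw k)] at c3
    exact c1 (abs_le.2 ⟨(not_le.1 c3).le, c2⟩)
  have htot := (measureReal_mono (μ := posterior ρ (w k) (c k)) hcover).trans
    ((measureReal_union_le _ _).trans (add_le_add_right (measureReal_union_le _ _) _))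
  rw [probReal_univ] at htot
  have hle : (posterior ρ (w k) (c k)).real {v | |postError (w k) ρ q v| ≤ x} ≤ 1 :=
    measureReal_le_one
  have e : 2 / (f * x / 2) ^ 2 / (c k / nEff (w k))
      = 1 / (f * x / 2) ^ 2 / (c k / nEff (w k)) + 1 / (f * x / 2) ^ 2 / (c k / nEff (w k)) := by
    ring
  rw [abs_lt]
  constructor <;> linarith

/-- The window carries expected mass of order `1 / √n_eff`, negligible against the scale `1 / √(c +
1)`. Taking `ζ` as a small multiple of this scale makes both terms of the window bound small. -/
lemma tendstoInProb_posterior_of_zero (hq0 : 0 < q) (hq1 : q < 1) (hw : ∀ k i, 0 < w k i)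
    (hn : Tendsto (fun k => nEff (w k)) atTop atTop) (hθ : cdf P θ = q) (hf0 : 0 < f)
    (hf : HasDerivAt (cdf P) f θ) {c : ℕ → ℝ} (hc : ∀ k, 0 < c k)
    (hcn : Tendsto (fun k => c k / nEff (w k)) atTop (𝓝 0)) {x : ℝ} (hx : 0 < x) :
    TendstoInProb m P (fun k ρ =>
      (posterior ρ (w k) (c k)).real {v | |postError (w k) ρ q v| ≤ x}) 0 := by
  refine tendstoInProb_of_eventually fun ε hε η hη => ?_
  have h1q : 0 < 1 - q := by linarith
  set E := Real.exp (1 / 2) with hE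
  have hE0 : 0 < E := Real.exp_pos _
  obtain ⟨δ, hδ0, hδq, hδε⟩ : ∃ δ > 0, δ ≤ q / 2 ∧ 2 * E * δ / ((1 - q) * q) ≤ ε / 2 := by
    refine ⟨min (q / 2) (ε * ((1 - q) * q) / (4 * E)), lt_min (by positivity) (by positivity),
      min_le_left _ _, ?_⟩
    rw [div_le_iff₀ (by positivity)]
    have := min_le_right (q / 2) (ε * ((1 - q) * q) / (4 * E))
    rw [le_div_iff₀ (by positivity)] at this
    linarith
  -- Slope times the window length `2 * x + 1`, plus one unit of linearization error at each end.
  -- The left end is `-x - 1` rather than `-x` because the window bound is strict on the left.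
  set A := f * (2 * x + 1) + 2 with hA
  have hA0 : 0 < A := by positivity
  have hlim : Tendsto (fun k => A / δ * √((c k + 1) / nEff (w k))) atTop (𝓝 0) := by
    have h1 : Tendsto (fun k => (c k + 1) / nEff (w k)) atTop (𝓝 0) := by
      have := hcn.add (hn.const_div_atTop 1)
      rw [add_zero] at this
      exact this.congr fun k => (add_div _ _ _).symm
    have := ((Real.continuous_sqrt.tendsto _).comp h1).const_mul (A / δ)
    simpa using this
  filter_upwards [eventually_bahadur hq0 hq1 hw hn hθ hf0 hf x one_pos (half_pos hη),
    eventually_bahadur hq0 hq1 hw hn hθ hf0 hf (-x - 1) one_pos (half_pos hη),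
    eventually_lt_of_scaled hw hn hq0 hq1 (|f * (-x - 1)| + 1),
    hlim.eventually_lt_const (half_pos hε)] with k ⟨B₁, hB₁, hB₁'⟩ ⟨B₂, hB₂, hB₂'⟩ h01 hk
  refine ⟨B₁ ∪ B₂, (measureReal_union_le _ _).trans (by linarith), fun ρ hρ => ?_⟩
  rw [Set.mem_union, not_or] at hρ
  have h1 := (abs_le.1 (hB₁' ρ hρ.1).2).2
  have h2 := (abs_le.1 (hB₂' ρ hρ.2).2).1
  have h2' := (hB₂' ρ hρ.2).2
  have hN := nEff_pos (hw k)
  have hs := Real.sqrt_pos.2 hN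
  set t := wcpThreshold (w k) ρ q + x / √(nEff (w k)) with ht
  set s := wcpThreshold (w k) ρ q + (-x - 1) / √(nEff (w k)) with hsdef
  have hst : s ≤ t := by
    rw [ht, hsdef]
    gcongr
    linarith
  obtain ⟨hp0, hp1⟩ := h01 (weightedCDF (w k) ρ s) (by
    have := abs_sub_abs_le_abs_sub (√(nEff (w k)) * (weightedCDF (w k) ρ s - q)) (f * (-x - 1))
    linarith)
  have hck := hc k
  have hsc : 1 ≤ √(c k + 1) := Real.one_le_sqrt.2 (by linarith)
  have hsc0 : 0 < √(c k + 1) := by linarith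
  -- With `c + 1` in place of `c`, `ζ ≤ δ ≤ q / 2` holds even when the concentrations are small.
  set ζ := δ / √(c k + 1) with hζ
  have hζ0 : 0 < ζ := by positivity
  have hζδ : ζ ≤ δ := div_le_self hδ0.le hsc
  have hmain := posterior_postThreshold_Ioc_le (hw k) hck ρ hq0 hq1 hst hp0 hp1 hζ0
    (by linarith : ζ < q)
  have hprob := isProbabilityMeasure_posterior (hw k) hck ρ
  have hsub : {v | |postError (w k) ρ q v| ≤ x} ⊆
      {v | s < postThreshold ρ q v ∧ postThreshold ρ q v ≤ t} := by
    intro v (hv : |_| ≤ x)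
    obtain ⟨v1, v2⟩ := abs_le.1 hv
    refine ⟨not_le.1 fun hcon => ?_, (postError_le_iff (hw k) ρ q v x).1 v2⟩
    have := (postError_le_iff (hw k) ρ q v (-x - 1)).2 hcon
    linarith
  have hle := (measureReal_mono (μ := posterior ρ (w k) (c k)) hsub).trans hmain
  have hdiff : weightedCDF (w k) ρ t - weightedCDF (w k) ρ s ≤ A / √(nEff (w k)) := by
    rw [le_div_iff₀ hs]
    linarith
  have b1 : (weightedCDF (w k) ρ t - weightedCDF (w k) ρ s) / ζ
      ≤ A / δ * √((c k + 1) / nEff (w k)) := by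
    calc _ ≤ A / √(nEff (w k)) / ζ := by gcongr
      _ = A / δ * √((c k + 1) / nEff (w k)) := by
          rw [hζ, Real.sqrt_div (by linarith)]
          field_simp
  have b2 : √(c k) * E * (ζ / ((1 - q) * (q - ζ))) ≤ 2 * E * δ / ((1 - q) * q) := by
    have hq2 : q / 2 ≤ q - ζ := by linarith
    have hz : 0 < q - ζ := by linarith
    calc √(c k) * E * (ζ / ((1 - q) * (q - ζ)))
        ≤ √(c k + 1) * E * (ζ / ((1 - q) * (q / 2))) := by
          gcongr
          linarith
      _ = 2 * E * δ / ((1 - q) * q) := by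
          rw [hζ]
          field_simp
  rw [sub_zero, abs_of_nonneg measureReal_nonneg]
  linarith

end BernsteinVonMises

end WBCP

theorem theorem1 (q : ℝ) (hq0 : 0 < q) (hq1 : q < 1) :
    -- mean consistency
    (∀ (n : ℕ) [NeZero n] (ρ w : Fin n → ℝ), (∀ i, 0 < w i) →
      WBCP.weightedCDF w ρ (WBCP.wcpThreshold w ρ q) ≠ q →
      ∃ C : ℝ, ∀ c : ℝ, 0 < c →
        |(∫ v, WBCP.postThreshold ρ q v ∂(WBCP.posterior ρ w c)) - WBCP.wcpThreshold w ρ q|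
          ≤ C / c) ∧
    -- posterior variance of the cumulative sums
    (∀ (n : ℕ) [NeZero n] (ρ w : Fin n → ℝ), (∀ i, 0 < w i) → ∀ c : ℝ, 0 < c → ∀ j : Fin n,
      WBCP.postVar ρ w c j =
        WBCP.cumSum (WBCP.sortedWeight ρ w) j * (1 - WBCP.cumSum (WBCP.sortedWeight ρ w) j)
          / (c + 1)) ∧
    -- frequentist variance of the weighted empirical distribution function
    (∀ (n : ℕ) [NeZero n] (w : Fin n → ℝ), (∀ i, 0 < w i) →
      ∀ (P : Measure ℝ) [IsProbabilityMeasure P] (t : ℝ),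
        WBCP.freqVar w P t = cdf P t * (1 - cdf P t) / WBCP.nEff w ∧
        ∀ (Q : Measure ℝ) [IsProbabilityMeasure Q],
          |WBCP.freqVar w P t - cdf Q t * (1 - cdf Q t) / WBCP.nEff w|
            ≤ |cdf P t - cdf Q t| / WBCP.nEff w) ∧
    -- exact matching at a common level: `c = n_eff - 1`, and the error of `c = n_eff`
    (∀ (n : ℕ) [NeZero n] (ρ w : Fin n → ℝ), (∀ i, 0 < w i) →
      ∀ (P : Measure ℝ) [IsProbabilityMeasure P] (t : ℝ) (j : Fin n),
        0 < cdf P t → cdf P t < 1 → WBCP.cumSum (WBCP.sortedWeight ρ w) j = cdf P t →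
        (∀ c : ℝ, 0 < c →
          (WBCP.postVar ρ w c j = WBCP.freqVar w P t ↔ c = WBCP.nEff w - 1) ∧
          (WBCP.postVar ρ w c j < WBCP.freqVar w P t ↔ WBCP.nEff w - 1 < c)) ∧
        |WBCP.postVar ρ w (WBCP.nEff w) j - WBCP.freqVar w P t|
          ≤ WBCP.freqVar w P t / WBCP.nEff w) ∧
    -- asymptotics along any sequence of weight profiles with `n_eff → ∞`
    (∀ (m : ℕ → ℕ) [∀ k, NeZero (m k)] (w : ∀ k, Fin (m k) → ℝ), (∀ k i, 0 < w k i) →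
      Tendsto (fun k => WBCP.nEff (w k)) atTop atTop →
      ∀ (P : Measure ℝ) [IsProbabilityMeasure P] (θ : ℝ), cdf P θ = q →
      -- asymptotic uniqueness of `c = n_eff` at the quantile
      (∀ (ρ : ∀ k, Fin (m k) → ℝ) (c : ℕ → ℝ), (∀ k, 0 < c k) →
        (Tendsto (fun k =>
            WBCP.postVar (ρ k) (w k) (c k)
                (WBCP.firstCrossing q (WBCP.sortedWeight (ρ k) (w k)))
              / WBCP.freqVar (w k) P θ) atTop (𝓝 1) ↔
          Tendsto (fun k => c k / WBCP.nEff (w k)) atTop (𝓝 1))) ∧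
      -- Bernstein–von Mises alignment, for a score density `f > 0` at the quantile `θ`
      ∀ f : ℝ, 0 < f → HasDerivAt (cdf P) f θ →
        -- sampling distribution of the weighted sample quantile
        WBCP.HasAsymptoticVariance m P (fun k => WBCP.freqError (w k) q θ)
          (q * (1 - q) / f ^ 2) ∧
        ((∀ ε > 0, ∀ᶠ k in atTop, ∀ i, √(WBCP.nEff (w k)) * WBCP.normWeight (w k) i ≤ ε) →
          ∀ x : ℝ, Tendsto (fun k =>
              (WBCP.sampling (m k) P).real {ρ | WBCP.freqError (w k) q θ ρ ≤ x}) atTop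
            (𝓝 ((gaussianReal 0 (q * (1 - q) / f ^ 2).toNNReal).real (Set.Iic x)))) ∧
        -- posterior distribution with `c = n_eff`
        (∀ x : ℝ, WBCP.TendstoInProb m P (fun k ρ =>
            (WBCP.posterior ρ (w k) (WBCP.nEff (w k))).real {v | WBCP.postError (w k) ρ q v ≤ x})
          ((gaussianReal 0 (q * (1 - q) / f ^ 2).toNNReal).real (Set.Iic x))) ∧
        -- posterior distribution with any other concentration
        ∀ c : ℕ → ℝ, (∀ k, 0 < c k) →
          (∀ κ : ℝ, 0 < κ → Tendsto (fun k => c k / WBCP.nEff (w k)) atTop (𝓝 κ) →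
            ∀ x : ℝ, WBCP.TendstoInProb m P (fun k ρ =>
                (WBCP.posterior ρ (w k) (c k)).real {v | WBCP.postError (w k) ρ q v ≤ x})
              ((gaussianReal 0 (q * (1 - q) / (κ * f ^ 2)).toNNReal).real (Set.Iic x))) ∧
          (Tendsto (fun k => c k / WBCP.nEff (w k)) atTop atTop →
            ∀ x : ℝ, 0 < x → WBCP.TendstoInProb m P (fun k ρ =>
                (WBCP.posterior ρ (w k) (c k)).real {v | |WBCP.postError (w k) ρ q v| ≤ x}) 1) ∧
          (Tendsto (fun k => c k / WBCP.nEff (w k)) atTop (𝓝 0) →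
            ∀ x : ℝ, 0 < x → WBCP.TendstoInProb m P (fun k ρ =>
                (WBCP.posterior ρ (w k) (c k)).real {v | |WBCP.postError (w k) ρ q v| ≤ x}) 0)) := by
  refine ⟨fun n _ ρ w hw hne => WBCP.posterior_mean_sub_le hw ρ hq0 hq1 hne,
    fun n _ ρ w hw c hc j => WBCP.postVar_eq hw hc ρ j, fun n _ w hw P _ t => ?_,
    fun n _ ρ w hw P _ t j ht0 ht1 hj => ?_, fun m _ w hw hn P _ θ hθ =>
      ⟨fun ρ c hc => WBCP.tendsto_postVar_div_freqVar_iff hq0 hq1 hw hn hθ ρ hc,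
        fun f hf0 hf => ⟨WBCP.hasAsymptoticVariance_freqError hq0 hq1 hw hn hθ hf0 hf,
          fun hmax x => WBCP.tendsto_freqError_le hq0 hq1 hw hn hθ hf0 hf hmax x, fun x => ?_,
          fun c hc =>
            ⟨fun κ hκ h x => WBCP.tendstoInProb_posterior_of_ratio hq0 hq1 hw hn hθ hf0 hf hc hκ h x,
              fun h x hx => WBCP.tendstoInProb_posterior_of_atTop hq0 hq1 hw hn hθ hf0 hf hc h hx,
              fun h x hx =>
                WBCP.tendstoInProb_posterior_of_zero hq0 hq1 hw hn hθ hf0 hf hc h hx⟩⟩⟩⟩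
  · refine ⟨WBCP.freqVar_eq P w t, fun Q _ => ?_⟩
    have hN := WBCP.nEff_pos hw
    rw [WBCP.freqVar_eq, ← sub_div, abs_div, abs_of_pos hN]
    refine div_le_div_of_nonneg_right ?_ hN.le
    have e : cdf P t * (1 - cdf P t) - cdf Q t * (1 - cdf Q t)
        = (cdf P t - cdf Q t) * (1 - cdf P t - cdf Q t) := by ring
    rw [e, abs_mul]
    refine mul_le_of_le_one_right (abs_nonneg _) (abs_le.2 ⟨?_, ?_⟩)
    · linarith [cdf_le_one P t, cdf_le_one Q t]
    · linarith [cdf_nonneg P t, cdf_nonneg Q t]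
  · have hN := WBCP.nEff_pos hw
    have hv : 0 < cdf P t * (1 - cdf P t) := mul_pos ht0 (by linarith)
    rw [WBCP.freqVar_eq]
    refine ⟨fun c hc => ?_, ?_⟩
    · rw [WBCP.postVar_eq hw hc, hj]
      have hc1 : 0 < c + 1 := by linarith
      constructor
      · rw [div_eq_div_iff hc1.ne' hN.ne', mul_right_inj' hv.ne']
        constructor <;> intro h <;> linarith
      · rw [div_lt_div_iff_of_pos_left hv hc1 hN]
        constructor <;> intro h <;> linarith
    · rw [WBCP.postVar_eq hw hN, hj]
      have hN1 : 0 < WBCP.nEff w + 1 := by linarith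
      have e : cdf P t * (1 - cdf P t) / (WBCP.nEff w + 1) - cdf P t * (1 - cdf P t) / WBCP.nEff w
          = -(cdf P t * (1 - cdf P t) / WBCP.nEff w / (WBCP.nEff w + 1)) := by
        field_simp
        ring
      rw [e, abs_neg, abs_of_pos (by positivity)]
      gcongr
      linarith
  -- The calibrated concentration is the case `κ = 1`.
  · have h := WBCP.tendstoInProb_posterior_of_ratio hq0 hq1 hw hn hθ hf0 hf
      (fun k => WBCP.nEff_pos (hw k)) one_pos
      (tendsto_const_nhds.congr fun k => (div_self (WBCP.nEff_pos (hw k)).ne').symm) x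
    rwa [one_mul] at h
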